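/- Let $G$ be a compact (real, smooth) Lie group with identity component $G^0$ and Lie algebra $\mathfrak g\cong\mathfrak{su}_2$, and let $G\to \mathrm{GL}(V)$ be a (smooth) linear representation in a finite-dimensional real vector space $V$. Let $n_1\ge\dots\ge n_L$ be the dimensions of the irreducible components of the associated representation of $\mathfrak g$ in $V$ (with multiplicities), and let $l$ be the number of those $n_i$ that are greater than $1$. Suppose that one of the following holds: 1. $l=2$, $n_1=n_2=4$; 2. $l=2$, $n_1=4$, $n_2=3$; 3. $l=3$, $n_1=n_2=n_3=3$. Then $V/G^0$ is diffeomorphic to a vector space $U$, i.e. there is a homeomorphism $V/G^0\to U$ onto a finite-dimensional real vector space $U$ such that the resulting quotient map $\pi\colon V\to U$ is smooth; moreover, the finite group $G/G^0$ acts linearly on $U\cong V/G^0$ (there is a linear representation $\sigma$ of $G/G^0$ in $U$ with $\pi(gv)=\sigma(gG^0)\pi(v)$ for all $g\in G$, $v\in V$). The identification of $V/G^0$ with $U$ can be chosen as follows. Put $V_0=\{v\in V: G^0v=\{v\}\}$. There are a linear isomorphism $V\cong V_0\oplus M$ that is $v\mapsto (v,0)$ on $V_0$, such that $G^0$ acts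 trivially on $V_0$ and acts on $M$ exactly by the transformations given below, and a linear isomorphism $U\cong V_0\oplus N$ under which $\pi$ becomes $(v_0,x)\mapsto(v_0,q(x))$. Here, with $\mathbb H$ the quaternions and $\mathbb H_0\subset\mathbb H$ the purely imaginary ones: 1. $M=\mathbb H\oplus\mathbb H$, the transformations are $(z_1,z_2)\mapsto(z_1h^{-1},z_2h^{-1})$ with $h\in\mathbb H$, $|h|=1$; $N=\mathbb R\oplus\mathbb H$ and $q(z_1,z_2)=(|z_1|^2-|z_2|^2,\ z_1\overline{z_2})$; 2. $M=\mathbb H\oplus\mathbb H_0$, the transformations are $(z,z_0)\mapsto(zh^{-1},hz_0h^{-1})$ with $h\in\mathbb H$, $|h|=1$; $N=\mathbb R\oplus\mathbb H_0$ and $q(z,z_0)=(|z|^2-|z_0|^2,\ zz_0\overline{z})$; 3. $M=\mathrm{Mat}_{3\times3}(\mathbb R)$, the transformations are $A\mapsto AC^{-1}$ with $C\in \mathbf{SO}_3$; $N=(S/\mathbb RE)\oplus\mathbb R$, where $S$ is the space of real symmetric $3\times 3$ matrices and $E$ is the identity matrix, and $q(A)=(AA^T+\mathbb RE,\ \det A)$.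 -/

import Mathlib

open scoped Manifold ContDiff Quaternion

noncomputable section

namespace OrbitSpaceSU2

/-- A smooth real Lie group is regular enough for Mathlib's bracket on its tangent space at 1. -/
instance instLieGroupMinSmoothness {d : ℕ} {G : Type*} [TopologicalSpace G]
    [ChartedSpace (EuclideanSpace ℝ (Fin d)) G] [Group G] [LieGroup (𝓡 d) ∞ G] :
    LieGroup (𝓡 d) (minSmoothness ℝ 3) G := by
  rw [minSmoothness_of_isRCLikeNormedField]
  infer_instance

section SpecialUnitary

attribute [local instance] LieRing.ofAssociativeRing

/-- The Lie algebra of traceless skew-Hermitian complex `2 × 2` matrices, with the commutator. -/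
def su2 : LieSubalgebra ℝ (Matrix (Fin 2) (Fin 2) ℂ) where
  carrier := {A | A.conjTranspose = -A ∧ A.trace = 0}
  add_mem' := by
    rintro A B ⟨hA, hA'⟩ ⟨hB, hB'⟩
    refine ⟨?_, ?_⟩
    · rw [Matrix.conjTranspose_add, hA, hB, neg_add]
    · rw [Matrix.trace_add, hA', hB', add_zero]
  zero_mem' := by simp
  smul_mem' := by
    rintro c A ⟨hA, hA'⟩
    refine ⟨?_, ?_⟩
    · rw [Matrix.conjTranspose_smul, hA, star_trivial, smul_neg]
    · rw [Matrix.trace_smul, hA', smul_zero]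
  lie_mem' := by
    rintro A B ⟨hA, -⟩ ⟨hB, -⟩
    refine ⟨?_, ?_⟩
    · rw [Ring.lie_def, Matrix.conjTranspose_sub, Matrix.conjTranspose_mul,
        Matrix.conjTranspose_mul, hA, hB]
      noncomm_ring
    · rw [Ring.lie_def, Matrix.trace_sub, Matrix.trace_mul_comm, sub_self]

end SpecialUnitary

section Representation

variable {d : ℕ} {G : Type*} [TopologicalSpace G] [ChartedSpace (EuclideanSpace ℝ (Fin d)) G]
  [Group G] {V : Type*} [NormedAddCommGroup V] [NormedSpace ℝ V]

/-- The differential at the identity of a representation `ρ`: the associated action of the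
Lie algebra of `G` on `V`. -/
def lieAction (ρ : G →* (V →L[ℝ] V)) : GroupLieAlgebra (𝓡 d) G →L[ℝ] (V →L[ℝ] V) :=
  mfderiv (𝓡 d) 𝓘(ℝ, V →L[ℝ] V) (fun g : G => ρ g) 1

/-- The subspace `W` is invariant under the action of the Lie algebra of `G`. -/
def IsLieInvariant (ρ : G →* (V →L[ℝ] V)) (W : Submodule ℝ V) : Prop :=
  ∀ X : GroupLieAlgebra (𝓡 d) G, ∀ w ∈ W, lieAction ρ X w ∈ W

/-- The subspace `W` is an irreducible subrepresentation for the Lie algebra of `G`. -/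
def IsLieIrreducible (ρ : G →* (V →L[ℝ] V)) (W : Submodule ℝ V) : Prop :=
  W ≠ ⊥ ∧ IsLieInvariant (d := d) ρ W ∧
    ∀ U : Submodule ℝ V, U ≤ W → IsLieInvariant (d := d) ρ U → U = ⊥ ∨ U = W

/-- `V` is a direct sum of irreducible subrepresentations for the Lie algebra of `G`, and the
dimensions of those of dimension greater than `1` form the multiset `s`. -/
def HasNontrivialComponentDims (ρ : G →* (V →L[ℝ] V)) (s : Multiset ℕ) : Prop :=
  ∃ (L : ℕ) (W : Fin L → Submodule ℝ V), DirectSum.IsInternal W ∧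
    (∀ i, IsLieIrreducible (d := d) ρ (W i)) ∧
    ((Finset.univ : Finset (Fin L)).val.map fun i => Module.finrank ℝ (W i)).filter (1 < ·) = s

end Representation

section Orbits

variable {G : Type*} [TopologicalSpace G] [Group G] [IsTopologicalGroup G]
  {V : Type*} [NormedAddCommGroup V] [NormedSpace ℝ V]

/-- The identity component of `G`. -/
abbrev idComponent (G : Type*) [TopologicalSpace G] [Group G] [IsTopologicalGroup G] :
    Subgroup G :=
  Subgroup.connectedComponentOfOne G

/-- The identity component is normal, so that the component group `G ⧸ idComponent G` makes
sense. -/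
instance instNormalIdComponent : (idComponent G).Normal where
  conj_mem := by
    intro n hn g
    have hc : Continuous fun x : G => g * x * g⁻¹ := by fun_prop
    have h := hc.image_connectedComponent_subset 1 ⟨n, hn, rfl⟩
    rw [mul_one, mul_inv_cancel] at h
    exact h

/-- Two vectors are equivalent if they lie in one orbit of the identity component. -/
def orbitSetoid (ρ : G →* (V →L[ℝ] V)) : Setoid V where
  r v w := ∃ g ∈ idComponent G, ρ g v = w
  iseqv :=
    { refl := fun v => ⟨1, one_mem _, by simp⟩
      symm := by
        rintro v w ⟨g, hg, rfl⟩
        refine ⟨g⁻¹, inv_mem hg, ?_⟩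
        change (ρ g⁻¹ * ρ g) v = v
        rw [← map_mul, inv_mul_cancel, map_one]
        rfl
      trans := by
        rintro u v w ⟨g, hg, rfl⟩ ⟨h, hh, rfl⟩
        refine ⟨h * g, mul_mem hh hg, ?_⟩
        rw [map_mul]
        rfl }

/-- The orbit space of the identity component, with the quotient topology. -/
abbrev OrbitSpace (ρ : G →* (V →L[ℝ] V)) : Type _ := Quotient (orbitSetoid ρ)

/-- The projection of `V` onto the orbit space of the identity component. -/
def toOrbit (ρ : G →* (V →L[ℝ] V)) (v : V) : OrbitSpace ρ := Quotient.mk (orbitSetoid ρ) v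

/-- The subspace of vectors fixed by the identity component. -/
def fixedSubspace (ρ : G →* (V →L[ℝ] V)) : Submodule ℝ V where
  carrier := {v | ∀ g ∈ idComponent G, ρ g v = v}
  add_mem' := by
    intro v w hv hw g hg
    rw [map_add, hv g hg, hw g hg]
  zero_mem' := fun g _ => map_zero (ρ g)
  smul_mem' := by
    intro c v hv g hg
    rw [map_smul, hv g hg]

/-- In suitable linear coordinates `e` on `V` and `ι` on the target of `φ`, the identity component
acts on `V = V₀ × M` (with `V₀` its fixed subspace) trivially on `V₀` and through all the
transformations `act s` on `M`, and the quotient map `V → ℝᵐ` given by `φ` is `id × q`. -/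
def HasExplicitQuotientMap (ρ : G →* (V →L[ℝ] V)) {m : ℕ}
    (φ : OrbitSpace ρ ≃ₜ EuclideanSpace ℝ (Fin m))
    {S M N : Type*} [AddCommGroup M] [Module ℝ M] [AddCommGroup N] [Module ℝ N]
    (act : S → M → M) (q : M → N) : Prop :=
  ∃ (e : V ≃ₗ[ℝ] fixedSubspace ρ × M)
    (ι : EuclideanSpace ℝ (Fin m) ≃ₗ[ℝ] fixedSubspace ρ × N),
    (∀ v : fixedSubspace ρ, e v = (v, 0)) ∧
    (∀ g ∈ idComponent G, ∃ s : S, ∀ v, e (ρ g v) = ((e v).1, act s (e v).2)) ∧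
    (∀ s : S, ∃ g ∈ idComponent G, ∀ v, e (ρ g v) = ((e v).1, act s (e v).2)) ∧
    ∀ v, ι (φ (toOrbit ρ v)) = ((e v).1, q (e v).2)

end Orbits

section Models

/-- Quaternions of norm `1`. -/
abbrev UnitQuaternion : Type := {h : ℍ[ℝ] // ‖h‖ = 1}

/-- The space of purely imaginary quaternions. -/
def pureIm : Submodule ℝ ℍ[ℝ] where
  carrier := {z | z.re = 0}
  add_mem' := by
    intro a b ha hb
    simp only [Set.mem_ofPred_eq] at ha hb ⊢
    simp [ha, hb]
  zero_mem' := by simp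
  smul_mem' := by
    intro c a ha
    simp only [Set.mem_ofPred_eq] at ha ⊢
    simp [ha]

/-- The map `x ↦ z x z̄` on purely imaginary quaternions. -/
def twist (z : ℍ[ℝ]) (x : pureIm) : pureIm :=
  ⟨z * x * star z, by
    have hx : (x : ℍ[ℝ]).re = 0 := x.2
    change (z * x * star z).re = 0
    simp only [Quaternion.re_mul, Quaternion.imI_mul, Quaternion.imJ_mul, Quaternion.imK_mul,
      Quaternion.re_star, Quaternion.imI_star, Quaternion.imJ_star, Quaternion.imK_star, hx]
    ring⟩

/-- Unit quaternions acting on `ℍ ⊕ ℍ` by `(z₁, z₂) ↦ (z₁h⁻¹, z₂h⁻¹)`. -/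
def act44 (h : UnitQuaternion) (z : ℍ[ℝ] × ℍ[ℝ]) : ℍ[ℝ] × ℍ[ℝ] :=
  (z.1 * (h : ℍ[ℝ])⁻¹, z.2 * (h : ℍ[ℝ])⁻¹)

/-- The map `(z₁, z₂) ↦ (|z₁|² - |z₂|², z₁ z̄₂)`. -/
def quot44 (z : ℍ[ℝ] × ℍ[ℝ]) : ℝ × ℍ[ℝ] := (‖z.1‖ ^ 2 - ‖z.2‖ ^ 2, z.1 * star z.2)

/-- Unit quaternions acting on `ℍ ⊕ ℍ₀` by `(z, z₀) ↦ (zh⁻¹, h z₀ h⁻¹)`; here `h⁻¹ = h̄`. -/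
def act43 (h : UnitQuaternion) (z : ℍ[ℝ] × pureIm) : ℍ[ℝ] × pureIm :=
  (z.1 * (h : ℍ[ℝ])⁻¹, twist h z.2)

/-- The map `(z, z₀) ↦ (|z|² - |z₀|², z z₀ z̄)`. -/
def quot43 (z : ℍ[ℝ] × pureIm) : ℝ × pureIm :=
  (‖z.1‖ ^ 2 - ‖(z.2 : ℍ[ℝ])‖ ^ 2, twist z.1 z.2)

/-- Real symmetric `3 × 3` matrices. -/
def symMat : Submodule ℝ (Matrix (Fin 3) (Fin 3) ℝ) where
  carrier := {A | A.IsSymm}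
  add_mem' := fun ha hb => ha.add hb
  zero_mem' := Matrix.isSymm_zero
  smul_mem' := fun c _ ha => ha.smul c

/-- The line of scalar matrices in the space of symmetric matrices. -/
def scalarLine : Submodule ℝ symMat := Submodule.span ℝ {⟨1, Matrix.isSymm_one⟩}

/-- The group `SO(3)` acting on `3 × 3` matrices by `A ↦ A C⁻¹`. -/
def act333 (C : Matrix.specialOrthogonalGroup (Fin 3) ℝ) (A : Matrix (Fin 3) (Fin 3) ℝ) :
    Matrix (Fin 3) (Fin 3) ℝ :=
  A * (C : Matrix (Fin 3) (Fin 3) ℝ)⁻¹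

/-- The map `A ↦ (A Aᵀ mod ℝE, det A)`. -/
def quot333 (A : Matrix (Fin 3) (Fin 3) ℝ) : (symMat ⧸ scalarLine) × ℝ :=
  (scalarLine.mkQ ⟨A * A.transpose, Matrix.isSymm_mul_transpose_self A⟩, A.det)

end Models

end OrbitSpaceSU2

end

/-! The Lie algebra is ℝ³ with the cross product, so differentiating `ρ` gives operators X₀, X₁, X₂
with [X₀, X₁] = X₂ and cyclically, skew for an inner product averaged over the compact group. Since
G⁰ is connected, its fixed vectors, the operators commuting with it, its invariant functions and its
flows can all be read off from the Xₖ; `exists_isInfinitesimalModel` records this, and afterwards no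
manifold is needed.

Skew operators on ℝ⁴ are z ↦ az + zb with a, b imaginary quaternions, and skew operators on ℝ³ are
cross products. Hence a four-dimensional component must satisfy the relations of the spin
representation on ℍ (`isSpinHalf_of_finrank_eq_four`), and a three-dimensional one those of the
adjoint representation (`isSpinOne_of_finrank_eq_three`). Orthonormal generating vectors then
identify V isometrically with V₀ ⊕ M (`exists_isLinearModel44`, `exists_isLinearModel43`,
`exists_isLinearModel333`). The commutant of the generators contains left multiplications, which
forces G⁰ to act by right multiplications. The invariant z z₀ z̄ fixes its action on ℍ₀, and the
invariant det excludes reflections. Conversely every required transformation is reached by flows of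
the generators.

The maps q are onto and their fibres are exactly the orbits (`quot44_eq_iff`, `quot43_eq_iff`,
`quot333_eq_iff` and the surjectivity lemmas). Their components are homogeneous and vanish together
only at 0, so V → U is proper, hence closed, and the continuous bijection from the orbit space to U
is a homeomorphism (`isClosedMap_of_homogeneous`, `exists_homeomorph_of_model`).

For the whole group: conjugation by g acts on the generators by an automorphism of the cross
product, that is, by a rotation, and the same rotation is induced by some g₀ in G⁰. So g = g₁g₀ with
g₁ commuting with all Xₖ (`exists_mul_commute`). Such a g₁ acts on M by an isometry commuting with
the generators: a 2 × 2 quaternionic matrix, a pair of a unit quaternion and a sign, or left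
multiplication by an orthogonal matrix. In each case q carries it to a linear map of N. As V → U is
onto, this linear map is determined by g, so the maps form a representation, trivial on G⁰. -/

noncomputable section

namespace OrbitSpaceSU2

/-! ### From derivatives at the identity to the identity component. -/

section LieGroup

variable {d : ℕ} {G : Type*} [TopologicalSpace G]
  [ChartedSpace (EuclideanSpace ℝ (Fin d)) G] [Group G]

/-- A differentiable function on a manifold whose differential vanishes identically is locally
constant. -/
theorem isLocallyConstant_of_mfderiv_eq_zero {d : ℕ} {G : Type*} [TopologicalSpace G]
    [ChartedSpace (EuclideanSpace ℝ (Fin d)) G] [IsManifold (𝓡 d) 1 G]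
    {E : Type*} [NormedAddCommGroup E] [NormedSpace ℝ E]
    {F : G → E} (hF : MDifferentiable (𝓡 d) 𝓘(ℝ, E) F)
    (h0 : ∀ x, mfderiv (𝓡 d) 𝓘(ℝ, E) F x = 0) : IsLocallyConstant F := by
  rw [IsLocallyConstant.iff_eventually_eq]
  intro x
  let c := extChartAt (𝓡 d) x
  have ht : IsOpen c.target := isOpen_extChartAt_target x
  have hx : c x ∈ c.target := mem_extChartAt_target x
  obtain ⟨r, hr, hball⟩ := Metric.isOpen_iff.1 ht _ hx
  have hderiv : ∀ y ∈ c.target, HasFDerivAt (F ∘ c.symm) (0 : EuclideanSpace ℝ (Fin d) →L[ℝ] E) y := by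
    intro y hy
    have h1 : MDifferentiableAt (𝓡 d) 𝓘(ℝ, E) F (c.symm y) := hF _
    have h2 : MDifferentiableAt 𝓘(ℝ, EuclideanSpace ℝ (Fin d)) (𝓡 d) c.symm y :=
      (mdifferentiableOn_extChartAt_symm y hy).mdifferentiableAt (ht.mem_nhds hy)
    have h3 := h1.hasMFDerivAt.comp y h2.hasMFDerivAt
    rw [h0] at h3
    have h4 := h3.hasFDerivAt
    rwa [ContinuousLinearMap.zero_comp] at h4
  have hconst : ∀ y ∈ Metric.ball (c x) r, (F ∘ c.symm) y = (F ∘ c.symm) (c x) := by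
    intro y hy
    refine (convex_ball (c x) r).is_const_of_fderivWithin_eq_zero (𝕜 := ℝ) (f := F ∘ c.symm)
      (fun z hz => (hderiv z (hball hz)).differentiableAt.differentiableWithinAt) ?_ hy
      (Metric.mem_ball_self hr)
    intro z hz
    exact ((hderiv z (hball hz)).hasFDerivWithinAt).fderivWithin
      (Metric.isOpen_ball.uniqueDiffWithinAt hz)
  have hcont : ContinuousAt c x := continuousAt_extChartAt x
  filter_upwards [hcont.preimage_mem_nhds (Metric.ball_mem_nhds _ hr),
    extChartAt_source_mem_nhds (I := 𝓡 d) x] with y hy hys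
  have := hconst _ hy
  simpa [c.left_inv hys, c.left_inv (mem_extChartAt_source (I := 𝓡 d) x)] using this

theorem _root_.IsLocallyConstant.eq_of_mem_idComponent {G : Type*} [TopologicalSpace G] [Group G]
    [IsTopologicalGroup G] {E : Type*} {F : G → E}
    (hF : IsLocallyConstant F) {g : G} (hg : g ∈ idComponent G) : F g = F 1 :=
  hF.apply_eq_of_isPreconnected isPreconnected_connectedComponent hg mem_connectedComponent

theorem isOpen_idComponent (d : ℕ) {G : Type*} [TopologicalSpace G]
    [ChartedSpace (EuclideanSpace ℝ (Fin d)) G] [Group G] [IsTopologicalGroup G] : IsOpen (idComponent G : Set G) := by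
  have : LocallyConnectedSpace G := ChartedSpace.locallyConnectedSpace (EuclideanSpace ℝ (Fin d)) G
  exact isOpen_connectedComponent

theorem finite_quotient_idComponent (d : ℕ) {G : Type*} [TopologicalSpace G]
    [ChartedSpace (EuclideanSpace ℝ (Fin d)) G] [Group G] [IsTopologicalGroup G] [CompactSpace G] :
    Finite (G ⧸ idComponent G) :=
  Subgroup.quotient_finite_of_isOpen _ (isOpen_idComponent d)

variable [LieGroup (𝓡 d) ∞ G] {V : Type*} [NormedAddCommGroup V] [NormedSpace ℝ V]

theorem mdifferentiableAt_mul_left (g h : G) :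
    MDifferentiableAt (𝓡 d) (𝓡 d) (g * · : G → G) h :=
  ((contMDiff_mul_left (I := 𝓡 d) (n := ∞)).contMDiffAt).mdifferentiableAt (by simp)

theorem mdifferentiableAt_mul_right (g h : G) :
    MDifferentiableAt (𝓡 d) (𝓡 d) (· * g : G → G) h :=
  ((contMDiff_mul_right (I := 𝓡 d) (n := ∞)).contMDiffAt).mdifferentiableAt (by simp)

/-- If `F (g h)` is a fixed linear function of `F h` for every `g`, then `F` is constant on the
identity component as soon as its differential at `1` vanishes. -/
theorem eq_of_mfderiv_one_eq_zero [IsTopologicalGroup G]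
    {E : Type*} [NormedAddCommGroup E] [NormedSpace ℝ E]
    {F : G → E} (hF : MDifferentiable (𝓡 d) 𝓘(ℝ, E) F) (A : G → E →L[ℝ] E)
    (hA : ∀ g h, F (g * h) = A g (F h))
    (h0 : mfderiv (𝓡 d) 𝓘(ℝ, E) F 1 = 0) {g : G} (hg : g ∈ idComponent G) :
    F g = F 1 := by
  have : IsManifold (𝓡 d) 1 G := IsManifold.of_le (n := ∞) (by simp)
  refine (isLocallyConstant_of_mfderiv_eq_zero hF fun g => ?_).eq_of_mem_idComponent hg
  -- Left translation by g⁻¹ moves g to 1, so the equivariance of F carries the vanishing of the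
  -- differential from 1 to g.
  have h1 : F = (A g) ∘ (F ∘ (g⁻¹ * ·)) := by ext h; simp [← hA]
  have h2 : mfderiv (𝓡 d) 𝓘(ℝ, E) F (g⁻¹ * g) = 0 := by rw [inv_mul_cancel]; exact h0
  have h3 : MDifferentiableAt (𝓡 d) 𝓘(ℝ, E) (F ∘ (g⁻¹ * ·)) g :=
    (hF _).comp g (mdifferentiableAt_mul_left (d := d) g⁻¹ g)
  rw [h1, mfderiv_comp g (ContinuousLinearMap.mdifferentiableAt _) h3,
    mfderiv_comp g (hF _) (mdifferentiableAt_mul_left (d := d) g⁻¹ g)]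
  ext y
  change mfderiv 𝓘(ℝ, E) 𝓘(ℝ, E) (A g) _ (mfderiv (𝓡 d) 𝓘(ℝ, E) F (g⁻¹ * g) _) = 0
  rw [h2]
  exact map_zero _

/-- Differentiate ρ(gh) = ρ(g)ρ(h) in h at h = 1. -/
theorem mfderiv_rep_mulInvariantVectorField {ρ : G →* (V →L[ℝ] V)}
    (hρ : ContMDiff (𝓡 d) 𝓘(ℝ, V →L[ℝ] V) ∞ (fun g : G => ρ g))
    (g : G) (x : GroupLieAlgebra (𝓡 d) G) :
    mfderiv (𝓡 d) 𝓘(ℝ, V →L[ℝ] V) (fun g : G => ρ g) g (mulInvariantVectorField x g) =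
      ρ g * lieAction ρ x := by
  have hd : MDifferentiable (𝓡 d) 𝓘(ℝ, V →L[ℝ] V) (fun g : G => ρ g) :=
    hρ.mdifferentiable (by simp)
  have h1 := mfderiv_comp (1 : G) (hd (g * 1)) (mdifferentiableAt_mul_left (d := d) g 1)
  have h2 : (fun g : G => ρ g) ∘ (g * ·) =
      (ContinuousLinearMap.mul ℝ (V →L[ℝ] V) (ρ g)) ∘ (fun g : G => ρ g) := by
    ext h; simp
  rw [h2, mfderiv_comp (1 : G) (ContinuousLinearMap.mdifferentiableAt _) (hd 1)] at h1
  have h3 := DFunLike.congr_fun h1 x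
  rw [ContinuousLinearMap.mfderiv_eq] at h3
  -- The chain rule produces the base point g * 1; quantifying over k makes the substitution by g
  -- possible inside the dependent tangent spaces.
  have h4 : ∀ k, k = g → mfderiv (𝓡 d) 𝓘(ℝ, V →L[ℝ] V) (fun g : G => ρ g) k
      (mfderiv (𝓡 d) (𝓡 d) (g * ·) (1 : G) x) = mfderiv (𝓡 d) 𝓘(ℝ, V →L[ℝ] V) (fun g : G => ρ g) g
      (mfderiv (𝓡 d) (𝓡 d) (g * ·) (1 : G) x) := by
    rintro k rfl; rfl
  exact (h4 _ (mul_one g)).symm.trans h3.symm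

/-- In the chart at 1, let W_x be the left-invariant field of x and f the representation. Then
Df(W_x) = f · dρ(x), so differentiating f along W_x and W_y in both orders and subtracting gives the
commutator of dρ(x) and dρ(y). It is also the derivative of f along the bracket of the two fields.
-/
theorem lieAction_lie {ρ : G →* (V →L[ℝ] V)}
    (hρ : ContMDiff (𝓡 d) 𝓘(ℝ, V →L[ℝ] V) ∞ (fun g : G => ρ g))
    (x y : GroupLieAlgebra (𝓡 d) G) :
    lieAction ρ ⁅x, y⁆ = lieAction ρ x * lieAction ρ y - lieAction ρ y * lieAction ρ x := by
  have hd : MDifferentiable (𝓡 d) 𝓘(ℝ, V →L[ℝ] V) (fun g : G => ρ g) :=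
    hρ.mdifferentiable (by simp)
  have : IsManifold (𝓡 d) 2 G := IsManifold.of_le (n := ∞) ENat.LEInfty.out
  let c := extChartAt (𝓡 d) (1 : G)
  have ht : IsOpen c.target := isOpen_extChartAt_target (1 : G)
  have h1 : c 1 ∈ c.target := mem_extChartAt_target (1 : G)
  let f : EuclideanSpace ℝ (Fin d) → (V →L[ℝ] V) := fun u => ρ (c.symm u)
  let W : GroupLieAlgebra (𝓡 d) G → EuclideanSpace ℝ (Fin d) → EuclideanSpace ℝ (Fin d) :=
    fun x => VectorField.mpullbackWithin 𝓘(ℝ, EuclideanSpace ℝ (Fin d)) (𝓡 d) c.symm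
      (mulInvariantVectorField x) (Set.range (𝓡 d))
  have hW : ∀ x, DifferentiableAt ℝ (W x) (c 1) := by
    intro x
    have h := (mdifferentiableAt_mulInvariantVectorField (I := 𝓡 d) (g := (1 : G)) x)
    rw [← mdifferentiableWithinAt_univ] at h
    have h' := h.differentiableWithinAt_mpullbackWithin_vectorField
    rw [Set.preimage_univ, Set.univ_inter] at h'
    refine DifferentiableWithinAt.differentiableAt (h' : DifferentiableWithinAt ℝ (W x) _ (c 1)) ?_
    rw [ModelWithCorners.range_eq_univ]
    exact Filter.univ_mem
  have hsymm : ∀ u ∈ c.target, MDifferentiableAt 𝓘(ℝ, EuclideanSpace ℝ (Fin d)) (𝓡 d) c.symm u :=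
    fun u hu => (mdifferentiableOn_extChartAt_symm u hu).mdifferentiableAt (ht.mem_nhds hu)
  have hfd : ∀ u ∈ c.target, fderiv ℝ f u =
      (mfderiv (𝓡 d) 𝓘(ℝ, V →L[ℝ] V) (fun g : G => ρ g) (c.symm u)).comp
        (mfderiv 𝓘(ℝ, EuclideanSpace ℝ (Fin d)) (𝓡 d) c.symm u) := by
    intro u hu
    rw [← mfderiv_eq_fderiv]
    exact mfderiv_comp u (hd _) (hsymm u hu)
  have hfW : ∀ x, ∀ u ∈ c.target, fderiv ℝ f u (W x u) = f u * lieAction ρ x := by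
    intro x u hu
    rw [hfd u hu, ← mfderiv_rep_mulInvariantVectorField hρ]
    have hinv := isInvertible_mfderivWithin_extChartAt_symm (I := 𝓡 d) (x := (1 : G)) hu
    simp only [W, VectorField.mpullbackWithin_apply]
    rw [ModelWithCorners.range_eq_univ, mfderivWithin_univ] at hinv ⊢
    obtain ⟨e, he⟩ := hinv
    change mfderiv (𝓡 d) 𝓘(ℝ, V →L[ℝ] V) (fun g : G => ρ g) (c.symm u)
      (mfderiv 𝓘(ℝ, EuclideanSpace ℝ (Fin d)) (𝓡 d) c.symm u
        ((mfderiv 𝓘(ℝ, EuclideanSpace ℝ (Fin d)) (𝓡 d) c.symm u).inverse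
          (mulInvariantVectorField x (c.symm u)))) = _
    congr 1
    rw [← he, ContinuousLinearMap.inverse_equiv]
    exact e.apply_symm_apply _
  have hf : ContDiffAt ℝ ∞ f (c 1) := by
    have hsm : ContMDiffAt 𝓘(ℝ, EuclideanSpace ℝ (Fin d)) (𝓡 d) ∞ c.symm (c 1) :=
      (contMDiffOn_extChartAt_symm (1 : G) _ h1).contMDiffAt (ht.mem_nhds h1)
    exact (hρ.contMDiffAt.comp _ hsm).contDiffAt
  have hf1 : f (c 1) = 1 := by
    simp only [f]
    rw [extChartAt_to_inv, map_one]
  have hbr := VectorField.fderiv_apply_lieBracket (𝕜 := ℝ) hf (by simpa using ENat.LEInfty.out) (hW y) (hW x)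
  have hev : ∀ x y, fderiv ℝ (fun u => fderiv ℝ f u (W y u)) (c 1) (W x (c 1)) =
      lieAction ρ x * lieAction ρ y := by
    intro x y
    have : (fun u => fderiv ℝ f u (W y u)) =ᶠ[nhds (c 1)] fun u => f u * lieAction ρ y := by
      filter_upwards [ht.mem_nhds h1] with u hu using hfW y u hu
    have hd2 := hf.differentiableAt (by simp)
    rw [this.fderiv_eq, (hd2.hasFDerivAt.mul_const' (lieAction ρ y)).fderiv]
    change fderiv ℝ f (c 1) (W x (c 1)) * lieAction ρ y = _
    rw [hfW x _ h1, hf1, one_mul]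
  rw [hev, hev] at hbr
  let z : EuclideanSpace ℝ (Fin d) := VectorField.lieBracket ℝ (W x) (W y) (c 1)
  have hlie : (⁅x, y⁆ : GroupLieAlgebra (𝓡 d) G) =
      (mfderiv (𝓡 d) 𝓘(ℝ, EuclideanSpace ℝ (Fin d)) c 1).inverse z := by
    rw [GroupLieAlgebra.bracket_def, VectorField.mlieBracket, VectorField.mlieBracketWithin_apply]
    simp only [z, W, c, ModelWithCorners.range_eq_univ, ← VectorField.lieBracketWithin_univ,
      Set.preimage_univ, Set.univ_inter]
  -- The tangent space at 1 is modelled on this very chart, so the chart has identity derivative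
  -- there and both brackets are the same vector.
  have hz : (mfderiv (𝓡 d) 𝓘(ℝ, EuclideanSpace ℝ (Fin d)) c 1).inverse z = z := by
    rw [mfderiv_extChartAt_self]
    exact DFunLike.congr_fun
      (ContinuousLinearMap.inverse_id (R := ℝ) (M := EuclideanSpace ℝ (Fin d))) z
  have hz' : (mfderiv 𝓘(ℝ, EuclideanSpace ℝ (Fin d)) (𝓡 d) c.symm (c 1)) z = z := by
    have := mfderivWithin_range_extChartAt_symm (I := 𝓡 d) (x := (1 : G))
    rw [ModelWithCorners.range_eq_univ, mfderivWithin_univ] at this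
    exact DFunLike.congr_fun this z
  rw [← hbr, hfd _ h1, hlie, hz]
  have key : ∀ k, k = 1 → ∀ z : EuclideanSpace ℝ (Fin d), lieAction ρ z =
      mfderiv (𝓡 d) 𝓘(ℝ, V →L[ℝ] V) (fun g : G => ρ g) k z := by
    rintro k rfl z; rfl
  refine (key (c.symm (c 1)) (extChartAt_to_inv 1) z).trans ?_
  change _ = mfderiv (𝓡 d) 𝓘(ℝ, V →L[ℝ] V) (fun g : G => ρ g) (c.symm (c 1))
    ((mfderiv 𝓘(ℝ, EuclideanSpace ℝ (Fin d)) (𝓡 d) c.symm (c 1)) z)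
  rw [hz']

section Rep

variable {ρ : G →* (V →L[ℝ] V)}

theorem hasMFDerivAt_rep_one (hρ : ContMDiff (𝓡 d) 𝓘(ℝ, V →L[ℝ] V) ∞ (fun g : G => ρ g)) :
    HasMFDerivAt (𝓡 d) 𝓘(ℝ, V →L[ℝ] V) (fun g : G => ρ g) 1 (lieAction ρ) :=
  (hρ.mdifferentiable (by simp) 1).hasMFDerivAt

theorem hasMFDerivAt_rep_apply_one
    (hρ : ContMDiff (𝓡 d) 𝓘(ℝ, V →L[ℝ] V) ∞ (fun g : G => ρ g)) (v : V) :
    HasMFDerivAt (𝓡 d) 𝓘(ℝ, V) (fun g : G => ρ g v) 1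
      ((ContinuousLinearMap.apply ℝ V v).comp (lieAction ρ)) :=
  ((ContinuousLinearMap.apply ℝ V v).hasMFDerivAt (x := ρ 1)).comp (1 : G)
    (hasMFDerivAt_rep_one hρ)

theorem mdifferentiable_rep_apply
    (hρ : ContMDiff (𝓡 d) 𝓘(ℝ, V →L[ℝ] V) ∞ (fun g : G => ρ g)) (v : V) :
    MDifferentiable (𝓡 d) 𝓘(ℝ, V) (fun g : G => ρ g v) := fun g =>
  ((ContinuousLinearMap.apply ℝ V v).mdifferentiableAt (x := ρ g)).comp g
    (hρ.mdifferentiable (by simp) g)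

/-- The fixed vectors of the identity component are those killed by the Lie algebra. -/
theorem mem_fixedSubspace_iff [IsTopologicalGroup G]
    (hρ : ContMDiff (𝓡 d) 𝓘(ℝ, V →L[ℝ] V) ∞ (fun g : G => ρ g)) (v : V) :
    v ∈ fixedSubspace ρ ↔ ∀ x : GroupLieAlgebra (𝓡 d) G, lieAction ρ x v = 0 := by
  have hd := hasMFDerivAt_rep_apply_one hρ v
  constructor
  · intro hv x
    have hev : (fun g : G => ρ g v) =ᶠ[nhds 1] fun _ => v := by
      filter_upwards [(isOpen_idComponent d (G := G)).mem_nhds (one_mem (idComponent G))] with g hg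
        using hv g hg
    have h1 := (hd.mfderiv.symm.trans hev.mfderiv_eq).trans mfderiv_const
    exact DFunLike.congr_fun h1 x
  · intro hv g hg
    have h0 : mfderiv (𝓡 d) 𝓘(ℝ, V) (fun g : G => ρ g v) 1 = 0 := by
      rw [hd.mfderiv]; ext x; exact hv x
    have := eq_of_mfderiv_one_eq_zero (mdifferentiable_rep_apply hρ v) (fun g => ρ g)
      (fun g h => by simp) h0 hg
    simpa using this

/-- An operator commuting with the Lie algebra commutes with the identity component. -/
theorem commute_rep_of_commute_lieAction [IsTopologicalGroup G]
    (hρ : ContMDiff (𝓡 d) 𝓘(ℝ, V →L[ℝ] V) ∞ (fun g : G => ρ g)) (C : V →L[ℝ] V)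
    (hC : ∀ x : GroupLieAlgebra (𝓡 d) G, lieAction ρ x * C = C * lieAction ρ x)
    {g : G} (hg : g ∈ idComponent G) : ρ g * C = C * ρ g := by
  have hd := hasMFDerivAt_rep_one hρ
  have hinv : ContMDiff (𝓡 d) 𝓘(ℝ, V →L[ℝ] V) ∞ (fun g : G => ρ g⁻¹) :=
    hρ.comp (contMDiff_inv (𝓡 d) ∞)
  have hi := ((hinv.mdifferentiable (by simp)) (1 : G)).hasMFDerivAt
  let D : EuclideanSpace ℝ (Fin d) →L[ℝ] (V →L[ℝ] V) :=
    mfderiv (𝓡 d) 𝓘(ℝ, V →L[ℝ] V) (fun g : G => ρ g⁻¹) 1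
  -- Differentiate ρ(g)ρ(g⁻¹) = 1 at the identity.
  have hDx : ∀ x : GroupLieAlgebra (𝓡 d) G, D x = - lieAction ρ x := by
    intro x
    have h1 := hd.mul' hi
    have h2 : (fun g : G => ρ g) * (fun g : G => ρ g⁻¹) = fun _ => 1 := by
      ext1 g; simp [← map_mul]
    rw [h2] at h1
    have h3 := DFunLike.congr_fun (h1.mfderiv.symm.trans mfderiv_const) x
    have h4 : ρ 1 * D x + lieAction ρ x * ρ 1⁻¹ = 0 := h3
    rw [inv_one, map_one, one_mul, mul_one] at h4
    exact eq_neg_of_add_eq_zero_left h4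
  have hl : HasMFDerivAt (𝓡 d) 𝓘(ℝ, V →L[ℝ] V) (fun g : G => ρ g * C) 1
      (((ContinuousLinearMap.mul ℝ (V →L[ℝ] V)).flip C).comp (lieAction ρ)) :=
    (((ContinuousLinearMap.mul ℝ (V →L[ℝ] V)).flip C).hasMFDerivAt (x := ρ 1)).comp (1 : G) hd
  have hF := hl.mul' hi
  -- The function g ↦ ρ(g) C ρ(g)⁻¹ has the commutator of dρ(x) and C as its derivative at 1, and it
  -- is equivariant under conjugation, so it is constant on the identity component.
  have h0 : mfderiv (𝓡 d) 𝓘(ℝ, V →L[ℝ] V) ((fun g : G => ρ g * C) * fun g : G => ρ g⁻¹) 1 = 0 := by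
    rw [hF.mfderiv]
    ext1 x
    change (ρ 1 * C) * D x + (lieAction ρ x * C) * ρ 1⁻¹ = 0
    rw [inv_one, map_one, one_mul, mul_one, hDx, hC, mul_neg, neg_add_cancel]
  have hFd : MDifferentiable (𝓡 d) 𝓘(ℝ, V →L[ℝ] V)
      ((fun g : G => ρ g * C) * fun g : G => ρ g⁻¹) := by
    intro g
    have h1 : MDifferentiableAt (𝓡 d) 𝓘(ℝ, V →L[ℝ] V) (fun g : G => ρ g * C) g :=
      (((ContinuousLinearMap.mul ℝ (V →L[ℝ] V)).flip C).mdifferentiableAt (x := ρ g)).comp g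
        (hρ.mdifferentiable (by simp) g)
    exact h1.mul ((hinv.mdifferentiable (by simp)) g)
  have := eq_of_mfderiv_one_eq_zero hFd
    (fun g => (ContinuousLinearMap.mulLeftRight ℝ (V →L[ℝ] V) (ρ g) (ρ g⁻¹)))
    (fun g h => by simp [mul_assoc]) h0 hg
  simp only [Pi.mul_apply, map_one, inv_one, one_mul, mul_one] at this
  have h5 := congrArg (· * ρ g) this
  simpa [mul_assoc, ← map_mul] using h5

/-- A function whose derivatives along the Lie algebra vanish is invariant under the identity
component. -/
theorem apply_rep_eq_of_fderiv_lieAction_eq_zero [IsTopologicalGroup G]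
    (hρ : ContMDiff (𝓡 d) 𝓘(ℝ, V →L[ℝ] V) ∞ (fun g : G => ρ g))
    {E : Type*} [NormedAddCommGroup E] [NormedSpace ℝ E] {f : V → E} (hf : Differentiable ℝ f)
    (h0 : ∀ (x : GroupLieAlgebra (𝓡 d) G) (v : V), fderiv ℝ f v (lieAction ρ x v) = 0)
    {g : G} (hg : g ∈ idComponent G) (v : V) : f (ρ g v) = f v := by
  have : IsManifold (𝓡 d) 1 G := IsManifold.of_le (n := ∞) (by simp)
  have hF : ∀ w, MDifferentiable (𝓡 d) 𝓘(ℝ, E) (fun g : G => f (ρ g w)) := fun w g =>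
    (hf (ρ g w)).mdifferentiableAt.comp g (mdifferentiable_rep_apply hρ w g)
  have h1 : ∀ w, mfderiv (𝓡 d) 𝓘(ℝ, E) (fun g : G => f (ρ g w)) 1 = 0 := by
    intro w
    have h2 := ((hf (ρ 1 w)).hasFDerivAt.hasMFDerivAt).comp (1 : G)
      (hasMFDerivAt_rep_apply_one hρ w)
    refine h2.mfderiv.trans ?_
    ext1 x
    change fderiv ℝ f (ρ 1 w) (lieAction ρ x w) = 0
    rw [map_one]
    exact h0 x w
  have := (isLocallyConstant_of_mfderiv_eq_zero (hF v) fun g => ?_).eq_of_mem_idComponent hg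
  · simpa using this
  -- No equivariance of f is available, so right translation is used: it brings g to 1 at the cost
  -- of replacing v by ρ(g)v, and the hypothesis covers every vector.
  have h3 : (fun h : G => f (ρ h v)) = (fun h : G => f (ρ h (ρ g v))) ∘ (· * g⁻¹) := by
    ext h
    simp only [Function.comp, ← mul_apply_eq_comp, ← map_mul, inv_mul_cancel_right]
  rw [h3, mfderiv_comp g (hF _ _) (mdifferentiableAt_mul_right (d := d) g⁻¹ g)]
  have h4 : mfderiv (𝓡 d) 𝓘(ℝ, E) (fun h : G => f (ρ h (ρ g v))) (g * g⁻¹) = 0 := by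
    rw [mul_inv_cancel]; exact h1 _
  rw [h4]
  rfl

/-- The element y is Ad(g)x: differentiate ρ(g h g⁻¹) in h at the identity. -/
theorem exists_lieAction_eq_conj
    (hρ : ContMDiff (𝓡 d) 𝓘(ℝ, V →L[ℝ] V) ∞ (fun g : G => ρ g)) (g : G)
    (x : GroupLieAlgebra (𝓡 d) G) :
    ∃ y : GroupLieAlgebra (𝓡 d) G, ρ g * lieAction ρ x * ρ g⁻¹ = lieAction ρ y := by
  have hd : MDifferentiable (𝓡 d) 𝓘(ℝ, V →L[ℝ] V) (fun g : G => ρ g) :=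
    hρ.mdifferentiable (by simp)
  have hc : MDifferentiableAt (𝓡 d) (𝓡 d) ((· * g⁻¹) ∘ (g * ·) : G → G) 1 :=
    (mdifferentiableAt_mul_right (d := d) g⁻¹ _).comp _ (mdifferentiableAt_mul_left (d := d) g 1)
  have h1 := mfderiv_comp (1 : G) (hd _) hc
  have h2 : (fun g : G => ρ g) ∘ ((· * g⁻¹) ∘ (g * ·) : G → G) =
      (ContinuousLinearMap.mulLeftRight ℝ (V →L[ℝ] V) (ρ g) (ρ g⁻¹)) ∘ (fun g : G => ρ g) := by
    ext h; simp [mul_assoc]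
  rw [h2, mfderiv_comp (1 : G) (ContinuousLinearMap.mdifferentiableAt _) (hd 1),
    ContinuousLinearMap.mfderiv_eq] at h1
  have h3 := DFunLike.congr_fun h1 x
  refine ⟨mfderiv (𝓡 d) (𝓡 d) ((· * g⁻¹) ∘ (g * ·) : G → G) 1 x, ?_⟩
  have key : ∀ k, k = 1 → ∀ z : EuclideanSpace ℝ (Fin d),
      mfderiv (𝓡 d) 𝓘(ℝ, V →L[ℝ] V) (fun g : G => ρ g) k z = lieAction ρ z := by
    rintro k rfl z; rfl
  exact (h3 : ContinuousLinearMap.mulLeftRight ℝ (V →L[ℝ] V) (ρ g) (ρ g⁻¹) (lieAction ρ x) = _).trans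
    (key _ (by simp) _)

end Rep

end LieGroup

/-! ### Exponentials of generators lie in the image of the identity component. -/

section Exponential

theorem exp_smul_mul_exp_smul_neg {A : Type*} [NormedRing A] [NormedAlgebra ℝ A] [CompleteSpace A]
    (X : A) (t : ℝ) : NormedSpace.exp (t • X) * NormedSpace.exp (t • -X) = 1 := by
  let _ : NormedAlgebra ℚ A := NormedAlgebra.restrictScalars ℚ ℝ A
  rw [← NormedSpace.exp_add_of_commute, ← smul_add, add_neg_cancel, smul_zero, NormedSpace.exp_zero]
  exact (((Commute.refl X).neg_right).smul_left t).smul_right t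

variable {d : ℕ} {G : Type*} [TopologicalSpace G]
  [ChartedSpace (EuclideanSpace ℝ (Fin d)) G] [Group G] [IsTopologicalGroup G]
  [LieGroup (𝓡 d) ∞ G] {V : Type*} [NormedAddCommGroup V] [NormedSpace ℝ V] [CompleteSpace V]
  {ρ : G →* (V →L[ℝ] V)}

/-- Along an integral curve γ of the left-invariant field of x through 1, ρ ∘ γ solves R' = RX with
R(0) = 1, so it is exp(tX); the curve stays in the identity component because it is connected.
Integral curves are only taken for short time here. -/
theorem eventually_exists_rep_eq_exp
    (hρ : ContMDiff (𝓡 d) 𝓘(ℝ, V →L[ℝ] V) ∞ (fun g : G => ρ g))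
    (x : GroupLieAlgebra (𝓡 d) G) :
    ∀ᶠ t : ℝ in nhds 0, ∃ g ∈ idComponent G, ρ g = NormedSpace.exp (t • lieAction ρ x) := by
  have : IsManifold (𝓡 d) 1 G := IsManifold.of_le (n := ∞) (by simp)
  have hv := (contMDiff_mulInvariantVectorField (I := 𝓡 d) (G := G) x).of_le
    (show (1 : ℕ∞ω) ≤ minSmoothness ℝ 2 by
      rw [minSmoothness_of_isRCLikeNormedField]; exact one_le_two)
  obtain ⟨γ, hγ0, hγ⟩ := exists_isMIntegralCurveAt_of_contMDiffAt_boundaryless 0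
    (hv.contMDiffAt (x := (1 : G)))
  obtain ⟨ε, hε, hball⟩ := Metric.eventually_nhds_iff_ball.1 hγ
  have hderiv : ∀ t ∈ Metric.ball (0 : ℝ) ε,
      HasDerivAt (fun t => ρ (γ t)) (ρ (γ t) * lieAction ρ x) t := by
    intro t ht
    have h1 := ((hρ.mdifferentiable (by simp) (γ t)).hasMFDerivAt).comp t (hball t ht)
    have h2 : HasFDerivAt (fun t => ρ (γ t))
        ((1 : ℝ →L[ℝ] ℝ).smulRight (ρ (γ t) * lieAction ρ x)) t := by
      refine h1.hasFDerivAt.congr_fderiv ?_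
      ext1
      change mfderiv (𝓡 d) 𝓘(ℝ, V →L[ℝ] V) (fun g : G => ρ g) (γ t)
        ((1 : ℝ) • mulInvariantVectorField x (γ t)) = (1 : ℝ) • (ρ (γ t) * lieAction ρ x)
      rw [one_smul, one_smul, mfderiv_rep_mulInvariantVectorField hρ]
    simpa using h2.hasDerivAt
  have hcont : ContinuousOn γ (Metric.ball 0 ε) := fun t ht =>
    (hball t ht).continuousAt.continuousWithinAt
  have hmem : ∀ t ∈ Metric.ball (0 : ℝ) ε, γ t ∈ idComponent G := by
    intro t ht
    have h1 : IsPreconnected (γ '' Metric.ball 0 ε) :=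
      (convex_ball (0 : ℝ) ε).isPreconnected.image _ hcont
    exact h1.subset_connectedComponent ⟨0, Metric.mem_ball_self hε, hγ0⟩ ⟨t, ht, rfl⟩
  set X := lieAction ρ x
  have hexp : ∀ t : ℝ, HasDerivAt (fun t : ℝ => NormedSpace.exp (t • -X))
      (-X * NormedSpace.exp (t • -X)) t := fun t => hasDerivAt_exp_smul_const' (-X) t
  have hP : ∀ t ∈ Metric.ball (0 : ℝ) ε,
      HasDerivAt (fun t => ρ (γ t) * NormedSpace.exp (t • -X)) 0 t := by
    intro t ht
    refine ((hderiv t ht).mul (hexp t)).congr_deriv ?_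
    rw [mul_assoc, neg_mul, mul_neg, add_neg_cancel]
  filter_upwards [Metric.ball_mem_nhds (0 : ℝ) hε] with t ht
  refine ⟨γ t, hmem t ht, ?_⟩
  have h1 : ρ (γ t) * NormedSpace.exp (t • -X) = 1 := by
    have := Metric.isOpen_ball.is_const_of_deriv_eq_zero (convex_ball (0 : ℝ) ε).isPreconnected
      (fun t ht => (hP t ht).differentiableAt.differentiableWithinAt)
      (fun t ht => (hP t ht).deriv) ht (Metric.mem_ball_self hε)
    simpa [hγ0] using this
  have h2 : NormedSpace.exp (t • -X) * NormedSpace.exp (t • X) = 1 := by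
    simpa using exp_smul_mul_exp_smul_neg (-X) t
  calc ρ (γ t) = ρ (γ t) * (NormedSpace.exp (t • -X) * NormedSpace.exp (t • X)) := by
        rw [h2, mul_one]
    _ = _ := by rw [← mul_assoc, h1, one_mul]

/-- Powers of short-time elements suffice: exp(X) is the (n+1)-st power of exp(X/(n+1)). -/
theorem exists_rep_eq_exp
    (hρ : ContMDiff (𝓡 d) 𝓘(ℝ, V →L[ℝ] V) ∞ (fun g : G => ρ g))
    (x : GroupLieAlgebra (𝓡 d) G) :
    ∃ g ∈ idComponent G, ρ g = NormedSpace.exp (lieAction ρ x) := by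
  have h1 : Filter.Tendsto (fun n : ℕ => (1 : ℝ) / ((n : ℝ) + 1)) Filter.atTop (nhds 0) :=
    tendsto_one_div_add_atTop_nhds_zero_nat
  obtain ⟨n, g, hg, hgx⟩ := (h1.eventually (eventually_exists_rep_eq_exp hρ x)).exists
  refine ⟨g ^ (n + 1), pow_mem hg _, ?_⟩
  let _ : NormedAlgebra ℚ (V →L[ℝ] V) := NormedAlgebra.restrictScalars ℚ ℝ _
  rw [map_pow, hgx, ← NormedSpace.exp_nsmul, ← Nat.cast_smul_eq_nsmul ℝ, smul_smul]
  congr 2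
  have : (n : ℝ) + 1 ≠ 0 := by positivity
  push_cast
  rw [mul_one_div_cancel this, one_smul]

/-- A solution of `R' = X R`, with `X` in the Lie algebra, stays in the image of the identity
component. -/
theorem exists_rep_eq_of_hasDerivAt
    (hρ : ContMDiff (𝓡 d) 𝓘(ℝ, V →L[ℝ] V) ∞ (fun g : G => ρ g))
    (x : GroupLieAlgebra (𝓡 d) G) {R : ℝ → V → V} (hR0 : ∀ v, R 0 v = v)
    (hR : ∀ v t, HasDerivAt (fun t => R t v) (lieAction ρ x (R t v)) t) (t : ℝ) :
    ∃ g ∈ idComponent G, ∀ v, ρ g v = R t v := by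
  obtain ⟨g, hg, hgx⟩ := exists_rep_eq_exp hρ (t • x)
  refine ⟨g, hg, fun v => ?_⟩
  rw [hgx, map_smul]
  set X := lieAction ρ x
  have hexp : ∀ t : ℝ, HasDerivAt (fun t : ℝ => NormedSpace.exp (t • -X))
      (NormedSpace.exp (t • -X) * -X) t := fun t => hasDerivAt_exp_smul_const (-X) t
  have hQ : ∀ s, HasDerivAt (fun s => NormedSpace.exp (s • -X) (R s v)) 0 s := by
    -- Uniqueness for a linear equation: exp(-sX) R(s)v has derivative zero.
    intro s
    refine ((hexp s).clm_apply (hR v s)).congr_deriv ?_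
    simp
  have h1 : NormedSpace.exp (t • -X) (R t v) = v := by
    have := is_const_of_deriv_eq_zero (fun s => (hQ s).differentiableAt) (fun s => (hQ s).deriv) t 0
    simpa [hR0] using this
  have h2 : NormedSpace.exp (t • X) * NormedSpace.exp (t • -X) = 1 := exp_smul_mul_exp_smul_neg X t
  calc NormedSpace.exp (t • X) v = (NormedSpace.exp (t • X) * NormedSpace.exp (t • -X)) (R t v) := by
        rw [mul_apply_eq_comp, h1]
    _ = _ := by rw [h2]; rfl

end Exponential

/-! ### An invariant inner product and the skewness of the generators. -/

section InvariantForm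

open MeasureTheory

/-- A linear action of a compact group has an invariant positive definite bilinear form. -/
theorem exists_invariant_bilinForm {G : Type*} [TopologicalSpace G] [T2Space G] [CompactSpace G]
    [Group G] [IsTopologicalGroup G]
    {V : Type*} [NormedAddCommGroup V] [NormedSpace ℝ V] [FiniteDimensional ℝ V]
    (ρ : G →* (V →L[ℝ] V)) (hρ : Continuous ρ) :
    ∃ B : LinearMap.BilinForm ℝ V, (∀ v w, B v w = B w v) ∧ (∀ v, v ≠ 0 → 0 < B v v) ∧
      ∀ g v w, B (ρ g v) (ρ g w) = B v w := by
  let _ : MeasurableSpace G := borel G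
  have : BorelSpace G := ⟨rfl⟩
  let μ : Measure G := Measure.haar
  let L : V ≃L[ℝ] EuclideanSpace ℝ (Fin (Module.finrank ℝ V)) := toEuclidean
  have hc : ∀ v w, Continuous fun g : G => inner ℝ (L (ρ g⁻¹ v)) (L (ρ g⁻¹ w)) := by
    intro v w
    have h1 : ∀ v, Continuous fun g : G => L (ρ g⁻¹ v) := fun v =>
      L.continuous.comp ((hρ.comp continuous_inv).clm_apply continuous_const)
    exact (h1 v).inner (h1 w)
  have hi : ∀ v w, Integrable (fun g : G => inner ℝ (L (ρ g⁻¹ v)) (L (ρ g⁻¹ w))) μ := fun v w =>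
    (hc v w).integrable_of_hasCompactSupport (HasCompactSupport.of_compactSpace _)
  -- Averaging over Haar measure with g⁻¹ in the integrand lets left invariance of the measure give
  -- invariance of the form.
  let B : LinearMap.BilinForm ℝ V := LinearMap.mk₂ ℝ
    (fun v w => ∫ g : G, inner ℝ (L (ρ g⁻¹ v)) (L (ρ g⁻¹ w)) ∂μ)
    (fun v v' w => by
      rw [← integral_add (hi _ _) (hi _ _)]
      simp only [map_add, inner_add_left])
    (fun c v w => by
      rw [smul_eq_mul, ← integral_const_mul]
      simp only [map_smul, inner_smul_left]; rfl)
    (fun v w w' => by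
      rw [← integral_add (hi _ _) (hi _ _)]
      simp only [map_add, inner_add_right])
    (fun c v w => by
      rw [smul_eq_mul, ← integral_const_mul]
      simp only [map_smul, inner_smul_right])
  have hB : ∀ v w, B v w = ∫ g : G, inner ℝ (L (ρ g⁻¹ v)) (L (ρ g⁻¹ w)) ∂μ := fun _ _ => rfl
  refine ⟨B, fun v w => ?_, fun v hv => ?_, fun h v w => ?_⟩
  · simp only [hB, real_inner_comm]
  · rw [hB]
    refine (hc v v).integral_pos_of_hasCompactSupport_nonneg_nonzero
      (HasCompactSupport.of_compactSpace _) (fun g => real_inner_self_nonneg) (x := 1) ?_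
    simpa using hv
  · rw [hB, hB]
    rw [← integral_mul_left_eq_self _ h]
    simp [← mul_apply_eq_comp, ← map_mul]

/-- The Lie algebra acts by skew operators for an invariant bilinear form. -/
theorem bilinForm_lieAction {d : ℕ} {G : Type*} [TopologicalSpace G]
    [ChartedSpace (EuclideanSpace ℝ (Fin d)) G] [Group G]
    [LieGroup (𝓡 d) ∞ G] {V : Type*} [NormedAddCommGroup V] [NormedSpace ℝ V]
    [FiniteDimensional ℝ V] {ρ : G →* (V →L[ℝ] V)}
    (hρ : ContMDiff (𝓡 d) 𝓘(ℝ, V →L[ℝ] V) ∞ (fun g : G => ρ g))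
    {B : LinearMap.BilinForm ℝ V} (hB : ∀ v w, B v w = B w v)
    (hBρ : ∀ g v w, B (ρ g v) (ρ g w) = B v w)
    (x : GroupLieAlgebra (𝓡 d) G) (v w : V) : B (lieAction ρ x v) w = - B v (lieAction ρ x w) := by
  -- Differentiate the constant B(ρ(g)v, ρ(g)v) at the identity; polarization then gives skewness.
  have key : ∀ v, B v (lieAction ρ x v) = 0 := by
    intro v
    let Q : V → ℝ := fun v => B v v
    let B' : V →L[ℝ] V →L[ℝ] ℝ := LinearMap.toContinuousBilinearMap B
    have hQ : HasFDerivAt Q (B' v + B'.flip v) v := by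
      refine (B'.hasFDerivAt_of_bilinear (hasFDerivAt_id v) (hasFDerivAt_id v)).congr_fderiv ?_
      ext w
      simp
    have hQ1 : HasFDerivAt Q (B' v + B'.flip v) (ρ 1 v) := by rwa [map_one]
    have h1 := hQ1.hasMFDerivAt.comp (1 : G) (hasMFDerivAt_rep_apply_one hρ v)
    have h2 : Q ∘ (fun g : G => ρ g v) = fun _ => Q v := by
      ext g; exact hBρ g v v
    rw [h2] at h1
    have h3 := DFunLike.congr_fun (h1.mfderiv.symm.trans mfderiv_const) x
    have h4 : B v (lieAction ρ x v) + B (lieAction ρ x v) v = 0 := h3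
    rw [hB (lieAction ρ x v)] at h4
    linarith
  have h := key (v + w)
  simp only [map_add, LinearMap.add_apply, key] at h
  rw [hB (lieAction ρ x v)]
  linarith

end InvariantForm

/-! ### A basis of su(2) with the structure constants of the cross product. -/

section StandardBasis

attribute [local instance] LieRing.ofAssociativeRing

-- The basis consists of the Pauli matrices times -i/2; the factor 1/2 normalizes the brackets.
open Complex in
theorem exists_su2_basis : ∃ s : Fin 3 → su2, ⁅s 0, s 1⁆ = s 2 ∧ ⁅s 1, s 2⁆ = s 0 ∧
    ⁅s 2, s 0⁆ = s 1 ∧ ∀ y, ∃ c : Fin 3 → ℝ, y = ∑ k, c k • s k := by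
  let s0 : su2 := ⟨!![0, -I / 2; -I / 2, 0], by
    refine ⟨?_, ?_⟩
    · ext i j; fin_cases i <;> fin_cases j <;> simp [Matrix.conjTranspose_apply] <;> ring
    · simp [Matrix.trace_fin_two]⟩
  let s1 : su2 := ⟨!![0, -1 / 2; 1 / 2, 0], by
    refine ⟨?_, ?_⟩
    · ext i j; fin_cases i <;> fin_cases j <;> simp [Matrix.conjTranspose_apply] <;> ring
    · simp [Matrix.trace_fin_two]⟩
  let s2 : su2 := ⟨!![-I / 2, 0; 0, I / 2], by
    refine ⟨?_, ?_⟩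
    · ext i j; fin_cases i <;> fin_cases j <;> simp [Matrix.conjTranspose_apply] <;> ring
    · simp [Matrix.trace_fin_two]; ring⟩
  refine ⟨![s0, s1, s2], ?_, ?_, ?_, ?_⟩
  · apply Subtype.ext
    change ⁅s0.1, s1.1⁆ = s2.1
    rw [Ring.lie_def]
    ext i j; fin_cases i <;> fin_cases j <;> simp [s0, s1, s2] <;> ring
  · apply Subtype.ext
    change ⁅s1.1, s2.1⁆ = s0.1
    rw [Ring.lie_def]
    ext i j; fin_cases i <;> fin_cases j <;> simp [s0, s1, s2] <;> ring
  · apply Subtype.ext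
    change ⁅s2.1, s0.1⁆ = s1.1
    rw [Ring.lie_def]
    ext i j; fin_cases i <;> fin_cases j <;> simp [s0, s1, s2] <;>
      ring_nf <;> simp <;> norm_num
  · rintro ⟨A, hA, hA'⟩
    refine ⟨![-2 * (A 0 1).im, -2 * (A 0 1).re, -2 * (A 0 0).im], ?_⟩
    apply Subtype.ext
    have h := fun i j => congrFun (congrFun hA i) j
    have h00 := h 0 0
    have h01 := h 1 0
    have h11 := h 1 1
    rw [Matrix.trace_fin_two] at hA'
    simp only [Matrix.conjTranspose_apply, Matrix.neg_apply, Complex.ext_iff, Complex.star_def,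
      Complex.conj_re, Complex.conj_im, Complex.neg_re, Complex.neg_im, Complex.add_re,
      Complex.add_im, Complex.zero_re, Complex.zero_im] at h00 h01 h11 hA'
    simp only [Fin.sum_univ_three]
    change A = (-2 * (A 0 1).im) • s0.1 + (-2 * (A 0 1).re) • s1.1 + (-2 * (A 0 0).im) • s2.1
    ext i j; fin_cases i <;> fin_cases j <;> simp [s0, s1, s2, Complex.ext_iff] <;>
      (try constructor) <;> linarith

end StandardBasis

/-! ### The infinitesimal data that replace the Lie group. -/

section Data

/-- Infinitesimal generators `X` of the identity component satisfying the relations of `so(3)`,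
together with an invariant inner product `B`. -/
structure IsInfinitesimalModel {G : Type*} [TopologicalSpace G] [Group G] [IsTopologicalGroup G]
    {V : Type*} [NormedAddCommGroup V] [NormedSpace ℝ V]
    (ρ : G →* (V →L[ℝ] V)) (X : Fin 3 → V →L[ℝ] V) (B : LinearMap.BilinForm ℝ V) : Prop where
  comm01 : X 0 * X 1 - X 1 * X 0 = X 2
  comm12 : X 1 * X 2 - X 2 * X 1 = X 0
  comm20 : X 2 * X 0 - X 0 * X 2 = X 1
  symm : ∀ v w, B v w = B w v
  pos : ∀ v, v ≠ 0 → 0 < B v v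
  inv : ∀ g v w, B (ρ g v) (ρ g w) = B v w
  skew : ∀ k v w, B (X k v) w = - B v (X k w)
  fixed : ∀ v, v ∈ fixedSubspace ρ ↔ ∀ k, X k v = 0
  commute : ∀ C : V →L[ℝ] V, (∀ k, X k * C = C * X k) → ∀ g ∈ idComponent G, ρ g * C = C * ρ g
  -- Values in ℍ cover both later uses: z z₀ z̄, and the determinant times 1.
  invariant : ∀ f : V → ℍ[ℝ], Differentiable ℝ f → (∀ k v, fderiv ℝ f v (X k v) = 0) →
    ∀ g ∈ idComponent G, ∀ v, f (ρ g v) = f v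
  exp : ∀ (c : Fin 3 → ℝ) (R : ℝ → V → V), (∀ v, R 0 v = v) →
    (∀ v t, HasDerivAt (fun t => R t v) (∑ k, c k • X k (R t v)) t) →
    ∀ t, ∃ g ∈ idComponent G, ∀ v, ρ g v = R t v
  conj : ∀ g k, ∃ a : Fin 3 → ℝ, ρ g * X k * ρ g⁻¹ = ∑ j, a j • X j

/-- The three generators span the image of the Lie algebra, so every condition over all Lie algebra
elements reduces by linearity to three conditions. The isomorphism with su(2) is used only here. -/
theorem exists_isInfinitesimalModel {d : ℕ} {G : Type*} [TopologicalSpace G] [T2Space G]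
    [CompactSpace G]
    [ChartedSpace (EuclideanSpace ℝ (Fin d)) G] [Group G] [IsTopologicalGroup G]
    [LieGroup (𝓡 d) ∞ G]
    {V : Type*} [NormedAddCommGroup V] [NormedSpace ℝ V] [FiniteDimensional ℝ V]
    (ρ : G →* (V →L[ℝ] V))
    (hρ : ContMDiff (𝓡 d) 𝓘(ℝ, V →L[ℝ] V) ∞ (fun g : G => ρ g))
    (hg : Nonempty (GroupLieAlgebra (𝓡 d) G ≃ₗ⁅ℝ⁆ su2)) :
    ∃ X B, IsInfinitesimalModel ρ X B ∧ ∀ W : Submodule ℝ V,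
      IsLieInvariant (d := d) ρ W ↔ ∀ k, ∀ w ∈ W, X k w ∈ W := by
  have : CompleteSpace V := FiniteDimensional.complete ℝ V
  obtain ⟨φ⟩ := hg
  obtain ⟨s, h01, h12, h20, hs⟩ := exists_su2_basis
  obtain ⟨B, hB, hpos, hinv⟩ := exists_invariant_bilinForm ρ hρ.continuous
  let x : Fin 3 → GroupLieAlgebra (𝓡 d) G := fun k => φ.symm (s k)
  have hx : ∀ y : GroupLieAlgebra (𝓡 d) G, ∃ c : Fin 3 → ℝ,
      lieAction ρ y = ∑ k, c k • lieAction ρ (x k) := by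
    intro y
    obtain ⟨c, hc⟩ := hs (φ y)
    refine ⟨c, ?_⟩
    have hy : y = ∑ k, c k • x k := by
      have h1 : y = φ.symm (φ y) := (φ.symm_apply_apply y).symm
      rw [h1, hc]
      have h2 : ∀ z, φ.symm z = (φ.symm : su2 →ₗ⁅ℝ⁆ GroupLieAlgebra (𝓡 d) G).toLinearMap z :=
        fun _ => rfl
      simp only [x, h2, map_sum, map_smul]
    rw [hy, map_sum]
    exact Finset.sum_congr rfl fun k _ => map_smul (lieAction ρ) (c k) (x k)
  refine ⟨fun k => lieAction ρ (x k), B, ⟨?_, ?_, ?_, hB, hpos, hinv, ?_, ?_, ?_, ?_, ?_, ?_⟩, ?_⟩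
  · rw [← lieAction_lie hρ, ← LieEquiv.map_lie, h01]
  · rw [← lieAction_lie hρ, ← LieEquiv.map_lie, h12]
  · rw [← lieAction_lie hρ, ← LieEquiv.map_lie, h20]
  · exact fun k v w => bilinForm_lieAction hρ hB hinv _ v w
  · intro v
    rw [mem_fixedSubspace_iff hρ]
    refine ⟨fun h k => h _, fun h y => ?_⟩
    obtain ⟨c, hc⟩ := hx y
    rw [hc]
    simp [h]
  · intro C hC g hg
    refine commute_rep_of_commute_lieAction hρ C (fun y => ?_) hg
    obtain ⟨c, hc⟩ := hx y
    rw [hc]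
    simp [Finset.sum_mul, Finset.mul_sum, hC]
  · intro f hf h0 g hg v
    refine apply_rep_eq_of_fderiv_lieAction_eq_zero hρ hf (fun y v => ?_) hg v
    obtain ⟨c, hc⟩ := hx y
    rw [hc]
    simp [map_sum, h0]
  · intro c R hR0 hR t
    refine exists_rep_eq_of_hasDerivAt hρ (∑ k, c k • x k) hR0 (fun v t => ?_) t
    convert hR v t using 1
    rw [map_sum, sum_apply]
    refine Finset.sum_congr rfl fun k _ => ?_
    rw [map_smul]
    rfl
  · intro g k
    obtain ⟨y, hy⟩ := exists_lieAction_eq_conj hρ g (x k)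
    obtain ⟨c, hc⟩ := hx y
    exact ⟨c, hy.trans hc⟩
  · intro W
    refine ⟨fun h k w hw => h _ w hw, fun h y w hw => ?_⟩
    obtain ⟨c, hc⟩ := hx y
    rw [hc, sum_apply]
    exact Submodule.sum_mem _ fun k _ => W.smul_mem _ (h k w hw)

end Data

/-! ### Triples closed under the cross product. -/

section Cross

open Matrix

/-- Three vectors with `p × q = r`, `q × r = p`, `r × p = q` vanish or form an orthonormal basis. -/
theorem eq_zero_or_orthonormal_of_cross {p q r : Fin 3 → ℝ} (h1 : crossProduct p q = r)
    (h2 : crossProduct q r = p) (h3 : crossProduct r p = q) :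
    (p = 0 ∧ q = 0 ∧ r = 0) ∨ (p ⬝ᵥ p = 1 ∧ q ⬝ᵥ q = 1 ∧ r ⬝ᵥ r = 1 ∧
      p ⬝ᵥ q = 0 ∧ q ⬝ᵥ r = 0 ∧ r ⬝ᵥ p = 0) := by
  have pq : p ⬝ᵥ q = 0 := by rw [← h3]; exact dot_cross_self _ _
  have qr : q ⬝ᵥ r = 0 := by rw [← h1]; exact dot_cross_self _ _
  have rp : r ⬝ᵥ p = 0 := by rw [← h2]; exact dot_cross_self _ _
  -- Cyclic invariance of the triple product gives |p|² = |q|² = |r|², and Lagrange's identity gives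
  -- |r|² = |p|²|q|². So the common value t satisfies t(t - 1) = 0.
  have e1 := triple_product_permutation p q r
  have e2 := triple_product_permutation q r p
  rw [h2, h3] at e1
  rw [h3, h1] at e2
  have e3 : r ⬝ᵥ r = (p ⬝ᵥ p) * (q ⬝ᵥ q) := by
    conv_lhs => rw [← h1]
    rw [cross_dot_cross, pq, dotProduct_comm q p, pq]; ring
  have e4 : p ⬝ᵥ p * (p ⬝ᵥ p - 1) = 0 := by
    rw [← e2, ← e1] at e3; linarith
  rcases mul_eq_zero.1 e4 with h | h
  · left
    refine ⟨dotProduct_self_eq_zero.1 h, dotProduct_self_eq_zero.1 (e1 ▸ h),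
      dotProduct_self_eq_zero.1 (e2 ▸ e1 ▸ h)⟩
  · right
    have h' : p ⬝ᵥ p = 1 := by linarith
    exact ⟨h', by linarith, by linarith, pq, qr, rp⟩

end Cross

/-! ### Rotations as products of axis rotations. -/

section Euler

open Real Matrix

/-- The rotation about the first coordinate axis. -/
def rotX (t : ℝ) : Matrix (Fin 3) (Fin 3) ℝ := !![1, 0, 0; 0, cos t, -sin t; 0, sin t, cos t]

/-- The rotation about the third coordinate axis. -/
def rotZ (t : ℝ) : Matrix (Fin 3) (Fin 3) ℝ := !![cos t, -sin t, 0; sin t, cos t, 0; 0, 0, 1]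

theorem exists_polar (x y : ℝ) : ∃ t, x = √(x ^ 2 + y ^ 2) * cos t ∧ y = √(x ^ 2 + y ^ 2) * sin t := by
  have h : ‖(⟨x, y⟩ : ℂ)‖ = √(x ^ 2 + y ^ 2) := by
    rw [Complex.norm_def, Complex.normSq_mk]; ring_nf
  exact ⟨Complex.arg ⟨x, y⟩, by rw [← h, Complex.norm_mul_cos_arg], by
    rw [← h, Complex.norm_mul_sin_arg]⟩

theorem exists_polar_of_sq_add_sq_eq_one {x y : ℝ} (h : x ^ 2 + y ^ 2 = 1) :
    ∃ t, x = cos t ∧ y = sin t := by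
  obtain ⟨t, h1, h2⟩ := exists_polar x y
  rw [h, sqrt_one, one_mul] at h1 h2
  exact ⟨t, h1, h2⟩

theorem transpose_rotX_mul (t : ℝ) : (rotX t)ᵀ * rotX t = 1 := by
  ext i j
  fin_cases i <;> fin_cases j <;>
    simp [rotX, Matrix.mul_apply, Fin.sum_univ_three] <;> nlinarith [sin_sq_add_cos_sq t]

theorem transpose_rotZ_mul (t : ℝ) : (rotZ t)ᵀ * rotZ t = 1 := by
  ext i j
  fin_cases i <;> fin_cases j <;>
    simp [rotZ, Matrix.mul_apply, Fin.sum_univ_three] <;> nlinarith [sin_sq_add_cos_sq t]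

theorem det_rotX (t : ℝ) : (rotX t).det = 1 := by
  simp [rotX, det_fin_three]; nlinarith [sin_sq_add_cos_sq t]

theorem det_rotZ (t : ℝ) : (rotZ t).det = 1 := by
  simp [rotZ, det_fin_three]; nlinarith [sin_sq_add_cos_sq t]

theorem exists_eq_rotZ {D : Matrix (Fin 3) (Fin 3) ℝ} (hD : Dᵀ * D = 1) (hdet : D.det = 1)
    (h0 : D 0 2 = 0) (h1 : D 1 2 = 0) (h2 : D 2 2 = 1) : ∃ t, D = rotZ t := by
  have e := fun i j => congrFun (congrFun hD i) j
  have e02 := e 0 2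
  have e12 := e 1 2
  have e00 := e 0 0
  have e01 := e 0 1
  have e11 := e 1 1
  simp [Matrix.mul_apply, Fin.sum_univ_three, h0, h1, h2] at e02 e12 e00 e01 e11
  rw [det_fin_three, h0, h1, h2, e02, e12] at hdet
  rw [e02] at e00 e01
  rw [e12] at e11
  -- The upper left 2 × 2 block is orthogonal of determinant one, hence equal to its own cofactor
  -- matrix.
  have ha : D 1 1 = D 0 0 := by linear_combination D 0 0 * hdet - D 1 1 * e00 + D 1 0 * e01
  have hb : D 0 1 = - D 1 0 := by linear_combination -(D 1 0) * hdet - D 0 1 * e00 + D 0 0 * e01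
  obtain ⟨t, ht0, ht1⟩ := exists_polar_of_sq_add_sq_eq_one (x := D 0 0) (y := D 1 0) (by
    linear_combination e00)
  refine ⟨t, ?_⟩
  ext i j
  fin_cases i <;> fin_cases j <;> simp [rotZ, *]

/-- Euler angles: every rotation is a product of rotations about two coordinate axes. -/
theorem exists_euler_angles {C : Matrix (Fin 3) (Fin 3) ℝ} (hC : Cᵀ * C = 1) (hdet : C.det = 1) :
    ∃ a b c, C = rotZ a * rotX b * rotZ c := by
  have e22 := congrFun (congrFun hC 2) 2
  simp [Matrix.mul_apply, Fin.sum_univ_three] at e22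
  -- The last column of `rotZ a * rotX b` is (sin a sin b, -cos a sin b, cos b); matching it with
  -- that of C determines a and b.
  obtain ⟨a, ha0, ha1⟩ := exists_polar (-(C 1 2)) (C 0 2)
  set s := √((-(C 1 2)) ^ 2 + C 0 2 ^ 2) with hs
  have hs2 : s ^ 2 = (-(C 1 2)) ^ 2 + C 0 2 ^ 2 := sq_sqrt (by positivity)
  obtain ⟨b, hb0, hb1⟩ := exists_polar_of_sq_add_sq_eq_one (x := C 2 2) (y := s) (by
    rw [hs2]; linarith)
  have hQ : (rotZ a * rotX b)ᵀ * (rotZ a * rotX b) = 1 := by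
    rw [transpose_mul, Matrix.mul_assoc, ← Matrix.mul_assoc (rotZ a)ᵀ, transpose_rotZ_mul,
      Matrix.one_mul, transpose_rotX_mul]
  have hQ' : (rotZ a * rotX b) * (rotZ a * rotX b)ᵀ = 1 := mul_eq_one_comm.1 hQ
  have hcol : ∀ i, (rotZ a * rotX b) i 2 = C i 2 := by
    intro i
    fin_cases i
    · simp [rotX, rotZ, Matrix.mul_apply, Fin.sum_univ_three, ← hb1]; linarith
    · simp [rotX, rotZ, Matrix.mul_apply, Fin.sum_univ_three, ← hb1]; linarith
    · simp [rotX, rotZ, Matrix.mul_apply, Fin.sum_univ_three, ← hb0]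
  set Q := rotZ a * rotX b with hQdef
  have hDcol : ∀ i, (Qᵀ * C) i 2 = (1 : Matrix (Fin 3) (Fin 3) ℝ) i 2 := by
    intro i
    rw [← hQ]
    simp [Matrix.mul_apply, hcol]
  -- Q and C share their last column, so QᵀC fixes the third basis vector.
  obtain ⟨c, hc⟩ := exists_eq_rotZ (D := Qᵀ * C)
    (by rw [transpose_mul, transpose_transpose, Matrix.mul_assoc, ← Matrix.mul_assoc Q, hQ',
      Matrix.one_mul, hC])
    (by rw [det_mul, det_transpose, hdet, hQdef, det_mul, det_rotX, det_rotZ]; norm_num)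
    (by rw [hDcol]; simp) (by rw [hDcol]; simp) (by rw [hDcol]; simp)
  refine ⟨a, b, c, ?_⟩
  rw [← hc, ← hQdef, ← Matrix.mul_assoc, hQ', Matrix.one_mul]

end Euler

/-! ### Orthonormal bases for a bilinear form. -/

section OrthonormalBasis

/-- A positive definite symmetric bilinear form has an orthonormal basis. -/
theorem exists_orthonormal_basis {W : Type*} [AddCommGroup W] [Module ℝ W] [FiniteDimensional ℝ W]
    (B : LinearMap.BilinForm ℝ W) (hB : ∀ v w, B v w = B w v) (hpos : ∀ v, v ≠ 0 → 0 < B v v)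
    {n : ℕ} (hn : Module.finrank ℝ W = n) :
    ∃ b : Module.Basis (Fin n) ℝ W, ∀ i j, B (b i) (b j) = if i = j then 1 else 0 := by
  subst hn
  let c : InnerProductSpace.Core ℝ W :=
    { inner := fun v w => B v w
      conj_inner_symm := fun v w => hB w v
      re_inner_nonneg := fun v => by
        by_cases h : v = 0
        · simp [h]
        · exact (hpos v h).le
      add_left := fun u v w => by simp
      smul_left := fun v w r => by simp
      definite := fun v hv => by
        by_contra h
        exact (hpos v h).ne' hv }
  let _ : NormedAddCommGroup W := c.toNormedAddCommGroup
  let _ : InnerProductSpace ℝ W := InnerProductSpace.ofCore c.toCore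
  let b := stdOrthonormalBasis ℝ W
  refine ⟨b.toBasis, fun i j => ?_⟩
  have := orthonormal_iff_ite.1 b.orthonormal i j
  rw [OrthonormalBasis.coe_toBasis]
  exact this

end OrthonormalBasis

/-! ### Quaternion coordinates. -/

section Quat

/-- The quaternion with the given coordinates. -/
def quat (a b c d : ℝ) : ℍ[ℝ] := ⟨a, b, c, d⟩

@[simp] theorem re_quat (a b c d : ℝ) : (quat a b c d).re = a := rfl
@[simp] theorem imI_quat (a b c d : ℝ) : (quat a b c d).imI = b := rfl
@[simp] theorem imJ_quat (a b c d : ℝ) : (quat a b c d).imJ = c := rfl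
@[simp] theorem imK_quat (a b c d : ℝ) : (quat a b c d).imK = d := rfl

theorem linearMap_quaternion_apply {W : Type*} [AddCommGroup W] [Module ℝ W] (S : ℍ[ℝ] →ₗ[ℝ] W)
    (z : ℍ[ℝ]) : S z = z.re • S (quat 1 0 0 0) + z.imI • S (quat 0 1 0 0) +
      z.imJ • S (quat 0 0 1 0) + z.imK • S (quat 0 0 0 1) := by
  simp only [← map_smul, ← map_add]
  congr 1
  ext <;> simp

end Quat

/-! ### Skew operators on ℍ and the relations of su(2). -/

section SpinHalf

variable {W : Type*} [AddCommGroup W] [Module ℝ W]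

/-- The relations `X k ^ 2 = -1/4`, `X 0 X 1 = X 2 / 2` (and cyclically) hold at `w`. -/
def IsSpinHalf (X : Fin 3 → W →ₗ[ℝ] W) (w : W) : Prop :=
  (∀ k, X k (X k w) = -(1 / 4 : ℝ) • w) ∧ X 0 (X 1 w) = (1 / 2 : ℝ) • X 2 w ∧
    X 1 (X 2 w) = (1 / 2 : ℝ) • X 0 w ∧ X 2 (X 0 w) = (1 / 2 : ℝ) • X 1 w

/-- This is the splitting of so(4) into left and right multiplications by imaginary quaternions. The
sum a + b is S(1), and the differences of their coordinates are read off from S(i) and S(j). -/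
theorem exists_eq_mul_add_mul_of_skew {S : ℍ[ℝ] →ₗ[ℝ] ℍ[ℝ]} (hS : ∀ z, (S z * star z).re = 0) :
    ∃ a b : ℍ[ℝ], a.re = 0 ∧ b.re = 0 ∧ ∀ z, S z = a * z + z * b := by
  set s0 := S (quat 1 0 0 0) with h0
  set s1 := S (quat 0 1 0 0) with h1
  set s2 := S (quat 0 0 1 0) with h2
  set s3 := S (quat 0 0 0 1) with h3
  have hlin := linearMap_quaternion_apply S
  rw [← h0, ← h1, ← h2, ← h3] at hlin
  have e0 := hS (quat 1 0 0 0)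
  have e1 := hS (quat 0 1 0 0)
  have e2 := hS (quat 0 0 1 0)
  have e3 := hS (quat 0 0 0 1)
  have e01 := hS (quat 1 1 0 0)
  have e02 := hS (quat 1 0 1 0)
  have e03 := hS (quat 1 0 0 1)
  have e12 := hS (quat 0 1 1 0)
  have e13 := hS (quat 0 1 0 1)
  have e23 := hS (quat 0 0 1 1)
  rw [hlin] at e0 e1 e2 e3 e01 e02 e03 e12 e13 e23
  simp at e0 e1 e2 e3 e01 e02 e03 e12 e13 e23
  refine ⟨quat 0 ((s0.imI + s2.imK) / 2) ((s0.imJ - s1.imK) / 2) ((s0.imK + s1.imJ) / 2),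
    quat 0 ((s0.imI - s2.imK) / 2) ((s0.imJ + s1.imK) / 2) ((s0.imK - s1.imJ) / 2), rfl, rfl, fun z => ?_⟩
  rw [hlin]
  ext <;> simp
  · linear_combination z.re * e0 + z.imI * (e01 - e0 - e1) + z.imJ * (e02 - e0 - e2) + z.imK * (e03 - e0 - e3)
  · linear_combination z.imI * e1 + z.imJ * (e12 - e1 - e2) + z.imK * (e13 - e1 - e3)
  · linear_combination z.imJ * e2 + z.imK * (e23 - e2 - e3)
  · linear_combination z.imK * e3

/-- The splitting of so(4) is direct: z = 1 gives b = -a, and then a commutes with i and j, so an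
imaginary a is 0. -/
theorem eq_zero_of_mul_add_mul_eq_zero {a b : ℍ[ℝ]} (ha : a.re = 0) (hb : b.re = 0)
    (h : ∀ z : ℍ[ℝ], a * z + z * b = 0) : a = 0 ∧ b = 0 := by
  have h0 := h (quat 1 0 0 0)
  have h1 := h (quat 0 1 0 0)
  have h2 := h (quat 0 0 1 0)
  rw [Quaternion.ext_iff] at h0 h1 h2
  simp [ha, hb] at h0 h1 h2
  obtain ⟨h01, h02, h03⟩ := h0
  constructor <;> ext <;> simp [ha, hb] <;> linarith [h1.1, h1.2, h2.1, h2.2]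

/-- Imaginary quaternions satisfying the relations of `su(2)` vanish or are halves of
quaternion units. -/
theorem eq_zero_or_spinHalf_of_commutator {a b c : ℍ[ℝ]} (ha : a.re = 0) (hb : b.re = 0)
    (hc : c.re = 0) (h1 : a * b - b * a = c) (h2 : b * c - c * b = a) (h3 : c * a - a * c = b) :
    (a = 0 ∧ b = 0 ∧ c = 0) ∨
      (a * a = -(1 / 4 : ℝ) • 1 ∧ b * b = -(1 / 4 : ℝ) • 1 ∧ c * c = -(1 / 4 : ℝ) • 1 ∧
        a * b = (1 / 2 : ℝ) • c ∧ b * c = (1 / 2 : ℝ) • a ∧ c * a = (1 / 2 : ℝ) • b ∧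
        b * a = -(1 / 2 : ℝ) • c ∧ c * b = -(1 / 2 : ℝ) • a ∧ a * c = -(1 / 2 : ℝ) • b) := by
  -- The commutator of imaginary quaternions is twice their cross product, so doubling the
  -- coordinates turns it into the cross product itself.
  let v : ℍ[ℝ] → Fin 3 → ℝ := fun z => ![2 * z.imI, 2 * z.imJ, 2 * z.imK]
  have key : ∀ {a b c : ℍ[ℝ]}, a * b - b * a = c → crossProduct (v a) (v b) = v c := by
    rintro a b c rfl
    ext i
    fin_cases i <;> simp [v, cross_apply] <;> ring
  rcases eq_zero_or_orthonormal_of_cross (key h1) (key h2) (key h3) with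
    ⟨ha', hb', hc'⟩ | ⟨aa, bb, cc, ab, bc, ca⟩
  · left
    have hz : ∀ {a : ℍ[ℝ]}, a.re = 0 → v a = 0 → a = 0 := by
      intro a ha h
      have e0 := congrFun h 0
      have e1 := congrFun h 1
      have e2 := congrFun h 2
      simp [v] at e0 e1 e2
      ext <;> simp [*]
    exact ⟨hz ha ha', hz hb hb', hz hc hc'⟩
  · right
    have hsq : ∀ {a : ℍ[ℝ]}, a.re = 0 → v a ⬝ᵥ v a = 1 → a * a = -(1 / 4 : ℝ) • 1 := by
      intro a ha h
      simp [v, dotProduct, Fin.sum_univ_three] at h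
      ext <;> simp [ha] <;> linarith
    have hm : ∀ {a b : ℍ[ℝ]}, a.re = 0 → b.re = 0 → v a ⬝ᵥ v b = 0 → a * b = - (b * a) := by
      intro a b ha hb h
      simp [v, dotProduct, Fin.sum_univ_three] at h
      ext <;> simp [ha, hb] <;> linarith
    have hm2 : ∀ {a b c : ℍ[ℝ]}, a * b = -(b * a) → a * b - b * a = c →
        a * b = (1 / 2 : ℝ) • c ∧ b * a = -(1 / 2 : ℝ) • c := by
      rintro a b c h rfl
      rw [h]
      constructor <;> module
    exact ⟨hsq ha aa, hsq hb bb, hsq hc cc, (hm2 (hm ha hb ab) h1).1, (hm2 (hm hb hc bc) h2).1,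
      (hm2 (hm hc ha ca) h3).1, (hm2 (hm ha hb ab) h1).2, (hm2 (hm hb hc bc) h2).2,
      (hm2 (hm hc ha ca) h3).2⟩

end SpinHalf

/-! ### Four-dimensional components. -/

section SpinHalf

variable {W : Type*} [AddCommGroup W] [Module ℝ W]

/-- The quaternion with coordinates in the basis `b`. -/
def quatEquivOfBasis (b : Module.Basis (Fin 4) ℝ W) : W ≃ₗ[ℝ] ℍ[ℝ] :=
  b.equivFun.trans
    { toFun := fun x => quat (x 0) (x 1) (x 2) (x 3)
      invFun := fun z => ![z.re, z.imI, z.imJ, z.imK]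
      map_add' := fun x y => by ext <;> simp
      map_smul' := fun c x => by ext <;> simp
      left_inv := fun x => by ext i; fin_cases i <;> simp
      right_inv := fun z => by ext <;> simp }

theorem re_quatEquivOfBasis_mul_star {b : Module.Basis (Fin 4) ℝ W} {B : LinearMap.BilinForm ℝ W}
    (hb : ∀ i j, B (b i) (b j) = if i = j then 1 else 0) (v w : W) :
    (quatEquivOfBasis b v * star (quatEquivOfBasis b w)).re = B v w := by
  conv_rhs => rw [← b.sum_equivFun v, ← b.sum_equivFun w]
  change (quat (b.equivFun v 0) (b.equivFun v 1) (b.equivFun v 2) (b.equivFun v 3) *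
    star (quat (b.equivFun w 0) (b.equivFun w 1) (b.equivFun w 2) (b.equivFun w 3))).re = _
  generalize b.equivFun v = x
  generalize b.equivFun w = y
  simp [Fin.sum_univ_four, hb]

/-- A four-dimensional representation of `so(3)` by skew operators without fixed vectors
satisfies the relations of the spin representation. -/
theorem isSpinHalf_of_finrank_eq_four [FiniteDimensional ℝ W] (hW : Module.finrank ℝ W = 4)
    {B : LinearMap.BilinForm ℝ W} (hB : ∀ v w, B v w = B w v) (hpos : ∀ v, v ≠ 0 → 0 < B v v)
    {X : Fin 3 → W →ₗ[ℝ] W} (hskew : ∀ k v w, B (X k v) w = - B v (X k w))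
    (h01 : ∀ w, X 0 (X 1 w) - X 1 (X 0 w) = X 2 w) (h12 : ∀ w, X 1 (X 2 w) - X 2 (X 1 w) = X 0 w)
    (h20 : ∀ w, X 2 (X 0 w) - X 0 (X 2 w) = X 1 w) (hfix : ∀ w, (∀ k, X k w = 0) → w = 0) (w : W) :
    IsSpinHalf X w := by
  obtain ⟨b, hb⟩ := exists_orthonormal_basis B hB hpos hW
  let e := quatEquivOfBasis b
  have he : ∀ v w, (e v * star (e w)).re = B v w := re_quatEquivOfBasis_mul_star hb
  have hex : ∀ k, ∃ p q : ℍ[ℝ], p.re = 0 ∧ q.re = 0 ∧ ∀ w, e (X k w) = p * e w + e w * q := by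
    intro k
    obtain ⟨p, q, hp, hq, h⟩ := exists_eq_mul_add_mul_of_skew
      (S := e.toLinearMap ∘ₗ X k ∘ₗ e.symm.toLinearMap) (fun z => by
        obtain ⟨w, rfl⟩ := e.surjective z
        simp only [LinearMap.comp_apply, LinearEquiv.coe_coe, LinearEquiv.symm_apply_apply, he]
        have := hskew k w w
        rw [hB w] at this
        linarith)
    refine ⟨p, q, hp, hq, fun w => ?_⟩
    have := h (e w)
    simpa using this
  choose p q hp hq hX using hex
  -- Left and right multiplications commute, so the bracket relation splits by uniqueness. Right
  -- multiplication reverses products, which is why -q rather than q satisfies the relations.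
  have hbr : ∀ {i j k}, (∀ w, X i (X j w) - X j (X i w) = X k w) →
      p i * p j - p j * p i = p k ∧ (-q i) * (-q j) - (-q j) * (-q i) = -q k := by
    intro i j k hijk
    have h1 : ∀ z : ℍ[ℝ], (p i * p j - p j * p i - p k) * z +
        z * (q j * q i - q i * q j - q k) = 0 := by
      intro z
      obtain ⟨w, rfl⟩ := e.surjective z
      have h2 := congrArg e (hijk w)
      rw [map_sub, hX, hX, hX, hX, hX] at h2
      rw [← sub_eq_zero] at h2
      rw [← h2]
      noncomm_ring
    obtain ⟨h3, h4⟩ := eq_zero_of_mul_add_mul_eq_zero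
      (by simp [hp]; ring) (by simp [hq]; ring) h1
    refine ⟨sub_eq_zero.1 h3, ?_⟩
    rw [← sub_eq_zero.1 h4]
    noncomm_ring
  have hq' : ∀ k, (-q k).re = 0 := fun k => by simp [hq]
  -- Each of p and -q is zero or a triple of half units. Both zero makes every vector fixed, exactly
  -- one zero gives the claim, and both nonzero must be excluded.
  rcases eq_zero_or_spinHalf_of_commutator (hp 0) (hp 1) (hp 2) (hbr h01).1 (hbr h12).1 (hbr h20).1
    with ⟨p0, p1, p2⟩ | ⟨p00, p11, p22, p01, p12, p20, p10, p21, p02⟩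
  · have hX' : ∀ k w, e (X k w) = e w * q k := by
      intro k w
      rw [hX]
      fin_cases k <;> simp [p0, p1, p2]
    rcases eq_zero_or_spinHalf_of_commutator (hq' 0) (hq' 1) (hq' 2) (hbr h01).2 (hbr h12).2
      (hbr h20).2 with ⟨q0, q1, q2⟩ | ⟨q00, q11, q22, q01, q12, q20, q10, q21, q02⟩
    · have hw : w = 0 := hfix w fun k => e.injective (by
        rw [hX', map_zero]
        rw [neg_eq_zero] at q0 q1 q2
        fin_cases k <;> simp [q0, q1, q2])
      subst hw
      refine ⟨fun k => ?_, ?_, ?_, ?_⟩ <;> simp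
    · simp only [neg_mul_neg] at *
      refine ⟨fun k => e.injective ?_, e.injective ?_, e.injective ?_, e.injective ?_⟩
      · rw [hX', hX', map_smul, mul_assoc]
        fin_cases k <;> simp [q00, q11, q22]
      · rw [hX', hX', map_smul, hX', mul_assoc, q10]
        simp
      · rw [hX', hX', map_smul, hX', mul_assoc, q21]
        simp
      · rw [hX', hX', map_smul, hX', mul_assoc, q02]
        simp
  · rcases eq_zero_or_spinHalf_of_commutator (hq' 0) (hq' 1) (hq' 2) (hbr h01).2 (hbr h12).2
      (hbr h20).2 with ⟨q0, q1, q2⟩ | ⟨q00, q11, q22, q01, q12, q20, q10, q21, q02⟩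
    · have hX' : ∀ k w, e (X k w) = p k * e w := by
        intro k w
        rw [neg_eq_zero] at q0 q1 q2
        rw [hX]
        fin_cases k <;> simp [q0, q1, q2]
      refine ⟨fun k => e.injective ?_, e.injective ?_, e.injective ?_, e.injective ?_⟩
      · rw [hX', hX', map_smul, ← mul_assoc]
        fin_cases k <;> simp [p00, p11, p22]
      · rw [hX', hX', map_smul, hX', ← mul_assoc, p01]
        simp
      · rw [hX', hX', map_smul, hX', ← mul_assoc, p12]
        simp
      · rw [hX', hX', map_smul, hX', ← mul_assoc, p20]
        simp
    · exfalso
      simp only [neg_mul_neg] at *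
      -- In this case ℍ splits into a fixed line and a three-dimensional part; T has values in the
      -- vectors killed by all generators, so by assumption it vanishes.
      let T : ℍ[ℝ] → ℍ[ℝ] := fun z => z + (4 : ℝ) • (p 0 * z * q 0 + p 1 * z * q 1 + p 2 * z * q 2)
      have hT : ∀ z, T z = 0 := by
        intro z
        refine (e.symm.map_eq_zero_iff).1 (hfix _ fun k => e.injective ?_)
        rw [hX, map_zero, e.apply_symm_apply]
        have key : ∀ {a b c u v w : ℍ[ℝ]}, a * a = -(1 / 4 : ℝ) • 1 → a * b = (1 / 2 : ℝ) • c →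
            a * c = -(1 / 2 : ℝ) • b → u * u = -(1 / 4 : ℝ) • 1 → v * u = -(1 / 2 : ℝ) • -w →
            w * u = (1 / 2 : ℝ) • -v →
            a * (z + (4 : ℝ) • (a * z * u + b * z * v + c * z * w)) +
              (z + (4 : ℝ) • (a * z * u + b * z * v + c * z * w)) * u = 0 := by
          intro a b c u v w aa ab ac uu vu wu
          have e1 : a * (z + (4 : ℝ) • (a * z * u + b * z * v + c * z * w)) +
              (z + (4 : ℝ) • (a * z * u + b * z * v + c * z * w)) * u =
              a * z + (4 : ℝ) • ((a * a) * z * u + (a * b) * z * v + (a * c) * z * w) +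
              z * u + (4 : ℝ) • (a * z * (u * u) + b * z * (v * u) + c * z * (w * u)) := by
            simp only [mul_add, add_mul, smul_add, mul_smul_comm, smul_mul_assoc, mul_assoc]
            abel
          rw [e1, aa, ab, ac, uu, vu, wu]
          simp only [smul_mul_assoc, mul_smul_comm, one_mul, mul_one, smul_neg, mul_neg]
          module
        fin_cases k
        · exact key p00 p01 p02 q00 q10 q20
        · have := key p11 p12 p10 q11 q21 q01
          convert this using 3 <;> simp only [T] <;> congr 2 <;> abel
        · have := key p22 p20 p21 q22 q02 q12
          convert this using 3 <;> simp only [T] <;> congr 2 <;> abel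
      -- The four diagonal entries of T add up to its trace. Since p and q are imaginary, z ↦ pzq
      -- has trace 0, so T has trace 4 and cannot vanish.
      have t0 := congrArg QuaternionAlgebra.re (hT (quat 1 0 0 0))
      have t1 := congrArg QuaternionAlgebra.imI (hT (quat 0 1 0 0))
      have t2 := congrArg QuaternionAlgebra.imJ (hT (quat 0 0 1 0))
      have t3 := congrArg QuaternionAlgebra.imK (hT (quat 0 0 0 1))
      simp [T, hp, hq] at t0 t1 t2 t3
      linarith

end SpinHalf

/-! ### Three-dimensional components. -/

section SpinOne

open Matrix

variable {W : Type*} [AddCommGroup W] [Module ℝ W]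

/-- Relations of the adjoint representation of `so(3)` at the vector `w`. -/
def IsSpinOne (X : Fin 3 → W →ₗ[ℝ] W) (w : W) : Prop :=
  X 0 (X 0 w) + X 1 (X 1 w) + X 2 (X 2 w) = -(2 : ℝ) • w ∧
    X 1 (X 0 (X 2 w)) + X 2 (X 0 (X 1 w)) = 0 ∧ X 1 (X 0 (X 1 w)) = 0

theorem exists_eq_cross_of_skew {S : (Fin 3 → ℝ) →ₗ[ℝ] (Fin 3 → ℝ)} (hS : ∀ z, S z ⬝ᵥ z = 0) :
    ∃ a, ∀ z, S z = crossProduct a z := by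
  set s0 := S ![1, 0, 0] with h0
  set s1 := S ![0, 1, 0] with h1
  set s2 := S ![0, 0, 1] with h2
  have hlin : ∀ z, S z = z 0 • s0 + z 1 • s1 + z 2 • s2 := by
    intro z
    rw [h0, h1, h2]
    simp only [← map_smul, ← map_add]
    congr 1
    ext i; fin_cases i <;> simp
  have e0 := hS ![1, 0, 0]
  have e1 := hS ![0, 1, 0]
  have e2 := hS ![0, 0, 1]
  have e01 := hS ![1, 1, 0]
  have e02 := hS ![1, 0, 1]
  have e12 := hS ![0, 1, 1]
  rw [hlin] at e0 e1 e2 e01 e02 e12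
  simp [dotProduct, Fin.sum_univ_three] at e0 e1 e2 e01 e02 e12
  refine ⟨![s1 2, s2 0, s0 1], fun z => ?_⟩
  rw [hlin, cross_apply]
  ext i
  fin_cases i <;> simp
  · linear_combination z 0 * e0 + z 1 * (e01 - e0 - e1)
  · linear_combination z 1 * e1 + z 2 * (e12 - e1 - e2)
  · linear_combination z 0 * (e02 - e0 - e2) + z 2 * e2

/-- A three-dimensional representation of `so(3)` by skew operators without fixed vectors
satisfies the relations of the adjoint representation. -/
theorem isSpinOne_of_finrank_eq_three [FiniteDimensional ℝ W] (hW : Module.finrank ℝ W = 3)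
    {B : LinearMap.BilinForm ℝ W} (hB : ∀ v w, B v w = B w v) (hpos : ∀ v, v ≠ 0 → 0 < B v v)
    {X : Fin 3 → W →ₗ[ℝ] W} (hskew : ∀ k v w, B (X k v) w = - B v (X k w))
    (h01 : ∀ w, X 0 (X 1 w) - X 1 (X 0 w) = X 2 w) (h12 : ∀ w, X 1 (X 2 w) - X 2 (X 1 w) = X 0 w)
    (h20 : ∀ w, X 2 (X 0 w) - X 0 (X 2 w) = X 1 w) (hfix : ∀ w, (∀ k, X k w = 0) → w = 0) :
    (∀ w, IsSpinOne X w) ∧ ∃ w, w ≠ 0 ∧ X 0 w = 0 := by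
  obtain ⟨b, hb⟩ := exists_orthonormal_basis B hB hpos hW
  let e := b.equivFun
  have he : ∀ v w, e v ⬝ᵥ e w = B v w := by
    intro v w
    conv_rhs => rw [← b.sum_equivFun v, ← b.sum_equivFun w]
    change b.equivFun v ⬝ᵥ b.equivFun w = _
    generalize b.equivFun v = x
    generalize b.equivFun w = y
    simp [Fin.sum_univ_three, hb, dotProduct]
  have hex : ∀ k, ∃ p, ∀ w, e (X k w) = crossProduct p (e w) := by
    intro k
    obtain ⟨p, h⟩ := exists_eq_cross_of_skew
      (S := e.toLinearMap ∘ₗ X k ∘ₗ e.symm.toLinearMap) (fun z => by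
        obtain ⟨w, rfl⟩ := e.surjective z
        simp only [LinearMap.comp_apply, LinearEquiv.coe_coe, LinearEquiv.symm_apply_apply, he]
        have := hskew k w w
        rw [hB w] at this
        linarith)
    refine ⟨p, fun w => ?_⟩
    have := h (e w)
    simpa using this
  choose p hX using hex
  -- By the Jacobi identity the commutator of p × · and p' × · is (p × p') × ·, and testing on two
  -- basis vectors recovers the vector.
  have hbr : ∀ {i j k}, (∀ w, X i (X j w) - X j (X i w) = X k w) →
      crossProduct (p i) (p j) = p k := by
    intro i j k hijk
    have h1 : ∀ z, crossProduct (crossProduct (p i) (p j)) z = crossProduct (p k) z := by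
      intro z
      obtain ⟨w, rfl⟩ := e.surjective z
      rw [← hX, ← hijk, map_sub, hX, hX, hX, hX, cross_cross]
    have f0 := h1 ![1, 0, 0]
    have f1 := h1 ![0, 1, 0]
    rw [cross_apply (_ : Fin 3 → ℝ) ![1, 0, 0], cross_apply (_ : Fin 3 → ℝ) ![1, 0, 0]] at f0
    rw [cross_apply (_ : Fin 3 → ℝ) ![0, 1, 0], cross_apply (_ : Fin 3 → ℝ) ![0, 1, 0]] at f1
    have g1 := congrFun f0 1
    have g2 := congrFun f0 2
    have g0 := congrFun f1 2
    simp at g0 g1 g2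
    ext i
    fin_cases i
    · exact g0
    · exact g2
    · exact g1
  rcases eq_zero_or_orthonormal_of_cross (hbr h01) (hbr h12) (hbr h20) with
    ⟨p0, p1, p2⟩ | ⟨p00, p11, p22, p01, p12, p20⟩
  · exfalso
    have h0 : ∀ w : W, w = 0 := fun w => hfix w fun k => e.injective (by
      rw [hX, map_zero]
      fin_cases k <;> simp [p0, p1, p2])
    have : Subsingleton W := ⟨fun a b => by rw [h0 a, h0 b]⟩
    rw [Module.finrank_zero_of_subsingleton] at hW
    norm_num at hW
  -- The generator X₀ is the cross product with p₀, so p₀ itself is a nonzero vector it kills.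
  · refine ⟨fun w => ⟨e.injective ?_, e.injective ?_, e.injective ?_⟩, e.symm (p 0), ?_, ?_⟩
    -- For orthonormal pₖ one has Σ pₖ(pₖ · w) = w, hence Σ pₖ × (pₖ × w) = w - 3w.
    · have hcol : ∀ i j, p 0 i * p 0 j + p 1 i * p 1 j + p 2 i * p 2 j = if i = j then 1 else 0 := by
        let M : Matrix (Fin 3) (Fin 3) ℝ := Matrix.of p
        have h1 : M * Mᵀ = 1 := by
          ext i j
          have : (M * Mᵀ) i j = p i ⬝ᵥ p j := rfl
          rw [this]
          fin_cases i <;> fin_cases j <;> simp [*, dotProduct_comm (p 1) (p 0),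
            dotProduct_comm (p 2) (p 1), dotProduct_comm (p 0) (p 2)]
        intro i j
        have h3 : Mᵀ * M = 1 := mul_eq_one_comm.1 h1
        have h2 := congrFun (congrFun h3 i) j
        rw [Matrix.one_apply] at h2
        rw [← h2]
        simp [Matrix.mul_apply, Fin.sum_univ_three, M]
      rw [map_add, map_add, map_smul, hX, hX, hX, hX, hX, hX]
      simp only [cross_cross_eq_smul_sub_smul', p00, p11, p22]
      ext i
      have hi := hcol i
      have hi0 := hi 0
      have hi1 := hi 1
      have hi2 := hi 2
      simp [dotProduct, Fin.sum_univ_three]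
      fin_cases i <;> simp at hi0 hi1 hi2 ⊢
      · linear_combination e w 0 * hi0 + e w 1 * hi1 + e w 2 * hi2
      · linear_combination e w 0 * hi0 + e w 1 * hi1 + e w 2 * hi2
      · linear_combination e w 0 * hi0 + e w 1 * hi1 + e w 2 * hi2
    · rw [map_add, map_zero, hX, hX, hX, hX, hX, hX, cross_cross_eq_smul_sub_smul' (p 0),
        cross_cross_eq_smul_sub_smul' (p 0), dotProduct_comm (p 1) (p 0), p20, p01, zero_smul,
        sub_zero, sub_zero, map_smul, map_smul, ← smul_add, cross_anticomm', smul_zero]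
    · rw [map_zero, hX, hX, hX, cross_cross_eq_smul_sub_smul' (p 0), dotProduct_comm (p 1) (p 0), p01,
        zero_smul, sub_zero, map_smul, cross_self, smul_zero]
    · intro h
      rw [LinearEquiv.map_eq_zero_iff] at h
      simp [h] at p00
    · apply e.injective
      rw [hX, e.apply_symm_apply, cross_self, map_zero]

end SpinOne

/-! ### The quotient map of ℍ ⊕ ℍ: fibres and surjectivity. -/

section Quotient44

theorem norm_sq_eq (z : ℍ[ℝ]) : ‖z‖ ^ 2 = z.re ^ 2 + z.imI ^ 2 + z.imJ ^ 2 + z.imK ^ 2 := by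
  rw [sq, ← Quaternion.normSq_eq_norm_mul_self, Quaternion.normSq_def']

theorem inv_eq_star_of_norm_eq_one {h : ℍ[ℝ]} (hh : ‖h‖ = 1) : h⁻¹ = star h := by
  rw [Quaternion.inv_def, Quaternion.normSq_eq_norm_mul_self, hh]
  simp

/-- Equal values give equal |z₁|, |z₂|, after which the quotient of two corresponding nonzero
components is the required unit quaternion, and the product z₁z̄₂ settles the other component. -/
theorem quot44_eq_iff (z w : ℍ[ℝ] × ℍ[ℝ]) : quot44 z = quot44 w ↔ ∃ h, act44 h z = w := by
  constructor
  · intro h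
    obtain ⟨z1, z2⟩ := z
    obtain ⟨w1, w2⟩ := w
    simp only [quot44, Prod.mk.injEq] at h
    obtain ⟨h1, h2⟩ := h
    have h3 : ‖z1‖ * ‖z2‖ = ‖w1‖ * ‖w2‖ := by
      have := congrArg norm h2
      simpa using this
    have hsum : ‖z1‖ ^ 2 + ‖z2‖ ^ 2 = ‖w1‖ ^ 2 + ‖w2‖ ^ 2 := by
      -- The sum of squares satisfies (α + β)² = (α - β)² + 4αβ, and both terms on the right are
      -- known.
      have h4 : (‖z1‖ ^ 2 + ‖z2‖ ^ 2) ^ 2 = (‖w1‖ ^ 2 + ‖w2‖ ^ 2) ^ 2 := by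
        linear_combination (‖z1‖ ^ 2 - ‖z2‖ ^ 2 + (‖w1‖ ^ 2 - ‖w2‖ ^ 2)) * h1 +
          4 * (‖z1‖ * ‖z2‖ + ‖w1‖ * ‖w2‖) * h3
      exact (sq_eq_sq₀ (by positivity) (by positivity)).1 h4
    have n1 : ‖z1‖ = ‖w1‖ := (sq_eq_sq₀ (norm_nonneg _) (norm_nonneg _)).1 (by linarith)
    have n2 : ‖z2‖ = ‖w2‖ := (sq_eq_sq₀ (norm_nonneg _) (norm_nonneg _)).1 (by linarith)
    by_cases hz1 : z1 = 0
    · have hw1 : w1 = 0 := by rw [← norm_eq_zero, ← n1, hz1, norm_zero]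
      by_cases hz2 : z2 = 0
      · have hw2 : w2 = 0 := by rw [← norm_eq_zero, ← n2, hz2, norm_zero]
        exact ⟨⟨1, norm_one⟩, by simp [act44, hz1, hz2, hw1, hw2]⟩
      · have hw2 : w2 ≠ 0 := by rw [← norm_ne_zero_iff, ← n2]; exact norm_ne_zero_iff.2 hz2
        refine ⟨⟨w2⁻¹ * z2, ?_⟩, ?_⟩
        · rw [norm_mul, norm_inv, n2, inv_mul_cancel₀ (norm_ne_zero_iff.2 hw2)]
        · simp [act44, hz1, hw1, mul_inv_rev, hz2]
    · have hw1 : w1 ≠ 0 := by rw [← norm_ne_zero_iff, ← n1]; exact norm_ne_zero_iff.2 hz1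
      have hh : ‖w1⁻¹ * z1‖ = 1 := by
        rw [norm_mul, norm_inv, n1, inv_mul_cancel₀ (norm_ne_zero_iff.2 hw1)]
      refine ⟨⟨w1⁻¹ * z1, hh⟩, ?_⟩
      simp only [act44, Prod.mk.injEq]
      constructor
      · simp [mul_inv_rev, hz1]
      · rw [inv_eq_star_of_norm_eq_one hh]
        have h4 : (w1⁻¹ * z1) * star z2 = star w2 := by
          rw [mul_assoc, h2, inv_mul_cancel_left₀ hw1]
        have h5 := congrArg star h4
        simpa using h5
  · rintro ⟨h, rfl⟩
    have hh := inv_eq_star_of_norm_eq_one h.2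
    have hs : star (h : ℍ[ℝ]) * (h : ℍ[ℝ]) = 1 := by
      rw [← hh]; exact inv_mul_cancel₀ (by rw [← norm_ne_zero_iff, h.2]; exact one_ne_zero)
    simp only [quot44, act44, Prod.mk.injEq]
    constructor
    · simp [h.2]
    · rw [hh, star_mul, star_star, mul_assoc, ← mul_assoc (star _), hs, one_mul]

theorem quot44_surjective : Function.Surjective quot44 := by
  rintro ⟨r, p⟩
  -- This is the value |z₁|² + |z₂|² must have, so |z₁|² = (r + s)/2, and z₁ can be taken real. If r
  -- + s = 0, then p = 0 and z₁ = 0.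
  set s := √(r ^ 2 + 4 * ‖p‖ ^ 2) with hs
  have hs2 : s ^ 2 = r ^ 2 + 4 * ‖p‖ ^ 2 := Real.sq_sqrt (by positivity)
  have hs0 : 0 ≤ s := Real.sqrt_nonneg _
  have hsr : |r| ≤ s := Real.abs_le_sqrt (by nlinarith [sq_nonneg ‖p‖])
  have hr := abs_le.1 hsr
  by_cases ha : r + s = 0
  · have hp : p = 0 := by
      have h1 : s = -r := by linarith
      rw [h1] at hs2
      rw [← norm_eq_zero]
      nlinarith
    refine ⟨(0, ((√(-r) : ℝ) : ℍ[ℝ])), ?_⟩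
    have : 0 ≤ -r := by linarith
    simp [quot44, hp, Real.sq_sqrt this]
  · set a := √((r + s) / 2) with hadef
    have ha2 : a ^ 2 = (r + s) / 2 := Real.sq_sqrt (by linarith)
    have ha0 : a ≠ 0 := by
      intro h; rw [h] at ha2; apply ha; linarith
    refine ⟨((a : ℍ[ℝ]), (a⁻¹ : ℝ) • star p), ?_⟩
    simp only [quot44, Prod.mk.injEq]
    constructor
    · rw [norm_smul, norm_star, mul_pow, norm_inv, inv_pow, Quaternion.norm_coe, Real.norm_eq_abs, sq_abs]
      field_simp
      have h4 : a ^ 4 = ((r + s) / 2) ^ 2 := by rw [← ha2]; ring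
      rw [ha2]
      nlinarith
    · ext <;> simp <;> field_simp

end Quotient44

/-! ### The quotient map of ℍ ⊕ ℍ₀: fibres and surjectivity. -/

section Quotient43

theorem coe_twist (z : ℍ[ℝ]) (x : pureIm) : (twist z x : ℍ[ℝ]) = z * x * star z := rfl

theorem norm_coe_twist (z : ℍ[ℝ]) (x : pureIm) :
    ‖(twist z x : ℍ[ℝ])‖ = ‖z‖ ^ 2 * ‖(x : ℍ[ℝ])‖ := by
  rw [coe_twist, norm_mul, norm_mul, norm_star]; ring

theorem twist_twist (a b : ℍ[ℝ]) (x : pureIm) : twist a (twist b x) = twist (a * b) x := by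
  apply Subtype.ext
  simp only [coe_twist, star_mul, mul_assoc]

theorem star_mul_self_of_norm_eq_one {h : ℍ[ℝ]} (hh : ‖h‖ = 1) : star h * h = 1 := by
  rw [← inv_eq_star_of_norm_eq_one hh]
  exact inv_mul_cancel₀ (by rw [← norm_ne_zero_iff, hh]; exact one_ne_zero)

theorem twist_one (x : pureIm) : twist 1 x = x := Subtype.ext (by simp [coe_twist])

theorem mul_self_of_re_eq_zero {z : ℍ[ℝ]} (hz : z.re = 0) :
    z * z = -((‖z‖ ^ 2 : ℝ) : ℍ[ℝ]) := by
  have hn := norm_sq_eq z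
  generalize ‖z‖ ^ 2 = n at hn ⊢
  rw [hz] at hn
  ext <;> simp [hz] <;> linarith

/-- Unit quaternions act transitively on spheres in the space of imaginary quaternions. -/
theorem exists_twist_eq {x y : pureIm} (hxy : ‖(x : ℍ[ℝ])‖ = ‖(y : ℍ[ℝ])‖) :
    ∃ h : UnitQuaternion, twist h x = y := by
  have scale : ∀ k : ℍ[ℝ], k ≠ 0 → k * (x : ℍ[ℝ]) = (y : ℍ[ℝ]) * k →
      ∃ h : UnitQuaternion, twist h x = y := by
    intro k hk hkx
    have hk' : ‖k‖ ≠ 0 := norm_ne_zero_iff.2 hk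
    have hn : ‖(‖k‖⁻¹ : ℝ) • k‖ = 1 := by
      rw [norm_smul, norm_inv, norm_norm, inv_mul_cancel₀ hk']
    refine ⟨⟨(‖k‖⁻¹ : ℝ) • k, hn⟩, Subtype.ext ?_⟩
    have hn2 : ((‖k‖⁻¹ : ℝ) • k) * star ((‖k‖⁻¹ : ℝ) • k) = 1 := by
      have := star_mul_self_of_norm_eq_one (h := star ((‖k‖⁻¹ : ℝ) • k)) (by rw [norm_star, hn])
      rwa [star_star] at this
    rw [coe_twist, smul_mul_assoc, hkx, ← mul_smul_comm, mul_assoc, hn2, mul_one]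
  have hx : (x : ℍ[ℝ]).re = 0 := x.2
  have hy : (y : ℍ[ℝ]).re = 0 := y.2
  have hxx := mul_self_of_re_eq_zero hx
  have hyy := mul_self_of_re_eq_zero hy
  rw [← hxy] at hyy
  by_cases h0 : x = 0
  · subst h0
    have : y = 0 := Subtype.ext (norm_eq_zero.1 (hxy.symm.trans (by simp)))
    subst this
    exact ⟨⟨1, norm_one⟩, twist_one _⟩
  have hx0 : (x : ℍ[ℝ]) ≠ 0 := fun h => h0 (Subtype.ext h)
  -- With x² = y² = -|x|², the quaternion k = |x|² - yx satisfies kx = yk. It vanishes only for y =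
  -- -x, where any nonzero imaginary k orthogonal to x works.
  by_cases hk : ((‖(x : ℍ[ℝ])‖ ^ 2 : ℝ) : ℍ[ℝ]) - y * x = 0
  · have hyx : (y : ℍ[ℝ]) = -x := by
      have h1 : (y : ℍ[ℝ]) * x = -(x : ℍ[ℝ]) * x := by
        rw [neg_mul, hxx, neg_neg]; exact (sub_eq_zero.1 hk).symm
      exact mul_right_cancel₀ hx0 h1
    by_cases hi : (x : ℍ[ℝ]).imI = 0 ∧ (x : ℍ[ℝ]).imJ = 0
    · refine scale (quat 0 1 0 0) (fun h => ?_) ?_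
      · have := congrArg QuaternionAlgebra.imI h; simp at this
      · rw [hyx]; ext <;> simp [hx, hi.1, hi.2]
    · refine scale (quat 0 (-(x : ℍ[ℝ]).imJ) (x : ℍ[ℝ]).imI 0) (fun h => hi ?_) ?_
      · have h1 := congrArg QuaternionAlgebra.imI h
        have h2 := congrArg QuaternionAlgebra.imJ h
        simp at h1 h2
        exact ⟨h2, h1⟩
      · rw [hyx]; ext <;> simp [hx] <;> ring
  · refine scale _ hk ?_
    rw [sub_mul, mul_sub, mul_assoc, hxx, ← mul_assoc (y : ℍ[ℝ]) y, hyy, Quaternion.coe_mul_eq_smul,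
      Quaternion.mul_coe_eq_smul, mul_neg, neg_mul, Quaternion.coe_mul_eq_smul, Quaternion.mul_coe_eq_smul]
    abel

/-- The value determines both norms. If z ≠ 0 the unit quaternion is w⁻¹z; if z = 0 the first
component imposes nothing, and transitivity on spheres in ℍ₀ is needed. -/
theorem quot43_eq_iff (z w : ℍ[ℝ] × pureIm) : quot43 z = quot43 w ↔ ∃ h, act43 h z = w := by
  constructor
  · intro h
    obtain ⟨z, x⟩ := z
    obtain ⟨w, y⟩ := w
    simp only [quot43, Prod.mk.injEq] at h
    obtain ⟨h1, h2⟩ := h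
    have h3 : ‖z‖ ^ 2 * ‖(x : ℍ[ℝ])‖ = ‖w‖ ^ 2 * ‖(y : ℍ[ℝ])‖ := by
      rw [← norm_coe_twist, ← norm_coe_twist, h2]
    -- Here a = |z|² and b = |z₀|: with a - b² fixed, a larger b means a larger a, hence a strictly
    -- larger product ab.
    have aux : ∀ {a b c e : ℝ}, 0 ≤ a → 0 ≤ b → 0 ≤ c → 0 ≤ e → a - b ^ 2 = c - e ^ 2 →
        a * b = c * e → b ≤ e := by
      intro a b c e ha hb hc he h1 h2
      by_contra! hlt
      have h3 : c < a := by nlinarith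
      nlinarith [mul_pos (lt_of_le_of_lt hc h3) (lt_of_le_of_lt he hlt), mul_nonneg hc he]
    have n2 : ‖(x : ℍ[ℝ])‖ = ‖(y : ℍ[ℝ])‖ :=
      le_antisymm
        (aux (sq_nonneg ‖z‖) (norm_nonneg _) (sq_nonneg ‖w‖) (norm_nonneg _) h1 h3)
        (aux (sq_nonneg ‖w‖) (norm_nonneg _) (sq_nonneg ‖z‖) (norm_nonneg _) h1.symm h3.symm)
    have n1 : ‖z‖ = ‖w‖ := by
      rw [n2] at h1
      exact (sq_eq_sq₀ (norm_nonneg _) (norm_nonneg _)).1 (by linarith)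
    by_cases hz : z = 0
    · have hw : w = 0 := by rw [← norm_eq_zero, ← n1, hz, norm_zero]
      obtain ⟨h, hh⟩ := exists_twist_eq n2
      exact ⟨h, by simp [act43, hz, hw, hh]⟩
    · have hw : w ≠ 0 := by rw [← norm_ne_zero_iff, ← n1]; exact norm_ne_zero_iff.2 hz
      have hh : ‖w⁻¹ * z‖ = 1 := by
        rw [norm_mul, norm_inv, n1, inv_mul_cancel₀ (norm_ne_zero_iff.2 hw)]
      refine ⟨⟨w⁻¹ * z, hh⟩, ?_⟩
      simp only [act43, Prod.mk.injEq]
      constructor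
      · simp [mul_inv_rev, hz]
      · have hw' : star w ≠ 0 := by simpa using hw
        rw [← twist_twist, h2, twist_twist, inv_mul_cancel₀ hw, twist_one]
  · rintro ⟨h, rfl⟩
    have hs : star (h : ℍ[ℝ]) * (h : ℍ[ℝ]) = 1 := star_mul_self_of_norm_eq_one h.2
    simp only [quot43, act43, Prod.mk.injEq]
    constructor
    · rw [norm_coe_twist]
      simp [h.2]
    · rw [twist_twist, inv_eq_star_of_norm_eq_one h.2, mul_assoc, hs, mul_one]

theorem quot43_surjective : Function.Surjective quot43 := by
  rintro ⟨r, p⟩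
  -- The number b is to be |z₀|, so |z|² = r + b² and (r + b²)b = |p|. The left side vanishes at the
  -- least b ≥ 0 with r + b² ≥ 0, and the right end of the interval is a crude point where the first
  -- factor is at least 1 and the second at least |p|.
  obtain ⟨b, hb0, hbr, hb⟩ : ∃ b : ℝ, 0 ≤ b ∧ 0 ≤ r + b ^ 2 ∧ (r + b ^ 2) * b = ‖(p : ℍ[ℝ])‖ := by
    set P := ‖(p : ℍ[ℝ])‖ with hP
    have hP0 : 0 ≤ P := norm_nonneg _
    set m := √(max (-r) 0) with hm
    have hm0 : 0 ≤ m := Real.sqrt_nonneg _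
    have hm2 : m ^ 2 = max (-r) 0 := Real.sq_sqrt (le_max_right _ _)
    have hcont : ContinuousOn (fun b : ℝ => (r + b ^ 2) * b) (Set.Icc m (m + |r| + P + 1)) := by
      fun_prop
    have hle : m ≤ m + |r| + P + 1 := by linarith [abs_nonneg r]
    have hlow : (r + m ^ 2) * m ≤ P := by
      rcases le_total (-r) 0 with h | h
      · rw [max_eq_right h] at hm2
        have : m = 0 := by simpa using hm2
        rw [this]; simpa using hP0
      · rw [max_eq_left h] at hm2
        rw [hm2]; simpa using hP0
    have hhigh : P ≤ (r + (m + |r| + P + 1) ^ 2) * (m + |r| + P + 1) := by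
      have h1 : -|r| ≤ r := neg_abs_le r
      have h2 : 0 ≤ |r| := abs_nonneg r
      have h3 : 1 ≤ r + (m + |r| + P + 1) ^ 2 := by nlinarith [mul_nonneg hm0 h2, mul_nonneg hm0 hP0, mul_nonneg h2 hP0]
      nlinarith
    obtain ⟨b, hb, hbP⟩ := intermediate_value_Icc hle hcont ⟨hlow, hhigh⟩
    refine ⟨b, hm0.trans hb.1, ?_, hbP⟩
    have : m ^ 2 ≤ b ^ 2 := pow_le_pow_left₀ hm0 hb.1 2
    have := le_max_left (-r) 0
    linarith
  by_cases ha : r + b ^ 2 = 0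
  · have hp : p = 0 := Subtype.ext (norm_eq_zero.1 (by rw [← hb, ha, zero_mul]))
    refine ⟨(0, ⟨quat 0 b 0 0, rfl⟩), ?_⟩
    have hn : ‖quat 0 b 0 0‖ ^ 2 = b ^ 2 := by rw [norm_sq_eq]; simp
    simp only [quot43, Prod.mk.injEq, hn]
    constructor
    · simp; linarith
    · rw [hp]; apply Subtype.ext; simp [coe_twist]
  · set a := √(r + b ^ 2) with hadef
    have ha2 : a ^ 2 = r + b ^ 2 := Real.sq_sqrt hbr
    have ha0 : a ≠ 0 := by intro h; rw [h] at ha2; apply ha; linarith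
    refine ⟨((a : ℍ[ℝ]), ((a ^ 2)⁻¹ : ℝ) • p), ?_⟩
    simp only [quot43, Prod.mk.injEq]
    constructor
    · rw [Submodule.coe_smul, norm_smul, ← hb, Quaternion.norm_coe, Real.norm_eq_abs, Real.norm_eq_abs,
        sq_abs, abs_of_nonneg (by positivity), ha2, inv_mul_cancel_left₀ ha]
      ring
    · apply Subtype.ext
      rw [coe_twist, Submodule.coe_smul, Quaternion.star_coe, Quaternion.coe_mul_eq_smul,
        Quaternion.mul_coe_eq_smul, smul_smul, smul_smul]
      rw [show a * a * (a ^ 2)⁻¹ = 1 by field_simp, one_smul]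

end Quotient43

/-! ### The quotient map of 3 × 3 matrices: fibres and surjectivity. -/

section Quotient333

open Matrix

/-- Linear maps with the same pointwise norms differ by a linear isometry. -/
theorem exists_linearIsometry_comp_eq {E F : Type*} [AddCommGroup E] [Module ℝ E]
    [NormedAddCommGroup F] [InnerProductSpace ℝ F] [FiniteDimensional ℝ F] (f g : E →ₗ[ℝ] F)
    (h : ∀ x, ‖f x‖ = ‖g x‖) : ∃ L : F →ₗᵢ[ℝ] F, ∀ x, L (f x) = g x := by
  -- For a linear section s of f, the map g ∘ s is isometric on the range of f; it then extends to
  -- the whole space.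
  obtain ⟨s, hs⟩ := f.rangeRestrict.exists_rightInverse_of_surjective f.range_rangeRestrict
  have hs' : ∀ y : LinearMap.range f, f (s y) = y := fun y =>
    congrArg Subtype.val (LinearMap.congr_fun hs y)
  let L₀ : LinearMap.range f →ₗᵢ[ℝ] F :=
    { toLinearMap := g ∘ₗ s
      norm_map' := fun y => by
        change ‖g (s y)‖ = ‖(y : F)‖
        rw [← h, hs'] }
  refine ⟨L₀.extend, fun x => ?_⟩
  have h1 := LinearIsometry.extend_apply L₀ (f.rangeRestrict x)
  change L₀.extend (f x) = _ at h1
  rw [h1]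
  change g (s (f.rangeRestrict x)) = g x
  rw [← sub_eq_zero, ← map_sub, ← norm_eq_zero, ← h, map_sub, hs', LinearMap.codRestrict_apply,
    sub_self, norm_zero]

/-- Square matrices with the same Gram matrix of rows differ by an orthogonal matrix. -/
theorem exists_eq_mul_of_mul_transpose_eq {n : ℕ} {A B : Matrix (Fin n) (Fin n) ℝ}
    (h : A * Aᵀ = B * Bᵀ) : ∃ O : Matrix (Fin n) (Fin n) ℝ, Oᵀ * O = 1 ∧ A * Oᵀ = B := by
  obtain ⟨L, hL⟩ := exists_linearIsometry_comp_eq (toEuclideanLin Aᵀ) (toEuclideanLin Bᵀ) (by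
    intro x
    rw [← sq_eq_sq₀ (norm_nonneg _) (norm_nonneg _), EuclideanSpace.real_norm_sq_eq,
      EuclideanSpace.real_norm_sq_eq]
    have key : ∀ M : Matrix (Fin n) (Fin n) ℝ,
        ∑ i, (toEuclideanLin Mᵀ x) i ^ 2 = x.ofLp ⬝ᵥ ((M * Mᵀ) *ᵥ x.ofLp) := by
      intro M
      rw [← mulVec_mulVec, dotProduct_mulVec, ← mulVec_transpose]
      simp [dotProduct, sq]
    rw [key, key, h])
  set O := toEuclideanLin.symm L.toLinearMap with hO
  have hOL : ∀ x, toEuclideanLin O x = L x := fun x => by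
    rw [hO, LinearEquiv.apply_symm_apply]; rfl
  refine ⟨O, ?_, ?_⟩
  · ext i j
    have h1 := L.inner_map_map (EuclideanSpace.single i 1) (EuclideanSpace.single j 1)
    rw [← hOL, ← hOL] at h1
    simp [PiLp.inner_apply, toLpLin_apply] at h1
    rw [mul_apply, one_apply]
    simp only [transpose_apply]
    convert h1 using 1
    exact Finset.sum_congr rfl fun _ _ => mul_comm _ _
  · have h2 : O * Aᵀ = Bᵀ := by
      apply toEuclideanLin.injective
      ext x : 1
      rw [← hL, ← hOL]
      simp [toLpLin_apply]
    have h3 := congrArg transpose h2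
    simpa using h3

/-- The transformations by orthogonal matrices of determinant one suffice as soon as the
determinants agree. -/
theorem exists_eq_mul_of_mul_transpose_eq_of_det_eq {A B : Matrix (Fin 3) (Fin 3) ℝ}
    (h : A * Aᵀ = B * Bᵀ) (hdet : A.det = B.det) :
    ∃ O : Matrix (Fin 3) (Fin 3) ℝ, Oᵀ * O = 1 ∧ O.det = 1 ∧ A * Oᵀ = B := by
  obtain ⟨O, hO, hAO⟩ := exists_eq_mul_of_mul_transpose_eq h
  have hO2 : O.det * O.det = 1 := by
    have := congrArg det hO
    simpa using this
  rcases mul_self_eq_one_iff.1 hO2 with h1 | h1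
  · exact ⟨O, hO, h1, hAO⟩
  have hA0 : A.det = 0 := by
    have := congrArg det hAO
    rw [det_mul, det_transpose, h1, ← hdet] at this
    linarith
  -- The determinant of O can be -1 only if A is singular; the reflection R in a kernel vector n
  -- then satisfies AR = A and corrects the sign.
  obtain ⟨n, hn0, hn⟩ := exists_mulVec_eq_zero_iff.2 hA0
  have hnn : n ⬝ᵥ n ≠ 0 := fun h => hn0 (dotProduct_self_eq_zero.1 h)
  set R : Matrix (Fin 3) (Fin 3) ℝ := 1 - (2 / (n ⬝ᵥ n)) • vecMulVec n n with hR
  have hRt : Rᵀ = R := by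
    rw [hR]; simp [transpose_vecMulVec]
  have hRR : R * R = 1 := by
    rw [hR]
    simp only [sub_mul, mul_sub, one_mul, mul_one, smul_mul_smul_comm, vecMulVec_mul_vecMulVec, vecMulVec_smul]
    rw [smul_smul]
    have : 2 / (n ⬝ᵥ n) * (2 / (n ⬝ᵥ n)) * (n ⬝ᵥ n) = 2 * (2 / (n ⬝ᵥ n)) := by field_simp
    rw [this, mul_smul, two_smul]
    abel
  have hRdet : R.det = -1 := by
    have hk : 2 / (n ⬝ᵥ n) * (n ⬝ᵥ n) = 2 := div_mul_cancel₀ _ hnn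
    rw [hR, det_fin_three]
    generalize 2 / (n ⬝ᵥ n) = k at hk
    simp only [dotProduct, Fin.sum_univ_three] at hk
    simp [vecMulVec_apply]
    linear_combination -hk
  have hAR : A * R = A := by
    rw [hR, mul_sub, mul_one, mul_smul_comm, mul_vecMulVec, hn]
    simp
  refine ⟨O * R, ?_, ?_, ?_⟩
  · rw [transpose_mul, hRt, mul_assoc, ← mul_assoc Oᵀ, hO, one_mul, hRR]
  · rw [det_mul, h1, hRdet]; norm_num
  · rw [transpose_mul, hRt, ← mul_assoc, hAR, hAO]

theorem coe_inv_specialOrthogonal (C : specialOrthogonalGroup (Fin 3) ℝ) :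
    (C : Matrix (Fin 3) (Fin 3) ℝ)⁻¹ = (C : Matrix (Fin 3) (Fin 3) ℝ)ᵀ := by
  apply inv_eq_left_inv
  exact (mem_orthogonalGroup_iff' _ _).1 (mem_specialOrthogonalGroup_iff.1 C.2).1

/-- For G = AAᵀ, det(G + c) - det G is c³ plus lower terms whose coefficients are the trace and the
sum of the principal 2 × 2 minors, all nonnegative. So it vanishes for c ≥ 0 only at c = 0. -/
theorem eq_zero_of_det_mul_transpose_add {A B : Matrix (Fin 3) (Fin 3) ℝ} {c : ℝ}
    (h : A * Aᵀ + c • 1 = B * Bᵀ) (hdet : A.det = B.det) (hc : 0 ≤ c) : c = 0 := by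
  have h1 : (A * Aᵀ + c • 1).det = (A * Aᵀ).det := by
    rw [h, det_mul, det_mul, det_transpose, det_transpose, hdet]
  have hdiag : ∀ i j, (A * Aᵀ) i j = A i 0 * A j 0 + A i 1 * A j 1 + A i 2 * A j 2 := by
    intro i j
    simp [mul_apply, Fin.sum_univ_three]
  have cs : ∀ i j, 0 ≤ (A * Aᵀ) i i * (A * Aᵀ) j j - (A * Aᵀ) i j * (A * Aᵀ) j i := by
    intro i j
    simp only [hdiag]
    have : 0 ≤ (A i 0 * A j 1 - A i 1 * A j 0) ^ 2 + (A i 0 * A j 2 - A i 2 * A j 0) ^ 2 +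
      (A i 1 * A j 2 - A i 2 * A j 1) ^ 2 := by positivity
    nlinarith
  have dg : ∀ i, 0 ≤ (A * Aᵀ) i i := by
    intro i
    rw [hdiag]
    nlinarith [mul_self_nonneg (A i 0), mul_self_nonneg (A i 1), mul_self_nonneg (A i 2)]
  have c01 := cs 0 1
  have c02 := cs 0 2
  have c12 := cs 1 2
  have d0 := dg 0
  have d1 := dg 1
  have d2 := dg 2
  generalize A * Aᵀ = G at *
  rw [det_fin_three, det_fin_three] at h1
  simp at h1
  have h2 : c * (G 0 0 * G 1 1 - G 0 1 * G 1 0 + (G 0 0 * G 2 2 - G 0 2 * G 2 0) +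
      (G 1 1 * G 2 2 - G 1 2 * G 2 1)) + c ^ 2 * (G 0 0 + G 1 1 + G 2 2) + c ^ 3 = 0 := by
    linear_combination h1
  have h3 : c ^ 3 ≤ 0 := by
    have e1 := mul_nonneg hc (add_nonneg (add_nonneg c01 c02) c12)
    have e2 := mul_nonneg (sq_nonneg c) (add_nonneg (add_nonneg d0 d1) d2)
    linarith
  by_contra hne
  have : 0 < c ^ 3 := pow_pos (lt_of_le_of_ne hc (Ne.symm hne)) 3
  linarith

theorem mkQ_scalarLine_eq_iff (S T : symMat) :
    scalarLine.mkQ S = scalarLine.mkQ T ↔ ∃ c : ℝ, (S : Matrix (Fin 3) (Fin 3) ℝ) + c • 1 = T := by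
  rw [eq_comm, Submodule.mkQ_apply, Submodule.mkQ_apply, Submodule.Quotient.eq, scalarLine,
    Submodule.mem_span_singleton]
  refine exists_congr fun c => ?_
  rw [← Subtype.coe_inj, Submodule.coe_smul, Submodule.coe_sub, eq_sub_iff_add_eq, add_comm]

/-- The determinant fixes the scalar lost in passing to the quotient by scalar matrices. Then the
Gram matrices agree, and the matrices differ by a rotation. -/
theorem quot333_eq_iff (A B : Matrix (Fin 3) (Fin 3) ℝ) :
    quot333 A = quot333 B ↔ ∃ C, act333 C A = B := by
  rw [quot333, quot333, Prod.mk.injEq, mkQ_scalarLine_eq_iff]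
  constructor
  · rintro ⟨⟨c, hc⟩, hdet⟩
    have hc' : A * Aᵀ + c • 1 = B * Bᵀ := hc
    have c0 : c = 0 := by
      -- For negative c, exchange A and B.
      rcases le_total 0 c with h | h
      · exact eq_zero_of_det_mul_transpose_add hc' hdet h
      · have := eq_zero_of_det_mul_transpose_add (c := -c) (A := B) (B := A)
          (by rw [← hc', neg_smul]; abel) hdet.symm (by linarith)
        linarith
    rw [c0, zero_smul, add_zero] at hc'
    obtain ⟨O, hO, hO1, hAO⟩ := exists_eq_mul_of_mul_transpose_eq_of_det_eq hc' hdet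
    refine ⟨⟨O, mem_specialOrthogonalGroup_iff.2 ⟨(mem_orthogonalGroup_iff' _ _).2 hO, hO1⟩⟩, ?_⟩
    rw [act333, coe_inv_specialOrthogonal, hAO]
  · rintro ⟨C, rfl⟩
    have h1 : (C : Matrix (Fin 3) (Fin 3) ℝ)ᵀ * C = 1 :=
      (mem_orthogonalGroup_iff' _ _).1 (mem_specialOrthogonalGroup_iff.1 C.2).1
    refine ⟨⟨0, ?_⟩, ?_⟩
    · simp only [act333, coe_inv_specialOrthogonal, transpose_mul, transpose_transpose]
      rw [mul_assoc, ← mul_assoc _ (C : Matrix (Fin 3) (Fin 3) ℝ), h1, zero_smul, add_zero, one_mul]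
    · rw [act333, coe_inv_specialOrthogonal, det_mul, det_transpose,
        (mem_specialOrthogonalGroup_iff.1 C.2).2, mul_one]

theorem quot333_surjective : Function.Surjective quot333 := by
  rintro ⟨p, δ⟩
  obtain ⟨⟨S, hS⟩, rfl⟩ := scalarLine.mkQ_surjective p
  have hH : S.IsHermitian := by
    rw [Matrix.IsHermitian, conjTranspose_eq_transpose_of_trivial]; exact hS
  set U : Matrix (Fin 3) (Fin 3) ℝ := hH.eigenvectorUnitary.1 with hU
  have hUU : U * Uᵀ = 1 := by
    have := Unitary.mul_star_self_of_mem hH.eigenvectorUnitary.2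
    rwa [star_eq_conjTranspose, conjTranspose_eq_transpose_of_trivial] at this
  have hdU : U.det ^ 2 = 1 := by
    have := congrArg det hUU
    simpa [sq] using this
  set l := hH.eigenvalues with hl
  have hSU : S = U * diagonal l * Uᵀ := by
    have := hH.spectral_theorem
    rw [Unitary.conjStarAlgAut_apply] at this
    rw [star_eq_conjTranspose, conjTranspose_eq_transpose_of_trivial] at this
    exact this
  -- Shift the symmetric matrix until it is positive semidefinite with determinant δ². The product
  -- of the shifted eigenvalues is 0 at minus the least eigenvalue, and at least (1 + δ²)³ after a
  -- further shift by 1 + δ².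
  obtain ⟨c, hc, hcd⟩ : ∃ c : ℝ, (∀ i, 0 ≤ l i + c) ∧ ∏ i, (l i + c) = δ ^ 2 := by
    obtain ⟨i0, hi0⟩ := Finite.exists_min l
    have hcont : ContinuousOn (fun c : ℝ => ∏ i, (l i + c)) (Set.Icc (-l i0) (-l i0 + (1 + δ ^ 2))) := by
      fun_prop
    have h0 : ∏ i, (l i + -l i0) = 0 := Finset.prod_eq_zero (Finset.mem_univ i0) (by ring)
    have h1 : δ ^ 2 ≤ ∏ i, (l i + (-l i0 + (1 + δ ^ 2))) := by
      have h2 : ∀ i ∈ (Finset.univ : Finset (Fin 3)), 1 + δ ^ 2 ≤ l i + (-l i0 + (1 + δ ^ 2)) := by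
        intro i _; linarith [hi0 i]
      have h3 := Finset.prod_le_prod (fun i _ => by positivity) h2
      rw [Finset.prod_const] at h3
      refine le_trans ?_ h3
      simp
      nlinarith [sq_nonneg δ, sq_nonneg (δ ^ 2), pow_nonneg (sq_nonneg δ) 3]
    obtain ⟨c, hc, hcd⟩ := intermediate_value_Icc (by nlinarith [sq_nonneg δ]) hcont
      (show δ ^ 2 ∈ Set.Icc _ _ from ⟨by rw [h0]; positivity, h1⟩)
    exact ⟨c, fun i => by linarith [hi0 i, hc.1], hcd⟩
  set A := U * diagonal fun i => √(l i + c) with hA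
  have hAA : A * Aᵀ = S + c • 1 := by
    rw [hA, transpose_mul, diagonal_transpose, mul_assoc, ← mul_assoc (diagonal _),
      diagonal_mul_diagonal, ← mul_assoc]
    have : (fun i => √(l i + c) * √(l i + c)) = fun i => l i + c := by
      funext i; exact Real.mul_self_sqrt (hc i)
    rw [this, ← diagonal_add, mul_add, add_mul, ← hSU]
    congr 1
    rw [← smul_one_eq_diagonal, mul_smul_comm, mul_one, smul_mul_assoc, hUU]
  have hdet : A.det ^ 2 = δ ^ 2 := by
    rw [hA, det_mul, mul_pow, hdU, one_mul, det_diagonal, ← Finset.prod_pow, ← hcd]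
    exact Finset.prod_congr rfl fun i _ => Real.sq_sqrt (hc i)
  have fin : ∀ M : Matrix (Fin 3) (Fin 3) ℝ, M * Mᵀ = S + c • 1 → M.det = δ →
      ∃ a, quot333 a = (scalarLine.mkQ ⟨S, hS⟩, δ) := by
    intro M hM hMd
    refine ⟨M, ?_⟩
    rw [quot333, hMd, Prod.mk.injEq, eq_comm, mkQ_scalarLine_eq_iff]
    exact ⟨⟨c, hM.symm⟩, rfl⟩
  -- In odd dimension, passing from A to -A changes the sign of det A and keeps AAᵀ.
  rcases sq_eq_sq_iff_eq_or_eq_neg.1 hdet with h | h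
  · exact fin A hAA h
  · refine fin (-A) (by simpa using hAA) ?_
    rw [det_neg, h, Fintype.card_fin]; ring

end Quotient333

/-! ### Closedness from homogeneity. -/

section Proper

/-- A continuous map with homogeneous components of positive degrees and without nontrivial common
zero is closed. -/
theorem isClosedMap_of_homogeneous {V E : Type*} [NormedAddCommGroup V] [NormedSpace ℝ V]
    [FiniteDimensional ℝ V] [NormedAddCommGroup E] [NormedSpace ℝ E] [FiniteDimensional ℝ E]
    {f : V → E} (hf : Continuous f) {κ : Type*} [Fintype κ] {E' : κ → Type*}
    [∀ i, NormedAddCommGroup (E' i)] [∀ i, NormedSpace ℝ (E' i)]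
    (p : ∀ i, E →L[ℝ] E' i) (n : κ → ℕ) (hn : ∀ i, n i ≠ 0)
    (hom : ∀ i (t : ℝ) v, p i (f (t • v)) = t ^ n i • p i (f v))
    (hzero : ∀ v, (∀ i, p i (f v) = 0) → v = 0) : IsClosedMap f := by
  have hP : 0 < ∏ i, n i := Finset.prod_pos fun i _ => Nat.pos_of_ne_zero (hn i)
  set D := ∏ i, n i with hD
  have hdiv : ∀ i, n i * (D / n i) = D := fun i =>
    Nat.mul_div_cancel' (Finset.dvd_prod_of_mem n (Finset.mem_univ i))
  have hdiv0 : ∀ i, D / n i ≠ 0 := fun i h => by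
    have := hdiv i; rw [h, mul_zero] at this; omega
  -- The exponents give every component the common degree D, so g ∘ f is at least its minimum on the
  -- unit sphere times ‖v‖ ^ D. That minimum is positive, so preimages of bounded sets are bounded
  -- and f is proper.
  let g : E → ℝ := fun y => ∑ i, ‖p i y‖ ^ (D / n i)
  have hg : Continuous g := by fun_prop
  have hgn : ∀ y, 0 ≤ g y := fun y => Finset.sum_nonneg fun i _ => by positivity
  have hgh : ∀ (t : ℝ) v, g (f (t • v)) = |t| ^ D * g (f v) := by
    intro t v
    simp only [g, Finset.mul_sum, hom, norm_smul, norm_pow, Real.norm_eq_abs, mul_pow, ← pow_mul, hdiv]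
  obtain ⟨c, hc, hcv⟩ : ∃ c > 0, ∀ v, c * ‖v‖ ^ D ≤ g (f v) := by
    by_cases hne : (Metric.sphere (0 : V) 1).Nonempty
    · obtain ⟨w, hw, hmin⟩ := (isCompact_sphere (0 : V) 1).exists_isMinOn hne
        (hg.comp hf).continuousOn
      have hw1 : ‖w‖ = 1 := by simpa using hw
      refine ⟨g (f w), lt_of_le_of_ne (hgn _) fun h => ?_, fun v => ?_⟩
      · have h0 : w = 0 := hzero w fun i => by
          have := (Finset.sum_eq_zero_iff_of_nonneg (fun i _ => by positivity)).1 h.symm i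
            (Finset.mem_univ i)
          exact norm_eq_zero.1 (pow_eq_zero_iff (hdiv0 i) |>.1 this)
        rw [h0, norm_zero] at hw1
        exact zero_ne_one hw1
      · by_cases hv : v = 0
        · rw [hv, norm_zero, zero_pow hP.ne', mul_zero]; exact hgn _
        · have hv' : ‖v‖ ≠ 0 := norm_ne_zero_iff.2 hv
          have h1 : g (f w) ≤ g (f (‖v‖⁻¹ • v)) := hmin (by
            rw [mem_sphere_zero_iff_norm, norm_smul, norm_inv, norm_norm, inv_mul_cancel₀ hv'])
          rw [hgh, abs_inv, abs_norm, inv_pow] at h1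
          rwa [← le_div_iff₀ (by positivity), div_eq_inv_mul]
    -- The unit sphere is empty only when V = 0.
    · refine ⟨1, one_pos, fun v => ?_⟩
      by_cases hv : v = 0
      · rw [hv, norm_zero, zero_pow hP.ne', mul_zero]; exact hgn _
      · exact absurd ⟨‖v‖⁻¹ • v, by
          rw [mem_sphere_zero_iff_norm, norm_smul, norm_inv, norm_norm,
            inv_mul_cancel₀ (norm_ne_zero_iff.2 hv)]⟩ hne
  have _ : ProperSpace V := FiniteDimensional.proper ℝ V
  have _ : ProperSpace E := FiniteDimensional.proper ℝ E
  refine (isProperMap_iff_isCompact_preimage.2 ⟨hf, fun K hK => ?_⟩).isClosedMap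
  refine Metric.isCompact_of_isClosed_isBounded (hK.isClosed.preimage hf) ?_
  obtain ⟨b, hb⟩ := hK.bddAbove_image hg.continuousOn
  refine (Metric.isBounded_closedBall (x := (0 : V)) (r := b / c + 1)).subset fun v hv => ?_
  rw [mem_closedBall_zero_iff]
  have h1 : c * ‖v‖ ^ D ≤ b := (hcv v).trans (hb ⟨f v, hv, rfl⟩)
  have h2 : ‖v‖ ^ D ≤ b / c := by rwa [le_div_iff₀ hc, mul_comm]
  by_contra! h3
  have hbc : 0 ≤ b / c := le_trans (by positivity) h2
  have h4 : ‖v‖ ≤ ‖v‖ ^ D := le_self_pow₀ (by linarith) hP.ne'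
  linarith

end Proper

/-! ### From an explicit orbit map to the quotient and its representation. -/

section Assembly

variable {G : Type*} [TopologicalSpace G] [Group G] [IsTopologicalGroup G]
  {V : Type*} [NormedAddCommGroup V] [NormedSpace ℝ V] [FiniteDimensional ℝ V]

/-- An orbit map with linear equivariance under the whole group gives the quotient. -/
theorem exists_homeomorph_of_model {ρ : G →* (V →L[ℝ] V)} {S M N₁ N₂ : Type*} [AddCommGroup M]
    [Module ℝ M] [AddCommGroup N₁] [Module ℝ N₁] [AddCommGroup N₂] [Module ℝ N₂]
    [FiniteDimensional ℝ N₁] [FiniteDimensional ℝ N₂] {act : S → M → M} {q : M → N₁ × N₂}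
    (e : V ≃ₗ[ℝ] fixedSubspace ρ × M) (he : ∀ v : fixedSubspace ρ, e v = (v, 0))
    (hact : ∀ g ∈ idComponent G, ∃ s : S, ∀ v, e (ρ g v) = ((e v).1, act s (e v).2))
    (hreal : ∀ s : S, ∃ g ∈ idComponent G, ∀ v, e (ρ g v) = ((e v).1, act s (e v).2))
    (hq : ∀ x y, q x = q y ↔ ∃ s, act s x = y) (hsurj : Function.Surjective q)
    {a b : ℕ} (ha : a ≠ 0) (hb : b ≠ 0)
    (hom : ∀ (t : ℝ) x, q (t • x) = (t ^ a • (q x).1, t ^ b • (q x).2))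
    (hsmooth : ∀ (j : V →ₗ[ℝ] M) (l : N₁ × N₂ →ₗ[ℝ] ℝ), ContDiff ℝ ∞ fun v => l (q (j v)))
    (hlin : ∀ g : G, ∃ (T : fixedSubspace ρ →ₗ[ℝ] fixedSubspace ρ) (τ : N₁ × N₂ →ₗ[ℝ] N₁ × N₂),
      ∀ v, (e (ρ g v)).1 = T (e v).1 ∧ q (e (ρ g v)).2 = τ (q (e v).2)) :
    ∃ (m : ℕ) (φ : OrbitSpace ρ ≃ₜ EuclideanSpace ℝ (Fin m))
      (σ : Representation ℝ (G ⧸ idComponent G) (EuclideanSpace ℝ (Fin m))),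
      ContDiff ℝ ∞ (fun v : V => φ (toOrbit ρ v)) ∧
      (∀ (g : G) (v : V), φ (toOrbit ρ (ρ g v)) =
        σ (g : G ⧸ idComponent G) (φ (toOrbit ρ v))) ∧
      HasExplicitQuotientMap ρ φ act q := by
  let m := Module.finrank ℝ (fixedSubspace ρ × (N₁ × N₂))
  let ι : EuclideanSpace ℝ (Fin m) ≃ₗ[ℝ] fixedSubspace ρ × (N₁ × N₂) :=
    LinearEquiv.ofFinrankEq _ _ (by rw [finrank_euclideanSpace_fin])
  let F : V → fixedSubspace ρ × (N₁ × N₂) := fun v => ((e v).1, q (e v).2)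
  let π : V → EuclideanSpace ℝ (Fin m) := fun v => ι.symm (F v)
  have hιπ : ∀ v, ι (π v) = F v := fun v => ι.apply_symm_apply _
  have hFsurj : Function.Surjective F := by
    rintro ⟨v, y⟩
    obtain ⟨x, rfl⟩ := hsurj y
    exact ⟨e.symm (v, x), by simp [F]⟩
  have hπsurj : Function.Surjective π := ι.symm.surjective.comp hFsurj
  have hFeq : ∀ v w, F v = F w ↔ ∃ g ∈ idComponent G, ρ g v = w := by
    intro v w
    constructor
    · intro h
      simp only [F, Prod.mk.injEq] at h
      obtain ⟨s, hs⟩ := (hq _ _).1 h.2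
      obtain ⟨g, hg, hgs⟩ := hreal s
      refine ⟨g, hg, e.injective ?_⟩
      rw [hgs, h.1, hs]
    · rintro ⟨g, hg, rfl⟩
      obtain ⟨s, hs⟩ := hact g hg
      simp only [F, hs]
      rw [(hq _ _).2 ⟨s, rfl⟩]
  have hπeq : ∀ v w, π v = π w ↔ ∃ g ∈ idComponent G, ρ g v = w := fun v w => by
    rw [← hFeq]; exact ι.symm.injective.eq_iff
  have hπsmooth : ContDiff ℝ ∞ π := by
    have h2 : ∀ (l : fixedSubspace ρ × (N₁ × N₂) →ₗ[ℝ] ℝ), ContDiff ℝ ∞ fun v => l (F v) := by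
      intro l
      have : (fun v => l (F v)) = fun v =>
          (l ∘ₗ LinearMap.inl ℝ _ _ ∘ₗ LinearMap.fst ℝ _ _ ∘ₗ e.toLinearMap) v +
          (l ∘ₗ LinearMap.inr ℝ _ _) (q ((LinearMap.snd ℝ _ _ ∘ₗ e.toLinearMap) v)) := by
        funext v
        simp only [F, LinearMap.comp_apply, ← map_add]
        simp
      rw [this]
      exact (LinearMap.toContinuousLinearMap _).contDiff.add (hsmooth _ _)
    rw [contDiff_piLp]
    intro i
    exact h2 ((EuclideanSpace.proj i).toLinearMap ∘ₗ ι.symm.toLinearMap)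
  have act0 : ∀ s, act s 0 = 0 := fun s => by
    obtain ⟨g, -, hgs⟩ := hreal s
    have := hgs 0
    simp only [map_zero, Prod.snd_zero] at this
    exact (congrArg Prod.snd this).symm
  have hq0 : q 0 = 0 := by
    have := hom 0 0
    rwa [smul_zero, zero_pow ha, zero_pow hb, zero_smul, zero_smul] at this
  have hclosed : IsClosedMap π := by
    -- The target splits into pieces of degrees 1, a, b. A common zero lies over q = 0, and that
    -- fibre is the orbit of 0, which is a single point.
    let P : Fin 3 → (fixedSubspace ρ × (N₁ × N₂) →ₗ[ℝ] fixedSubspace ρ × (N₁ × N₂)) :=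
      ![LinearMap.inl ℝ _ _ ∘ₗ LinearMap.fst ℝ _ _,
        LinearMap.inr ℝ _ _ ∘ₗ LinearMap.inl ℝ _ _ ∘ₗ LinearMap.fst ℝ _ _ ∘ₗ LinearMap.snd ℝ _ _,
        LinearMap.inr ℝ _ _ ∘ₗ LinearMap.inr ℝ _ _ ∘ₗ LinearMap.snd ℝ _ _ ∘ₗ LinearMap.snd ℝ _ _]
    have key : ∀ i w, (ι.symm.toLinearMap ∘ₗ P i ∘ₗ ι.toLinearMap).toContinuousLinearMap (π w) =
        ι.symm (P i (F w)) := by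
      intro i w
      simp [π]
    refine isClosedMap_of_homogeneous hπsmooth.continuous
      (fun i => LinearMap.toContinuousLinearMap
        (ι.symm.toLinearMap ∘ₗ P i ∘ₗ ι.toLinearMap)) ![1, a, b] ?_ ?_ ?_
    · intro i; fin_cases i <;> simp [ha, hb]
    · intro i t v
      rw [key, key, ← map_smul]
      congr 1
      fin_cases i <;> simp [P, F, hom]
    · intro v hv
      simp only [key, map_eq_zero_iff ι.symm ι.symm.injective] at hv
      have h0 := hv 0
      have h1 := hv 1
      have h2 := hv 2
      simp [P, F] at h0 h1 h2
      have hqv : q (e v).2 = q 0 := by rw [hq0]; exact Prod.ext h1 h2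
      obtain ⟨s, hs⟩ := (hq _ _).1 hqv.symm
      rw [act0] at hs
      have : e v = 0 := Prod.ext h0 hs.symm
      exact (map_eq_zero_iff e e.injective).1 this
  let Φ : OrbitSpace ρ → EuclideanSpace ℝ (Fin m) := Quotient.lift π fun v w h => (hπeq v w).2 h
  have hΦ : ∀ v, Φ (toOrbit ρ v) = π v := fun v => rfl
  have hΦbij : Function.Bijective Φ := by
    constructor
    · intro x y
      induction x using Quotient.inductionOn with | h v => ?_
      induction y using Quotient.inductionOn with | h w => ?_
      exact fun h => Quotient.sound ((hπeq v w).1 h)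
    · intro y
      obtain ⟨v, rfl⟩ := hπsurj y
      exact ⟨toOrbit ρ v, rfl⟩
  have hΦcont : Continuous Φ := hπsmooth.continuous.quotient_lift _
  have hΦclosed : IsClosedMap Φ := by
    intro C hC
    have h1 : IsClosed (toOrbit ρ ⁻¹' C) := hC.preimage continuous_quotient_mk'
    have h2 : Φ '' C = π '' (toOrbit ρ ⁻¹' C) := by
      ext y
      constructor
      · rintro ⟨x, hx, rfl⟩
        induction x using Quotient.inductionOn with | h v => ?_
        exact ⟨v, hx, rfl⟩
      · rintro ⟨v, hv, rfl⟩
        exact ⟨toOrbit ρ v, hv, rfl⟩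
    rw [h2]
    exact hclosed _ h1
  let φ : OrbitSpace ρ ≃ₜ EuclideanSpace ℝ (Fin m) :=
    (Equiv.ofBijective Φ hΦbij).toHomeomorphOfContinuousClosed hΦcont hΦclosed
  have hφ : ∀ v, φ (toOrbit ρ v) = π v := fun v => rfl
  choose T τ hTτ using hlin
  let A : G → (EuclideanSpace ℝ (Fin m) →ₗ[ℝ] EuclideanSpace ℝ (Fin m)) := fun g =>
    ι.symm.toLinearMap ∘ₗ ((T g).prodMap (τ g)) ∘ₗ ι.toLinearMap
  have hA : ∀ g v, π (ρ g v) = A g (π v) := by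
    intro g v
    simp only [A, LinearMap.comp_apply, LinearEquiv.coe_coe, hιπ]
    simp only [π, F, LinearMap.prodMap_apply, (hTτ g v).1, (hTτ g v).2]
  -- The linear maps were chosen separately for each g; surjectivity of π makes them unique, and
  -- multiplicativity and triviality on G⁰ follow.
  have hAext : ∀ L L' : EuclideanSpace ℝ (Fin m) →ₗ[ℝ] EuclideanSpace ℝ (Fin m),
      (∀ v, L (π v) = L' (π v)) → L = L' := by
    intro L L' h
    ext1 y
    obtain ⟨v, rfl⟩ := hπsurj y
    exact h v
  let σ₀ : G →* Module.End ℝ (EuclideanSpace ℝ (Fin m)) :=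
    { toFun := A
      map_one' := hAext _ _ fun v => by rw [← hA, map_one]; rfl
      map_mul' := fun g h => hAext _ _ fun v => by
        rw [← hA, map_mul]
        change π (ρ g (ρ h v)) = A g (A h (π v))
        rw [hA, hA] }
  have hker : idComponent G ≤ σ₀.ker := by
    intro g hg
    refine hAext _ _ fun v => ?_
    change A g (π v) = π v
    rw [← hA]
    exact ((hπeq _ _).2 ⟨g, hg, rfl⟩).symm
  refine ⟨m, φ, QuotientGroup.lift (idComponent G) σ₀ hker, hπsmooth, fun g v => ?_, e, ι, he,
    hact, hreal, fun v => ?_⟩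
  · rw [hφ, hφ]
    exact hA g v
  · rw [hφ, hιπ]

end Assembly

/-! ### Conjugation on the generators. -/

section Conjugation

open Matrix

/-- By the two commutation relations, exp(-sX)(cos s · P + sin s · Q) exp(sX) has zero derivative in
s; its value at 0 is P. -/
theorem exp_smul_mul_eq_of_commutator {A : Type*} [NormedRing A] [NormedAlgebra ℝ A]
    [CompleteSpace A] {X P Q : A} (hP : X * P - P * X = Q) (hQ : X * Q - Q * X = -P) (t : ℝ) :
    NormedSpace.exp (t • X) * P = (Real.cos t • P + Real.sin t • Q) * NormedSpace.exp (t • X) := by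
  have h1 : ∀ s : ℝ, HasDerivAt (fun s : ℝ => NormedSpace.exp (s • X))
      (X * NormedSpace.exp (s • X)) s := fun s => hasDerivAt_exp_smul_const' X s
  have h2 : ∀ s : ℝ, HasDerivAt (fun s : ℝ => NormedSpace.exp (s • -X))
      (NormedSpace.exp (s • -X) * -X) s := fun s => hasDerivAt_exp_smul_const (-X) s
  have h3 : ∀ s : ℝ, HasDerivAt (fun s : ℝ => Real.cos s • P + Real.sin s • Q)
      (-Real.sin s • P + Real.cos s • Q) s := fun s =>
    ((Real.hasDerivAt_cos s).smul_const P).add ((Real.hasDerivAt_sin s).smul_const Q)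
  have hD : ∀ s : ℝ, HasDerivAt (fun s : ℝ => NormedSpace.exp (s • -X) *
      (Real.cos s • P + Real.sin s • Q) * NormedSpace.exp (s • X)) 0 s := by
    intro s
    refine (((h2 s).mul (h3 s)).mul (h1 s)).congr_deriv ?_
    have hP' : P * X = X * P - Q := by rw [← hP]; abel
    have hQ' : Q * X = X * Q + P := by rw [← neg_neg P, ← hQ]; abel
    have : (-X) * (Real.cos s • P + Real.sin s • Q) + (-Real.sin s • P + Real.cos s • Q) +
        (Real.cos s • P + Real.sin s • Q) * X = 0 := by
      rw [add_mul, smul_mul_assoc, smul_mul_assoc, hP', hQ', mul_add, mul_smul_comm, mul_smul_comm,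
        neg_mul, neg_mul]
      module
    calc _ = NormedSpace.exp (s • -X) * ((-X) * (Real.cos s • P + Real.sin s • Q) +
          (-Real.sin s • P + Real.cos s • Q) + (Real.cos s • P + Real.sin s • Q) * X) *
          NormedSpace.exp (s • X) := by simp only [Pi.mul_apply]; noncomm_ring
      _ = 0 := by rw [this, mul_zero, zero_mul]
  have h4 := is_const_of_deriv_eq_zero (fun s => (hD s).differentiableAt) (fun s => (hD s).deriv) t 0
  have h5 := exp_smul_mul_exp_smul_neg X t
  simp only [zero_smul, NormedSpace.exp_zero, Real.cos_zero, Real.sin_zero, one_smul, add_zero,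
    one_mul, mul_one] at h4
  conv_lhs => rw [← h4]
  simp only [← mul_assoc, h5, one_mul]

section

variable {G : Type*} [Group G] {V : Type*} [NormedAddCommGroup V] [NormedSpace ℝ V]

theorem rep_mul_rep_inv (ρ : G →* (V →L[ℝ] V)) (g : G) : ρ g * ρ g⁻¹ = 1 := by
  rw [← map_mul, mul_inv_cancel, map_one]

theorem rep_inv_mul_rep (ρ : G →* (V →L[ℝ] V)) (g : G) : ρ g⁻¹ * ρ g = 1 := by
  rw [← map_mul, inv_mul_cancel, map_one]

end

variable {G : Type*} [TopologicalSpace G] [Group G] [IsTopologicalGroup G]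
  {V : Type*} [NormedAddCommGroup V] [NormedSpace ℝ V]
  {ρ : G →* (V →L[ℝ] V)} {X : Fin 3 → V →L[ℝ] V} {B : LinearMap.BilinForm ℝ V}

namespace IsInfinitesimalModel

theorem exists_rep_eq_exp [CompleteSpace V] (h : IsInfinitesimalModel ρ X B) (k : Fin 3) (t : ℝ) :
    ∃ g ∈ idComponent G, ρ g = NormedSpace.exp (t • X k) := by
  obtain ⟨g, hg, hgt⟩ := h.exp (Pi.single k 1) (fun t v => NormedSpace.exp (t • X k) v)
    (fun v => by simp) (fun v t => by
      refine ((hasDerivAt_exp_smul_const' (X k) t).clm_apply (hasDerivAt_const t v)).congr_deriv ?_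
      simp [Pi.single_apply]) t
  exact ⟨g, hg, by ext v; exact hgt v⟩

/-- The generators are linearly independent unless they all vanish. -/
theorem eq_zero_of_sum_smul_eq_zero (h : IsInfinitesimalModel ρ X B) (hX : X ≠ 0) {c : Fin 3 → ℝ}
    (hc : ∑ k, c k • X k = 0) : c = 0 := by
  -- Commuting the relation with P leaves yR - zQ = 0, and commuting this with Q leaves yP = 0. So P
  -- = 0, and the other two are brackets with P.
  have cycle : ∀ (P Q R : V →L[ℝ] V) (x y z : ℝ), P * Q - Q * P = R → Q * R - R * Q = P →
      R * P - P * R = Q → x • P + y • Q + z • R = 0 → y ≠ 0 → P = 0 ∧ Q = 0 ∧ R = 0 := by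
    intro P Q R x y z hPQ hQR hRP hs hy
    have h1 : y • (P * Q - Q * P) - z • (R * P - P * R) = 0 := by
      have : P * (x • P + y • Q + z • R) - (x • P + y • Q + z • R) * P = 0 := by
        rw [hs, mul_zero, zero_mul, sub_zero]
      rw [← this]
      simp only [mul_add, add_mul, mul_smul_comm, smul_mul_assoc, smul_sub]
      abel
    rw [hPQ, hRP] at h1
    have h2 : y • (Q * R - R * Q) = 0 := by
      have : Q * (y • R - z • Q) - (y • R - z • Q) * Q = 0 := by
        rw [h1, mul_zero, zero_mul, sub_zero]
      rw [← this]
      simp only [mul_sub, sub_mul, mul_smul_comm, smul_mul_assoc, smul_sub]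
      abel
    rw [hQR] at h2
    have hP : P = 0 := (smul_eq_zero.1 h2).resolve_left hy
    have hQ : Q = 0 := by rw [← hRP, hP, mul_zero, zero_mul, sub_zero]
    exact ⟨hP, hQ, by rw [← hPQ, hP, mul_zero, zero_mul, sub_zero]⟩
  rw [Fin.sum_univ_three] at hc
  funext k
  by_contra hk
  refine hX (funext fun i => ?_)
  fin_cases k
  · obtain ⟨a, b, e⟩ := cycle (X 2) (X 0) (X 1) (c 2) (c 0) (c 1) h.comm20 h.comm01 h.comm12
      (by rw [← hc]; abel) hk
    fin_cases i <;> assumption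
  · obtain ⟨a, b, e⟩ := cycle (X 0) (X 1) (X 2) (c 0) (c 1) (c 2) h.comm01 h.comm12 h.comm20 hc hk
    fin_cases i <;> assumption
  · obtain ⟨a, b, e⟩ := cycle (X 1) (X 2) (X 0) (c 1) (c 2) (c 0) h.comm12 h.comm20 h.comm01
      (by rw [← hc]; abel) hk
    fin_cases i <;> assumption

/-- Every rotation of the generators is a conjugation by an element of the identity component. -/
theorem exists_conj_eq_rotation [CompleteSpace V] (h : IsInfinitesimalModel ρ X B)
    {C : Matrix (Fin 3) (Fin 3) ℝ} (hC : Cᵀ * C = 1) (hdet : C.det = 1) :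
    ∃ g ∈ idComponent G, ∀ k, ρ g * X k = (∑ j, C j k • X j) * ρ g := by
  have mul : ∀ C D : Matrix (Fin 3) (Fin 3) ℝ,
      (∃ g ∈ idComponent G, ∀ k, ρ g * X k = (∑ j, C j k • X j) * ρ g) →
      (∃ g ∈ idComponent G, ∀ k, ρ g * X k = (∑ j, D j k • X j) * ρ g) →
      ∃ g ∈ idComponent G, ∀ k, ρ g * X k = (∑ j, (C * D) j k • X j) * ρ g := by
    rintro C D ⟨g, hg, hgC⟩ ⟨g', hg', hgD⟩
    refine ⟨g * g', mul_mem hg hg', fun k => ?_⟩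
    rw [map_mul, mul_assoc, hgD, ← mul_assoc, Finset.mul_sum]
    simp only [mul_smul_comm, hgC]
    rw [← mul_assoc]
    congr 1
    simp only [Matrix.mul_apply, Fin.sum_univ_three, add_mul, smul_mul_assoc, smul_add, smul_smul]
    simp only [add_smul]
    simp only [mul_comm (C _ _)]
    abel
  have hX : ∀ t, ∃ g ∈ idComponent G, ∀ k, ρ g * X k = (∑ j, rotX t j k • X j) * ρ g := by
    intro t
    obtain ⟨g, hg, hgt⟩ := h.exists_rep_eq_exp 0 t
    have e : X 0 * X 2 - X 2 * X 0 = -X 1 := by rw [← h.comm20]; abel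
    refine ⟨g, hg, fun k => ?_⟩
    rw [hgt]
    fin_cases k
    · have := ((Commute.refl (X 0)).smul_left t).exp_left
      simp [rotX, Fin.sum_univ_three]
      exact this
    · simpa [rotX, Fin.sum_univ_three] using exp_smul_mul_eq_of_commutator h.comm01 e t
    · have := exp_smul_mul_eq_of_commutator (P := X 2) (Q := -X 1) e (by
        rw [mul_neg, neg_mul, ← h.comm01]; abel) t
      simp [rotX, Fin.sum_univ_three]
      simp at this
      rw [this, add_comm]
  have hZ : ∀ t, ∃ g ∈ idComponent G, ∀ k, ρ g * X k = (∑ j, rotZ t j k • X j) * ρ g := by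
    intro t
    obtain ⟨g, hg, hgt⟩ := h.exists_rep_eq_exp 2 t
    have e : X 2 * X 1 - X 1 * X 2 = -X 0 := by rw [← h.comm12]; abel
    refine ⟨g, hg, fun k => ?_⟩
    rw [hgt]
    fin_cases k
    · simpa [rotZ, Fin.sum_univ_three] using exp_smul_mul_eq_of_commutator h.comm20 e t
    · have := exp_smul_mul_eq_of_commutator (P := X 1) (Q := -X 0) e (by
        rw [mul_neg, neg_mul, ← h.comm20]; abel) t
      simp [rotZ, Fin.sum_univ_three]
      simp at this
      rw [this, add_comm]
    · have := ((Commute.refl (X 2)).smul_left t).exp_left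
      simp [rotZ, Fin.sum_univ_three]
      exact this
  -- Realizable rotations are closed under products, so two axes suffice.
  obtain ⟨a, b, c, rfl⟩ := exists_euler_angles hC hdet
  exact mul _ _ (mul _ _ (hZ a) (hX b)) (hZ c)

/-- Up to the identity component, every element of the group commutes with the generators. -/
theorem exists_mul_commute [CompleteSpace V] (h : IsInfinitesimalModel ρ X B) (g : G) :
    ∃ g₁, ∃ g₀ ∈ idComponent G, g = g₁ * g₀ ∧ ∀ k, ρ g₁ * X k = X k * ρ g₁ := by
  by_cases hX : X = 0
  · exact ⟨g, 1, one_mem _, (mul_one g).symm, fun k => by simp [hX]⟩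
  choose a ha using h.conj g
  have hag : ∀ k, ρ g * X k = (∑ j, a k j • X j) * ρ g := fun k => by
    rw [← ha, mul_assoc (ρ g * X k), rep_inv_mul_rep, mul_one]
  have lin : ∀ x y : Fin 3 → ℝ, ∑ j, x j • X j = ∑ j, y j • X j → x = y := fun x y hxy => by
    rw [← sub_eq_zero]
    refine h.eq_zero_of_sum_smul_eq_zero hX ?_
    simp only [Pi.sub_apply, sub_smul, Finset.sum_sub_distrib, hxy, sub_self]
  have br : ∀ x y : Fin 3 → ℝ, (∑ j, x j • X j) * (∑ j, y j • X j) -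
      (∑ j, y j • X j) * (∑ j, x j • X j) = ∑ j, crossProduct x y j • X j := by
    intro x y
    have e : ∑ j, crossProduct x y j • X j = (x 1 * y 2 - x 2 * y 1) • (X 1 * X 2 - X 2 * X 1) +
        (x 2 * y 0 - x 0 * y 2) • (X 2 * X 0 - X 0 * X 2) +
        (x 0 * y 1 - x 1 * y 0) • (X 0 * X 1 - X 1 * X 0) := by
      rw [h.comm01, h.comm12, h.comm20, Fin.sum_univ_three, cross_apply]
      rfl
    rw [e]
    simp only [Fin.sum_univ_three, mul_add, add_mul, smul_mul_assoc, mul_smul_comm]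
    module
  -- Conjugation preserves brackets, so the rows of its coefficient matrix multiply like the
  -- generators under the cross product. Unless X = 0, they are orthonormal of determinant |a₀|² =
  -- 1, and the same rotation comes from G⁰.
  have conj_br : ∀ k l m, X k * X l - X l * X k = X m → crossProduct (a k) (a l) = a m := by
    intro k l m hklm
    apply lin
    rw [← br, ← ha, ← ha, ← ha, ← hklm]
    have : ∀ P Q : V →L[ℝ] V, ρ g * P * ρ g⁻¹ * (ρ g * Q * ρ g⁻¹) = ρ g * (P * Q) * ρ g⁻¹ := by
      intro P Q
      calc _ = ρ g * P * (ρ g⁻¹ * ρ g) * Q * ρ g⁻¹ := by noncomm_ring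
        _ = _ := by rw [rep_inv_mul_rep]; noncomm_ring
    rw [this, this, mul_sub, sub_mul]
  have c01 := conj_br 0 1 2 h.comm01
  have c12 := conj_br 1 2 0 h.comm12
  have c20 := conj_br 2 0 1 h.comm20
  rcases eq_zero_or_orthonormal_of_cross c01 c12 c20 with ⟨a0, a1, a2⟩ | ⟨n0, n1, n2, o01, o12, o20⟩
  · refine absurd (funext fun k => ?_) hX
    have hk : a k = 0 := by fin_cases k <;> assumption
    have h1 : ρ g * X k = 0 := by rw [hag, hk]; simp
    calc X k = (ρ g⁻¹ * ρ g) * X k := by rw [rep_inv_mul_rep, one_mul]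
      _ = 0 := by rw [mul_assoc, h1, mul_zero]
  · have hC : (Matrix.of a)ᵀᵀ * (Matrix.of a)ᵀ = 1 := by
      ext i j
      rw [transpose_transpose]
      have : (Matrix.of a * (Matrix.of a)ᵀ) i j = a i ⬝ᵥ a j := rfl
      rw [this]
      fin_cases i <;> fin_cases j <;> simp [n0, n1, n2, o01, o12, o20] <;>
        rw [dotProduct_comm] <;> assumption
    have hdet : ((Matrix.of a)ᵀ).det = 1 := by
      have : (Matrix.of a).det = a 0 ⬝ᵥ crossProduct (a 1) (a 2) := by
        rw [cross_apply, det_fin_three]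
        simp [dotProduct, Fin.sum_univ_three]
        ring
      rw [det_transpose, this, c12, n0]
    obtain ⟨g₀, hg₀, hg₀C⟩ := h.exists_conj_eq_rotation hC hdet
    refine ⟨g * g₀⁻¹, g₀, hg₀, by group, ?_⟩
    have hsum : ∀ k, ρ g₀ * X k * ρ g₀⁻¹ = ∑ j, a k j • X j := fun k => by
      rw [hg₀C, mul_assoc, rep_mul_rep_inv, mul_one]; rfl
    have hcomb : ∀ x, (∃ k, x = ∑ j, a k j • X j) →
        ρ g₀⁻¹ * x * ρ g₀ = ρ g⁻¹ * x * ρ g := by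
      rintro x ⟨k, rfl⟩
      have e1 : ρ g₀⁻¹ * (∑ j, a k j • X j) * ρ g₀ = X k := by
        rw [← hsum]
        calc _ = (ρ g₀⁻¹ * ρ g₀) * X k * (ρ g₀⁻¹ * ρ g₀) := by noncomm_ring
          _ = _ := by rw [rep_inv_mul_rep, one_mul, mul_one]
      have e2 : ρ g⁻¹ * (∑ j, a k j • X j) * ρ g = X k := by
        rw [← ha]
        calc _ = (ρ g⁻¹ * ρ g) * X k * (ρ g⁻¹ * ρ g) := by noncomm_ring
          _ = _ := by rw [rep_inv_mul_rep, one_mul, mul_one]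
      rw [e1, e2]
    -- The matrix is orthogonal, so each generator is a combination of the conjugated ones, on which
    -- g and g₀ are already known to agree.
    have hspan : ∀ k, X k = ∑ l, a l k • ∑ j, a l j • X j := by
      intro k
      have hC' := mul_eq_one_comm.1 hC
      have hjk : ∀ j, ∑ l, a l k * a l j = if k = j then 1 else 0 := fun j => by
        have := congrFun (congrFun hC' k) j
        rw [transpose_transpose, Matrix.mul_apply, Matrix.one_apply] at this
        exact this
      simp only [Finset.smul_sum, smul_smul]
      rw [Finset.sum_comm]
      simp only [← Finset.sum_smul, hjk]
      simp
    have hall : ∀ k, ρ g₀⁻¹ * X k * ρ g₀ = ρ g⁻¹ * X k * ρ g := by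
      intro k
      rw [hspan]
      simp only [Finset.mul_sum, Finset.sum_mul, mul_smul_comm, smul_mul_assoc]
      refine Finset.sum_congr rfl fun l _ => ?_
      congr 1
      simpa only [Finset.mul_sum, Finset.sum_mul, mul_smul_comm, smul_mul_assoc] using
        hcomb _ ⟨l, rfl⟩
    intro k
    rw [map_mul]
    calc ρ g * ρ g₀⁻¹ * X k = ρ g * (ρ g₀⁻¹ * X k * ρ g₀) * ρ g₀⁻¹ := by
          rw [mul_assoc (ρ g), mul_assoc (ρ g), mul_assoc (ρ g₀⁻¹ * X k), rep_mul_rep_inv, mul_one]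
      _ = (ρ g * ρ g⁻¹) * X k * ρ g * ρ g₀⁻¹ := by rw [hall]; noncomm_ring
      _ = X k * (ρ g * ρ g₀⁻¹) := by rw [rep_mul_rep_inv, one_mul, mul_assoc]

end IsInfinitesimalModel

end Conjugation

/-! ### Splitting off the fixed vectors, and actions in coordinates. -/

section LinearModel

variable {G : Type*} [TopologicalSpace G] [Group G] [IsTopologicalGroup G]
  {V : Type*} [NormedAddCommGroup V] [NormedSpace ℝ V]

/-- Linear coordinates `e` on `V = V₀ × M` in which the generators act through `Y` on `M` and the
invariant inner product is the orthogonal sum of its restriction to `V₀` and `b`. -/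
structure IsLinearModel (ρ : G →* (V →L[ℝ] V)) (X : Fin 3 → V →L[ℝ] V)
    (B : LinearMap.BilinForm ℝ V) {M : Type*} [AddCommGroup M] [Module ℝ M]
    (Y : Fin 3 → M →ₗ[ℝ] M) (b : M → M → ℝ) (e : V ≃ₗ[ℝ] fixedSubspace ρ × M) : Prop where
  apply_fixed : ∀ v : fixedSubspace ρ, e v = (v, 0)
  apply_generator : ∀ k v, e (X k v) = (0, Y k (e v).2)
  form : ∀ v w, B v w = B (e v).1 (e w).1 + b (e v).2 (e w).2

variable {ρ : G →* (V →L[ℝ] V)} {X : Fin 3 → V →L[ℝ] V} {B : LinearMap.BilinForm ℝ V}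

theorem IsInfinitesimalModel.eq_zero_of_form_eq_zero (h : IsInfinitesimalModel ρ X B) {v : V}
    (hv : B v v = 0) : v = 0 := by
  by_contra hne
  exact (h.pos v hne).ne' hv

/-- The identity component is normal. -/
theorem rep_mem_fixedSubspace {v : V} (hv : v ∈ fixedSubspace ρ) (g : G) :
    ρ g v ∈ fixedSubspace ρ := by
  intro x hx
  have h1 : g⁻¹ * x * g ∈ idComponent G := by
    simpa using (instNormalIdComponent (G := G)).conj_mem x hx g⁻¹
  have h2 := hv _ h1
  calc ρ x (ρ g v) = ρ (x * g) v := by rw [map_mul]; rfl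
    _ = ρ (g * (g⁻¹ * x * g)) v := by congr 2; group
    _ = ρ g (ρ (g⁻¹ * x * g) v) := by rw [map_mul]; rfl
    _ = ρ g v := by rw [h2]

variable {M : Type*} [AddCommGroup M] [Module ℝ M]
  {Y : Fin 3 → M →ₗ[ℝ] M} {b : M → M → ℝ}

/-- An isometric equivariant embedding of `M` orthogonal to the fixed vectors whose image is large
enough gives linear coordinates. -/
theorem IsInfinitesimalModel.exists_isLinearModel [FiniteDimensional ℝ V] [FiniteDimensional ℝ M]
    (h : IsInfinitesimalModel ρ X B) (j : M →ₗ[ℝ] V)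
    (hj : ∀ k x, X k (j x) = j (Y k x)) (hb : ∀ x y, B (j x) (j y) = b x y)
    (horth : ∀ v ∈ fixedSubspace ρ, ∀ x, B v (j x) = 0) (hpos : ∀ x, b x x = 0 → x = 0)
    (hdim : Module.finrank ℝ V ≤ Module.finrank ℝ (fixedSubspace ρ) + Module.finrank ℝ M) :
    ∃ e, IsLinearModel ρ X B Y b e := by
  -- The two summands are orthogonal and the form is definite on each, so f is injective; the
  -- dimension bound then makes it bijective.
  let f : fixedSubspace ρ × M →ₗ[ℝ] V := (fixedSubspace ρ).subtype.coprod j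
  have hf : ∀ v x, f (v, x) = v + j x := fun v x => by simp [f]
  have hB : ∀ v w x y, B (f (v, x)) (f (w, y)) = B v w + b x y := by
    intro v w x y
    rw [hf, hf, map_add, map_add, LinearMap.add_apply, LinearMap.add_apply, hb, horth v v.2 y,
      h.symm (j x) w, horth w w.2 x]
    ring
  have hinj : Function.Injective f := by
    rw [injective_iff_map_eq_zero]
    rintro ⟨v, x⟩ h0
    have hnn : ∀ u : V, 0 ≤ B u u := fun u => by
      by_cases hu : u = 0
      · simp [hu]
      · exact (h.pos u hu).le
    have h1 := hB v v x x
    rw [h0, map_zero] at h1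
    have h2 := hnn v
    have h3 := hnn (j x)
    rw [hb] at h3
    have hv : (v : V) = 0 := h.eq_zero_of_form_eq_zero (by linarith)
    exact Prod.ext (Subtype.ext hv) (hpos x (by linarith))
  have hfin : Module.finrank ℝ (fixedSubspace ρ × M) = Module.finrank ℝ V := by
    have := LinearMap.finrank_le_finrank_of_injective hinj
    rw [Module.finrank_prod] at this ⊢
    omega
  let E := LinearEquiv.ofInjectiveOfFinrankEq f hinj hfin
  have hE : ∀ p, E p = f p := fun p => rfl
  refine ⟨E.symm, ?_, ?_, ?_⟩
  · intro v
    rw [LinearEquiv.symm_apply_eq, hE, hf, map_zero, add_zero]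
  · intro k v
    obtain ⟨p, rfl⟩ := E.surjective v
    rw [LinearEquiv.symm_apply_apply, LinearEquiv.symm_apply_eq, hE, hE, hf 0, ← hj]
    have : f p = p.1 + j p.2 := hf p.1 p.2
    rw [this, map_add, (h.fixed _).1 p.1.2 k]
    simp
  · intro v w
    obtain ⟨p, rfl⟩ := E.surjective v
    obtain ⟨p', rfl⟩ := E.surjective w
    rw [LinearEquiv.symm_apply_apply, LinearEquiv.symm_apply_apply]
    exact hB p.1 p'.1 p.2 p'.2

namespace IsLinearModel

variable {e : V ≃ₗ[ℝ] fixedSubspace ρ × M}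

/-- The group acts on `V₀ × M` by isometries respecting the splitting. -/
theorem exists_split (he : IsLinearModel ρ X B Y b e) (h : IsInfinitesimalModel ρ X B) (g : G) :
    ∃ (T₀ : fixedSubspace ρ →ₗ[ℝ] fixedSubspace ρ) (T : M →ₗ[ℝ] M),
      (∀ v, e (ρ g v) = (T₀ (e v).1, T (e v).2)) ∧ (∀ v : fixedSubspace ρ, (T₀ v : V) = ρ g v) ∧
      ∀ x y, b (T x) (T y) = b x y := by
  let T₀ : fixedSubspace ρ →ₗ[ℝ] fixedSubspace ρ :=
    (ρ g).toLinearMap.restrict fun v hv => rep_mem_fixedSubspace hv g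
  have hT₀ : ∀ v : fixedSubspace ρ, (T₀ v : V) = ρ g v := fun v => rfl
  let T : M →ₗ[ℝ] M := LinearMap.snd ℝ _ _ ∘ₗ e.toLinearMap ∘ₗ (ρ g).toLinearMap ∘ₗ
    e.symm.toLinearMap ∘ₗ LinearMap.inr ℝ _ _
  have hb0 : b 0 0 = 0 := by
    have := he.form 0 0
    simpa using this.symm
  have hb0x : ∀ x, b 0 x = 0 := fun x => by
    have := he.form 0 (e.symm (0, x))
    simpa using this.symm
  -- The orthogonal complement of the invariant subspace V₀ is invariant: the V₀-component of the
  -- image is orthogonal to itself.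
  have hT : ∀ x, e (ρ g (e.symm (0, x))) = (0, T x) := by
    intro x
    refine Prod.ext ?_ rfl
    set u := (e (ρ g (e.symm (0, x)))).1 with hu
    have hu' : (ρ g⁻¹ (u : V)) ∈ fixedSubspace ρ := rep_mem_fixedSubspace u.2 _
    have h1 : B u (ρ g (e.symm (0, x))) = B u u := by
      rw [he.form, he.apply_fixed, ← hu]
      simp [hb0x]
    have h2 : B u (ρ g (e.symm (0, x))) = 0 := by
      rw [← h.inv g⁻¹]
      have : ρ g⁻¹ (ρ g (e.symm (0, x))) = e.symm (0, x) := by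
        change (ρ g⁻¹ * ρ g) _ = _
        rw [rep_inv_mul_rep]; rfl
      rw [this, he.form, he.apply_fixed ⟨_, hu'⟩]
      simp [hb0x]
    exact Subtype.ext (h.eq_zero_of_form_eq_zero (h1.symm.trans h2))
  refine ⟨T₀, T, fun v => ?_, hT₀, fun x y => ?_⟩
  · have hv : v = (e v).1 + e.symm (0, (e v).2) := by
      apply e.injective
      rw [map_add, he.apply_fixed, LinearEquiv.apply_symm_apply]
      simp
    conv_lhs => rw [hv]
    rw [map_add, map_add, hT, ← hT₀, he.apply_fixed]
    simp
  · have h1 := h.inv g (e.symm (0, x)) (e.symm (0, y))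
    rw [he.form, he.form (e.symm (0, x)), hT, hT] at h1
    simpa using h1

/-- The identity component acts on `M` by isometries commuting with the commutant of the
generators. -/
theorem exists_of_mem_idComponent [FiniteDimensional ℝ V] (he : IsLinearModel ρ X B Y b e)
    (h : IsInfinitesimalModel ρ X B) {g : G} (hg : g ∈ idComponent G) :
    ∃ T : M →ₗ[ℝ] M, (∀ v, e (ρ g v) = ((e v).1, T (e v).2)) ∧ (∀ x y, b (T x) (T y) = b x y) ∧
      ∀ C : M →ₗ[ℝ] M, (∀ k x, C (Y k x) = Y k (C x)) → ∀ x, T (C x) = C (T x) := by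
  obtain ⟨T₀, T, hT, hT₀, hb⟩ := he.exists_split h g
  have hT₀1 : ∀ v, T₀ v = v := fun v => Subtype.ext (by rw [hT₀]; exact v.2 g hg)
  refine ⟨T, fun v => by rw [hT, hT₀1], hb, fun C hC x => ?_⟩
  -- Extending C by 0 on V₀ keeps it in the commutant, because the generators vanish on V₀.
  let C' : V →L[ℝ] V := LinearMap.toContinuousLinearMap
    (e.symm.toLinearMap ∘ₗ LinearMap.inr ℝ _ _ ∘ₗ C ∘ₗ LinearMap.snd ℝ _ _ ∘ₗ e.toLinearMap)
  have hC' : ∀ v, C' v = e.symm (0, C (e v).2) := fun v => by simp [C']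
  have hcomm := h.commute C' (fun k => by
    ext v
    apply e.injective
    change e (X k (C' v)) = e (C' (X k v))
    rw [he.apply_generator, hC', hC', LinearEquiv.apply_symm_apply, LinearEquiv.apply_symm_apply,
      he.apply_generator, hC]) g hg
  have := congrArg (fun D : V →L[ℝ] V => (e (D (e.symm (0, x)))).2) hcomm
  change (e (ρ g (C' _))).2 = (e (C' (ρ g _))).2 at this
  simpa only [hC', hT, LinearEquiv.apply_symm_apply] using this

/-- Flows on `M` generated by the Lie algebra come from the identity component. -/
theorem exists_of_flow {M : Type*} [NormedAddCommGroup M] [NormedSpace ℝ M] [FiniteDimensional ℝ M]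
    [FiniteDimensional ℝ V] {Y : Fin 3 → M →ₗ[ℝ] M} {b : M → M → ℝ}
    {e : V ≃ₗ[ℝ] fixedSubspace ρ × M} (he : IsLinearModel ρ X B Y b e)
    (h : IsInfinitesimalModel ρ X B) (c : Fin 3 → ℝ) (R : ℝ → M → M) (hR0 : ∀ x, R 0 x = x)
    (hR : ∀ x t, HasDerivAt (fun t => R t x) (∑ k, c k • Y k (R t x)) t) (t : ℝ) :
    ∃ g ∈ idComponent G, ∀ v, e (ρ g v) = ((e v).1, R t (e v).2) := by
  obtain ⟨g, hg, hgt⟩ := h.exp c (fun t v => e.symm ((e v).1, R t (e v).2))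
    (fun v => by rw [hR0]; exact e.symm_apply_apply v) (fun v t => by
      have h1 : HasDerivAt (fun t => ((e v).1, R t (e v).2))
          ((0 : fixedSubspace ρ), ∑ k, c k • Y k (R t (e v).2)) t :=
        (hasDerivAt_const t _).prodMk (hR _ t)
      refine ((e.symm.toLinearMap.toContinuousLinearMap).hasFDerivAt.comp_hasDerivAt t
        h1).congr_deriv ?_
      apply e.injective
      change e (e.symm _) = _
      rw [LinearEquiv.apply_symm_apply, map_sum]
      simp only [map_smul, he.apply_generator, LinearEquiv.apply_symm_apply]
      ext1
      · simp [Prod.fst_sum]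
      · simp [Prod.snd_sum]) t
  exact ⟨g, hg, fun v => by rw [hgt, LinearEquiv.apply_symm_apply]⟩

/-- A differentiable function on `M` that is constant along curves tangent to the generators is
invariant under the identity component. -/
theorem apply_eq_of_flow {M : Type*} [NormedAddCommGroup M] [NormedSpace ℝ M]
    [FiniteDimensional ℝ M] [FiniteDimensional ℝ V] {Y : Fin 3 → M →ₗ[ℝ] M} {b : M → M → ℝ}
    {e : V ≃ₗ[ℝ] fixedSubspace ρ × M} (he : IsLinearModel ρ X B Y b e)
    (h : IsInfinitesimalModel ρ X B) (f : M → ℍ[ℝ]) (hf : Differentiable ℝ f)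
    (R : Fin 3 → ℝ → M → M) (hR0 : ∀ k x, R k 0 x = x) {a : ℝ} (ha : a ≠ 0)
    (hR : ∀ k x, HasDerivAt (fun t => R k t x) (a • Y k x) 0) (hfR : ∀ k t x, f (R k t x) = f x)
    {g : G} (hg : g ∈ idComponent G) (v : V) : f (e (ρ g v)).2 = f (e v).2 := by
  let p : V →L[ℝ] M := LinearMap.toContinuousLinearMap (LinearMap.snd ℝ _ _ ∘ₗ e.toLinearMap)
  have hp : ∀ v, p v = (e v).2 := fun v => rfl
  refine h.invariant (fun v => f (p v)) (hf.comp p.differentiable) (fun k v => ?_) g hg v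
  have h1 : HasFDerivAt (fun v => f (p v)) ((fderiv ℝ f (p v)).comp p) v :=
    (hf (p v)).hasFDerivAt.comp v p.hasFDerivAt
  rw [h1.fderiv, ContinuousLinearMap.comp_apply, hp (X k v), he.apply_generator]
  have h2 : HasDerivAt (fun t => f (R k t (p v))) (fderiv ℝ f (p v) (a • Y k (p v))) 0 := by
    have h3 : HasFDerivAt f (fderiv ℝ f (p v)) (R k 0 (p v)) := by
      rw [hR0]; exact (hf (p v)).hasFDerivAt
    exact h3.comp_hasDerivAt 0 (hR k (p v))
  simp only [hfR, map_smul] at h2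
  exact (smul_eq_zero.1 (h2.unique (hasDerivAt_const _ _))).resolve_left ha

/-- The whole group acts linearly on the target of an invariant map if isometries commuting with
the generators do. -/
theorem exists_linear_equivariant [FiniteDimensional ℝ V] (he : IsLinearModel ρ X B Y b e)
    (h : IsInfinitesimalModel ρ X B) {N : Type*} [AddCommGroup N] [Module ℝ N] {q : M → N}
    (hq : ∀ g ∈ idComponent G, ∀ v, q (e (ρ g v)).2 = q (e v).2)
    (hτ : ∀ T : M →ₗ[ℝ] M, (∀ x y, b (T x) (T y) = b x y) → (∀ k x, T (Y k x) = Y k (T x)) →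
      ∃ τ : N →ₗ[ℝ] N, ∀ x, q (T x) = τ (q x)) (g : G) :
    ∃ (T : fixedSubspace ρ →ₗ[ℝ] fixedSubspace ρ) (τ : N →ₗ[ℝ] N),
      ∀ v, (e (ρ g v)).1 = T (e v).1 ∧ q (e (ρ g v)).2 = τ (q (e v).2) := by
  have : CompleteSpace V := FiniteDimensional.complete ℝ V
  -- The factor g₀ leaves q unchanged, so only isometries commuting with the generators need linear
  -- images.
  obtain ⟨g₁, g₀, hg₀, rfl, hcomm⟩ := h.exists_mul_commute g
  obtain ⟨T₀, T, hT, -, hb⟩ := he.exists_split h g₁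
  obtain ⟨T', hT', -⟩ := he.exists_of_mem_idComponent h hg₀
  obtain ⟨τ, hτ⟩ := hτ T hb (fun k x => by
    have := congrArg (fun D : V →L[ℝ] V => (e (D (e.symm (0, x)))).2) (hcomm k)
    change (e (ρ g₁ (X k _))).2 = (e (X k (ρ g₁ _))).2 at this
    rw [hT, he.apply_generator, he.apply_generator, hT, LinearEquiv.apply_symm_apply] at this
    exact this)
  refine ⟨T₀, τ, fun v => ?_⟩
  have hv : ρ (g₁ * g₀) v = ρ g₁ (ρ g₀ v) := by rw [map_mul]; rfl
  constructor
  · rw [hv, hT, hT']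
  · rw [hv, hT]
    change q (T _) = _
    rw [hτ, hq g₀ hg₀]

/-- The quotient by the identity component in linear coordinates. -/
theorem exists_homeomorph [FiniteDimensional ℝ V] (he : IsLinearModel ρ X B Y b e)
    (h : IsInfinitesimalModel ρ X B) {S N₁ N₂ : Type*} [AddCommGroup N₁] [Module ℝ N₁]
    [AddCommGroup N₂] [Module ℝ N₂] [FiniteDimensional ℝ N₁] [FiniteDimensional ℝ N₂]
    {act : S → M → M} {q : M → N₁ × N₂}
    (hact : ∀ g ∈ idComponent G, ∃ s : S, ∀ v, e (ρ g v) = ((e v).1, act s (e v).2))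
    (hreal : ∀ s : S, ∃ g ∈ idComponent G, ∀ v, e (ρ g v) = ((e v).1, act s (e v).2))
    (hq : ∀ x y, q x = q y ↔ ∃ s, act s x = y) (hsurj : Function.Surjective q)
    {n₁ n₂ : ℕ} (hn₁ : n₁ ≠ 0) (hn₂ : n₂ ≠ 0)
    (hom : ∀ (t : ℝ) x, q (t • x) = (t ^ n₁ • (q x).1, t ^ n₂ • (q x).2))
    (hsmooth : ∀ (j : V →ₗ[ℝ] M) (l : N₁ × N₂ →ₗ[ℝ] ℝ), ContDiff ℝ ∞ fun v => l (q (j v)))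
    (hτ : ∀ T : M →ₗ[ℝ] M, (∀ x y, b (T x) (T y) = b x y) → (∀ k x, T (Y k x) = Y k (T x)) →
      ∃ τ : N₁ × N₂ →ₗ[ℝ] N₁ × N₂, ∀ x, q (T x) = τ (q x)) :
    ∃ (m : ℕ) (φ : OrbitSpace ρ ≃ₜ EuclideanSpace ℝ (Fin m))
      (σ : Representation ℝ (G ⧸ idComponent G) (EuclideanSpace ℝ (Fin m))),
      ContDiff ℝ ∞ (fun v : V => φ (toOrbit ρ v)) ∧
      (∀ (g : G) (v : V), φ (toOrbit ρ (ρ g v)) =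
        σ (g : G ⧸ idComponent G) (φ (toOrbit ρ v))) ∧
      HasExplicitQuotientMap ρ φ act q :=
  exists_homeomorph_of_model e he.apply_fixed hact hreal hq hsurj hn₁ hn₂ hom hsmooth
    (he.exists_linear_equivariant h (fun g hg v => by
      obtain ⟨s, hs⟩ := hact g hg
      rw [hs]
      exact ((hq _ _).2 ⟨s, rfl⟩).symm) hτ)

end IsLinearModel

end LinearModel

/-! ### Circles of unit quaternions. -/

section UnitQuaternions

/-- The quaternions `i`, `j`, `k`. -/
def imUnit (k : Fin 3) : ℍ[ℝ] := ![quat 0 1 0 0, quat 0 0 1 0, quat 0 0 0 1] k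

@[simp] theorem imUnit_zero : imUnit 0 = quat 0 1 0 0 := rfl
@[simp] theorem imUnit_one : imUnit 1 = quat 0 0 1 0 := rfl
@[simp] theorem imUnit_two : imUnit 2 = quat 0 0 0 1 := rfl

/-- The point with parameter `t` on the circle through `1` and `u`. -/
def circleQuat (u : ℍ[ℝ]) (t : ℝ) : ℍ[ℝ] := Real.cos t • 1 + Real.sin t • u

theorem circleQuat_zero (u : ℍ[ℝ]) : circleQuat u 0 = 1 := by simp [circleQuat]

theorem star_circleQuat {u : ℍ[ℝ]} (hu : star u = -u) (t : ℝ) :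
    star (circleQuat u t) = circleQuat (-u) t := by
  simp [circleQuat, hu]

theorem hasDerivAt_circleQuat {u : ℍ[ℝ]} (hu : u * u = -1) (t : ℝ) :
    HasDerivAt (circleQuat u) (circleQuat u t * u) t := by
  refine (((Real.hasDerivAt_cos t).smul_const (1 : ℍ[ℝ])).add
    ((Real.hasDerivAt_sin t).smul_const u)).congr_deriv ?_
  simp only [circleQuat, add_mul, smul_mul_assoc, hu, one_mul]
  module

theorem sum_smul_imUnit (c : Fin 3 → ℝ) : ∑ k, c k • imUnit k = quat 0 (c 0) (c 1) (c 2) := by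
  rw [Fin.sum_univ_three]
  ext <;> simp

theorem exists_eq_circleQuat {h : ℍ[ℝ]} (hh : ‖h‖ = 1) :
    ∃ (t : ℝ) (c : Fin 3 → ℝ), c 0 ^ 2 + c 1 ^ 2 + c 2 ^ 2 = 1 ∧
      h = circleQuat (∑ k, c k • imUnit k) t := by
  have h1 : h.re ^ 2 + (h.imI ^ 2 + h.imJ ^ 2 + h.imK ^ 2) = 1 := by
    have := norm_sq_eq h
    rw [hh] at this; linarith
  set n := √(h.imI ^ 2 + h.imJ ^ 2 + h.imK ^ 2) with hn
  have hn2 : n ^ 2 = h.imI ^ 2 + h.imJ ^ 2 + h.imK ^ 2 := Real.sq_sqrt (by positivity)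
  obtain ⟨t, ht1, ht2⟩ := exists_polar_of_sq_add_sq_eq_one (x := h.re) (y := n) (by rw [hn2, h1])
  by_cases hn0 : n = 0
  · rw [hn0] at hn2
    have hI : h.imI = 0 := by nlinarith [sq_nonneg h.imI, sq_nonneg h.imJ, sq_nonneg h.imK]
    have hJ : h.imJ = 0 := by nlinarith [sq_nonneg h.imI, sq_nonneg h.imJ, sq_nonneg h.imK]
    have hK : h.imK = 0 := by nlinarith [sq_nonneg h.imI, sq_nonneg h.imJ, sq_nonneg h.imK]
    -- For real h the axis is arbitrary.
    refine ⟨t, ![1, 0, 0], by simp, ?_⟩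
    rw [sum_smul_imUnit, circleQuat, ← ht1, ← ht2, hn0]
    ext <;> simp [hI, hJ, hK]
  · refine ⟨t, ![h.imI / n, h.imJ / n, h.imK / n], ?_, ?_⟩
    · simp only [Matrix.cons_val_zero, Matrix.cons_val_one, Matrix.cons_val]
      field_simp
      rw [hn2]
    · rw [sum_smul_imUnit, circleQuat, ← ht1, ← ht2]
      ext <;> simp <;> field_simp

theorem sum_smul_imUnit_mul_self {c : Fin 3 → ℝ} (hc : c 0 ^ 2 + c 1 ^ 2 + c 2 ^ 2 = 1) :
    (∑ k, c k • imUnit k) * (∑ k, c k • imUnit k) = -1 := by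
  rw [sum_smul_imUnit]
  ext <;> simp <;> linarith

theorem star_sum_smul_imUnit (c : Fin 3 → ℝ) :
    star (∑ k, c k • imUnit k) = -∑ k, c k • imUnit k := by
  rw [sum_smul_imUnit]
  ext <;> simp

/-- Real linear maps commuting with right multiplications are left multiplications. -/
theorem eq_mul_of_commute_mul_imUnit {t : ℍ[ℝ] →ₗ[ℝ] ℍ[ℝ]}
    (ht : ∀ k z, t (z * imUnit k) = t z * imUnit k) (z : ℍ[ℝ]) : t z = t 1 * z := by
  have hz : z = z.re • 1 + z.imI • imUnit 0 + z.imJ • imUnit 1 + z.imK • imUnit 2 := by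
    ext <;> simp
  have hk : ∀ k, t (imUnit k) = t 1 * imUnit k := fun k => by rw [← ht, one_mul]
  rw [hz]
  simp only [map_add, map_smul, hk, mul_add, mul_smul_comm, mul_one]

theorem re_mul_star_self (z : ℍ[ℝ]) : (z * star z).re = ‖z‖ ^ 2 := by
  rw [norm_sq_eq]; simp; ring

theorem star_smul_quaternion (r : ℝ) (z : ℍ[ℝ]) : star (r • z) = r • star z := by
  ext <;> simp

theorem contDiff_star_quaternion : ContDiff ℝ ∞ (star : ℍ[ℝ] → ℍ[ℝ]) := by
  let S : ℍ[ℝ] →ₗ[ℝ] ℍ[ℝ] :=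
    { toFun := star
      map_add' := star_add
      map_smul' := star_smul_quaternion }
  exact (LinearMap.toContinuousLinearMap S).contDiff

end UnitQuaternions

/-! ### The model ℍ ⊕ ℍ. -/

section Model44

/-- The generators acting on `ℍ ⊕ ℍ`. -/
def gen44 (k : Fin 3) : ℍ[ℝ] × ℍ[ℝ] →ₗ[ℝ] ℍ[ℝ] × ℍ[ℝ] :=
  -- Right multiplications by i, j, k have brackets -2 times the third one, so the factor -1/2
  -- yields the normalized relations.
  (-(1 / 2 : ℝ)) • (LinearMap.mulRight ℝ (imUnit k)).prodMap (LinearMap.mulRight ℝ (imUnit k))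

theorem gen44_apply (k : Fin 3) (z : ℍ[ℝ] × ℍ[ℝ]) :
    gen44 k z = (-(1 / 2 : ℝ)) • (z.1 * imUnit k, z.2 * imUnit k) := rfl

/-- The Euclidean inner product on `ℍ ⊕ ℍ`. -/
def form44 (z w : ℍ[ℝ] × ℍ[ℝ]) : ℝ := (z.1 * star w.1).re + (z.2 * star w.2).re

theorem quot44_smul (t : ℝ) (z : ℍ[ℝ] × ℍ[ℝ]) :
    quot44 (t • z) = (t ^ 2 • (quot44 z).1, t ^ 2 • (quot44 z).2) := by
  simp only [quot44, Prod.smul_fst, Prod.smul_snd, norm_smul, mul_pow, Real.norm_eq_abs, sq_abs,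
    smul_eq_mul, star_smul_quaternion, smul_mul_smul_comm, mul_sub]
  rw [← sq]

theorem contDiff_quot44 : ContDiff ℝ ∞ quot44 :=
  ((contDiff_fst.norm_sq ℝ).sub (contDiff_snd.norm_sq ℝ)).prodMk
    (contDiff_fst.mul (contDiff_star_quaternion.comp contDiff_snd))

/-- An isometry commuting with the generators induces a linear map of the quotient. -/
theorem exists_quot44_comp_eq {T : ℍ[ℝ] × ℍ[ℝ] →ₗ[ℝ] ℍ[ℝ] × ℍ[ℝ]}
    (hT : ∀ x y, form44 (T x) (T y) = form44 x y) (hY : ∀ k x, T (gen44 k x) = gen44 k (T x)) :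
    ∃ τ : ℝ × ℍ[ℝ] →ₗ[ℝ] ℝ × ℍ[ℝ], ∀ x, quot44 (T x) = τ (quot44 x) := by
  have hY' : ∀ k (x : ℍ[ℝ] × ℍ[ℝ]), T (x.1 * imUnit k, x.2 * imUnit k) =
      ((T x).1 * imUnit k, (T x).2 * imUnit k) := by
    intro k x
    have := hY k x
    rw [gen44_apply, gen44_apply, map_smul] at this
    exact smul_right_injective _ (by norm_num) this
  -- Commuting with right multiplications makes T a quaternionic 2 × 2 matrix acting from the left;
  -- being isometric, it is unitary.
  obtain ⟨a, b, c, e, habce⟩ : ∃ a b c e : ℍ[ℝ], ∀ z w, T (z, w) = (a * z + b * w, c * z + e * w) := by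
    have h1 : ∀ z, T (z, 0) = ((T (1, 0)).1 * z, (T (1, 0)).2 * z) := by
      intro z
      ext1
      · exact eq_mul_of_commute_mul_imUnit (t := LinearMap.fst ℝ _ _ ∘ₗ T ∘ₗ LinearMap.inl ℝ _ _)
          (fun k z => by simpa using congrArg Prod.fst (hY' k (z, 0))) z
      · exact eq_mul_of_commute_mul_imUnit (t := LinearMap.snd ℝ _ _ ∘ₗ T ∘ₗ LinearMap.inl ℝ _ _)
          (fun k z => by simpa using congrArg Prod.snd (hY' k (z, 0))) z
    have h2 : ∀ z, T (0, z) = ((T (0, 1)).1 * z, (T (0, 1)).2 * z) := by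
      intro z
      ext1
      · exact eq_mul_of_commute_mul_imUnit (t := LinearMap.fst ℝ _ _ ∘ₗ T ∘ₗ LinearMap.inr ℝ _ _)
          (fun k z => by simpa using congrArg Prod.fst (hY' k (0, z))) z
      · exact eq_mul_of_commute_mul_imUnit (t := LinearMap.snd ℝ _ _ ∘ₗ T ∘ₗ LinearMap.inr ℝ _ _)
          (fun k z => by simpa using congrArg Prod.snd (hY' k (0, z))) z
    refine ⟨(T (1, 0)).1, (T (0, 1)).1, (T (1, 0)).2, (T (0, 1)).2, fun z w => ?_⟩
    have : ((z, w) : ℍ[ℝ] × ℍ[ℝ]) = (z, 0) + (0, w) := by simp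
    rw [this, map_add, h1, h2]
    rfl
  have hac : ‖a‖ ^ 2 + ‖c‖ ^ 2 = 1 := by
    have := hT (1, 0) (1, 0)
    simpa only [habce, form44, mul_one, mul_zero, add_zero, zero_add, re_mul_star_self, norm_one,
      norm_zero, one_pow, ne_eq, OfNat.ofNat_ne_zero, not_false_eq_true, zero_pow] using this
  have hbe : ‖b‖ ^ 2 + ‖e‖ ^ 2 = 1 := by
    have := hT (0, 1) (0, 1)
    simpa only [habce, form44, mul_one, mul_zero, add_zero, zero_add, re_mul_star_self, norm_one,
      norm_zero, one_pow, ne_eq, OfNat.ofNat_ne_zero, not_false_eq_true, zero_pow] using this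
  have hort : star b * a + star e * c = 0 := by
    have key : ∀ z : ℍ[ℝ], (a * z * star b + c * z * star e).re = 0 := by
      intro z
      have := hT (z, 0) (0, 1)
      simpa [habce, form44] using this
    have key' : ∀ z : ℍ[ℝ], (z * (star b * a + star e * c)).re = 0 := by
      intro z
      have := key z
      simp only [mul_add, Quaternion.re_add, Quaternion.re_mul, Quaternion.imI_mul, Quaternion.imJ_mul,
        Quaternion.imK_mul, Quaternion.re_star, Quaternion.imI_star, Quaternion.imJ_star,
        Quaternion.imK_star] at this ⊢
      linear_combination this
    have := key' (star (star b * a + star e * c))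
    have h2 := re_mul_star_self (star (star b * a + star e * c))
    rw [star_star, norm_star] at h2
    exact norm_eq_zero.1 (pow_eq_zero_iff two_ne_zero |>.1 (h2.symm.trans this))
  have hnorm : ‖b‖ * ‖a‖ = ‖e‖ * ‖c‖ := by
    have := congrArg norm (eq_neg_of_add_eq_zero_left hort)
    simpa using this
  have hab : ‖a‖ ^ 2 + ‖b‖ ^ 2 = 1 := by
    have : ‖b‖ ^ 2 * ‖a‖ ^ 2 = ‖e‖ ^ 2 * ‖c‖ ^ 2 := by rw [← mul_pow, hnorm, mul_pow]
    have h1 : ‖e‖ ^ 2 = 1 - ‖b‖ ^ 2 := by linarith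
    have h2 : ‖c‖ ^ 2 = 1 - ‖a‖ ^ 2 := by linarith
    rw [h1, h2] at this
    linarith
  have hce : ‖c‖ ^ 2 + ‖e‖ ^ 2 = 1 := by linarith
  -- So far the columns are orthonormal; the rows are needed, because they make the terms in |z|²
  -- and |w|² combine into |z|² - |w|².
  have hrow : a * star c + b * star e = 0 := by
    by_cases hb : b = 0
    · have hc : c = 0 := by
        rw [hb, norm_zero] at hab hbe
        have : ‖c‖ ^ 2 = 0 := by linarith
        exact norm_eq_zero.1 (pow_eq_zero_iff two_ne_zero |>.1 this)
      simp [hb, hc]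
    · have hsb : star b ≠ 0 := by simpa using hb
      have hcc : c * star c = ((‖c‖ ^ 2 : ℝ) : ℍ[ℝ]) := by
        rw [Quaternion.self_mul_star, Quaternion.normSq_eq_norm_mul_self, sq]
      have hbb : star b * b = ((‖b‖ ^ 2 : ℝ) : ℍ[ℝ]) := by
        rw [Quaternion.star_mul_self, Quaternion.normSq_eq_norm_mul_self, sq]
      have : star b * (a * star c + b * star e) = 0 := by
        rw [mul_add, ← mul_assoc, ← mul_assoc, eq_neg_of_add_eq_zero_left hort, neg_mul, mul_assoc,
          hcc, hbb, Quaternion.coe_mul_eq_smul, Quaternion.mul_coe_eq_smul,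
          show ‖c‖ ^ 2 = ‖b‖ ^ 2 by linarith, neg_add_cancel]
      exact (mul_eq_zero.1 this).resolve_left hsb
  let τ : ℝ × ℍ[ℝ] →ₗ[ℝ] ℝ × ℍ[ℝ] :=
    { toFun := fun p => ((‖a‖ ^ 2 - ‖c‖ ^ 2) * p.1 + 2 * (a * p.2 * star b).re -
          2 * (c * p.2 * star e).re, p.1 • (a * star c) + a * p.2 * star e + b * star p.2 * star c)
      map_add' := fun p p' => by
        ext1
        · simp only [Prod.fst_add, Prod.snd_add, mul_add, add_mul, Quaternion.re_add]
          ring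
        · simp only [Prod.fst_add, Prod.snd_add, mul_add, add_mul, add_smul, star_add]
          abel
      map_smul' := fun r p => by
        ext1
        · simp only [Prod.smul_fst, Prod.smul_snd, mul_smul_comm, smul_mul_assoc,
            Quaternion.re_smul, smul_eq_mul, RingHom.id_apply]
          ring
        · simp only [Prod.smul_fst, Prod.smul_snd, mul_smul_comm, smul_mul_assoc,
            star_smul_quaternion, smul_eq_mul, RingHom.id_apply, smul_add, smul_smul] }
  refine ⟨τ, ?_⟩
  rintro ⟨z, w⟩
  rw [habce]
  have hzz : z * star z = ((‖z‖ ^ 2 : ℝ) : ℍ[ℝ]) := by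
    rw [Quaternion.self_mul_star, Quaternion.normSq_eq_norm_mul_self, sq]
  have hww : w * star w = ((‖w‖ ^ 2 : ℝ) : ℍ[ℝ]) := by
    rw [Quaternion.self_mul_star, Quaternion.normSq_eq_norm_mul_self, sq]
  have hexp : ∀ x y : ℍ[ℝ], ‖x * z + y * w‖ ^ 2 = ‖x‖ ^ 2 * ‖z‖ ^ 2 + ‖y‖ ^ 2 * ‖w‖ ^ 2 +
      2 * (x * (z * star w) * star y).re := by
    intro x y
    simp only [norm_sq_eq, Quaternion.re_add, Quaternion.imI_add, Quaternion.imJ_add,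
      Quaternion.imK_add, Quaternion.re_mul, Quaternion.imI_mul, Quaternion.imJ_mul,
      Quaternion.imK_mul, Quaternion.re_star, Quaternion.imI_star, Quaternion.imJ_star,
      Quaternion.imK_star]
    ring
  ext1
  · change ‖a * z + b * w‖ ^ 2 - ‖c * z + e * w‖ ^ 2 = (‖a‖ ^ 2 - ‖c‖ ^ 2) * (‖z‖ ^ 2 - ‖w‖ ^ 2) +
      2 * (a * (z * star w) * star b).re - 2 * (c * (z * star w) * star e).re
    rw [hexp, hexp]
    linear_combination ‖w‖ ^ 2 * (hab - hce)
  · change (a * z + b * w) * star (c * z + e * w) = (‖z‖ ^ 2 - ‖w‖ ^ 2) • (a * star c) +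
      a * (z * star w) * star e + b * star (z * star w) * star c
    have e1 : (a * z + b * w) * star (c * z + e * w) = a * (z * star z) * star c +
        a * (z * star w) * star e + b * star (z * star w) * star c + b * (w * star w) * star e := by
      simp only [star_add, star_mul, star_star]
      noncomm_ring
    rw [e1, hzz, hww, Quaternion.mul_coe_eq_smul, Quaternion.mul_coe_eq_smul, smul_mul_assoc,
      smul_mul_assoc, eq_neg_of_add_eq_zero_right hrow]
    module

variable {G : Type*} [TopologicalSpace G] [Group G] [IsTopologicalGroup G]
  {V : Type*} [NormedAddCommGroup V] [NormedSpace ℝ V] [FiniteDimensional ℝ V]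
  {ρ : G →* (V →L[ℝ] V)} {X : Fin 3 → V →L[ℝ] V} {B : LinearMap.BilinForm ℝ V}

namespace IsLinearModel

/-- The commutant of the generators contains the projection to a factor, diagonal left
multiplications and the swap. A map commuting with these is determined by its value at (1, 0): it is
right multiplication by one quaternion, of norm one by isometry. -/
theorem exists_act44 {e : V ≃ₗ[ℝ] fixedSubspace ρ × (ℍ[ℝ] × ℍ[ℝ])}
    (he : IsLinearModel ρ X B gen44 form44 e) (h : IsInfinitesimalModel ρ X B) {g : G}
    (hg : g ∈ idComponent G) : ∃ s, ∀ v, e (ρ g v) = ((e v).1, act44 s (e v).2) := by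
  obtain ⟨T, hT, hb, hC⟩ := he.exists_of_mem_idComponent h hg
  have hfst : (T (1, 0)).2 = 0 := by
    have := hC (LinearMap.inl ℝ _ _ ∘ₗ LinearMap.fst ℝ _ _) (fun k x => by simp [gen44_apply]) (1, 0)
    exact congrArg Prod.snd this
  have hleft : ∀ z, T (z, 0) = (z * (T (1, 0)).1, 0) := by
    intro z
    have := hC ((LinearMap.mulLeft ℝ z).prodMap (LinearMap.mulLeft ℝ z))
      (fun k x => by simp [gen44_apply, mul_assoc]) (1, 0)
    simpa [hfst] using this
  have hswap : ∀ z, T (0, z) = (0, z * (T (1, 0)).1) := by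
    intro z
    have := hC ((LinearMap.snd ℝ _ _).prod (LinearMap.fst ℝ _ _))
      (fun k x => by simp [gen44_apply]) (z, 0)
    rw [hleft] at this
    exact this
  have hn : ‖(T (1, 0)).1‖ = 1 := by
    have := hb (1, 0) (1, 0)
    simp only [form44, hfst, re_mul_star_self, norm_zero, norm_one, one_pow, add_zero, ne_eq,
      OfNat.ofNat_ne_zero, not_false_eq_true, zero_pow] at this
    exact (pow_eq_one_iff_of_nonneg (norm_nonneg _) two_ne_zero).1 this
  refine ⟨⟨star (T (1, 0)).1, by rw [norm_star, hn]⟩, fun v => ?_⟩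
  rw [hT, act44]
  simp only [inv_eq_star_of_norm_eq_one (h := star (T (1, 0)).1) (by rw [norm_star, hn]), star_star]
  congr 1
  have : (e v).2 = ((e v).2.1, 0) + (0, (e v).2.2) := by simp
  conv_lhs => rw [this]
  rw [map_add, hleft, hswap]
  simp

theorem exists_rep_eq_act44 {e : V ≃ₗ[ℝ] fixedSubspace ρ × (ℍ[ℝ] × ℍ[ℝ])}
    (he : IsLinearModel ρ X B gen44 form44 e) (h : IsInfinitesimalModel ρ X B) (s : UnitQuaternion) :
    ∃ g ∈ idComponent G, ∀ v, e (ρ g v) = ((e v).1, act44 s (e v).2) := by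
  obtain ⟨t, c, hc, hs⟩ := exists_eq_circleQuat s.2
  set u := ∑ k, c k • imUnit k with hu
  have huu : (-u) * (-u) = -1 := by rw [neg_mul_neg]; exact sum_smul_imUnit_mul_self hc
  -- The factor 2 cancels the 1/2 in the generators; the inverse of a point on the circle of u lies
  -- on the circle of -u.
  obtain ⟨g, hg, hgv⟩ := he.exists_of_flow h (fun k => 2 * c k)
    (fun t z => (z.1 * circleQuat (-u) t, z.2 * circleQuat (-u) t))
    (fun z => by simp [circleQuat_zero]) (fun z t => by
      have := hasDerivAt_circleQuat huu t
      refine ((this.const_mul z.1).prodMk (this.const_mul z.2)).congr_deriv ?_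
      have e1 : ∀ k (w : ℍ[ℝ] × ℍ[ℝ]), (2 * c k) • gen44 k w =
          (-(w.1 * (c k • imUnit k)), -(w.2 * (c k • imUnit k))) := by
        intro k w
        rw [gen44_apply, smul_smul, mul_smul_comm, mul_smul_comm, ← neg_smul, ← neg_smul]
        rw [show 2 * c k * -(1 / 2) = - c k by ring]
        rfl
      simp only [e1]
      ext1
      · simp only [Prod.fst_sum, Finset.sum_neg_distrib, ← Finset.mul_sum, ← hu]
        rw [mul_neg, mul_neg, mul_assoc]
      · simp only [Prod.snd_sum, Finset.sum_neg_distrib, ← Finset.mul_sum, ← hu]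
        rw [mul_neg, mul_neg, mul_assoc]) t
  refine ⟨g, hg, fun v => ?_⟩
  rw [hgv, act44, inv_eq_star_of_norm_eq_one s.2, hs, star_circleQuat (star_sum_smul_imUnit c)]

theorem exists_homeomorph44 {e : V ≃ₗ[ℝ] fixedSubspace ρ × (ℍ[ℝ] × ℍ[ℝ])}
    (he : IsLinearModel ρ X B gen44 form44 e) (h : IsInfinitesimalModel ρ X B) :
    ∃ (m : ℕ) (φ : OrbitSpace ρ ≃ₜ EuclideanSpace ℝ (Fin m))
      (σ : Representation ℝ (G ⧸ idComponent G) (EuclideanSpace ℝ (Fin m))),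
      ContDiff ℝ ∞ (fun v : V => φ (toOrbit ρ v)) ∧
      (∀ (g : G) (v : V), φ (toOrbit ρ (ρ g v)) =
        σ (g : G ⧸ idComponent G) (φ (toOrbit ρ v))) ∧
      HasExplicitQuotientMap ρ φ act44 quot44 :=
  he.exists_homeomorph h (fun _ hg => he.exists_act44 h hg) (he.exists_rep_eq_act44 h)
    quot44_eq_iff quot44_surjective two_ne_zero two_ne_zero quot44_smul
    (fun j l => (LinearMap.toContinuousLinearMap l).contDiff.comp
      (contDiff_quot44.comp (LinearMap.toContinuousLinearMap j).contDiff))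
    (fun _ hT hY => exists_quot44_comp_eq hT hY)

end IsLinearModel

end Model44

/-! ### The model ℍ ⊕ ℍ₀. -/

section Model43

/-- The commutator with `u` on imaginary quaternions. -/
def imComm (u : ℍ[ℝ]) : pureIm →ₗ[ℝ] pureIm where
  toFun x := ⟨u * x - x * u, by
    change (u * x - x * u : ℍ[ℝ]).re = 0
    simp only [Quaternion.re_sub, Quaternion.re_mul]
    ring⟩
  map_add' x y := Subtype.ext (by
    simp only [Submodule.coe_add, mul_add, add_mul]
    abel)
  map_smul' r x := Subtype.ext (by
    simp only [Submodule.coe_smul, mul_smul_comm, smul_mul_assoc, smul_sub, RingHom.id_apply])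

theorem coe_imComm (u : ℍ[ℝ]) (x : pureIm) : (imComm u x : ℍ[ℝ]) = u * x - x * u := rfl

/-- The projection onto the imaginary quaternions. -/
def imProj : ℍ[ℝ] →ₗ[ℝ] pureIm where
  toFun z := ⟨z - (z.re : ℍ[ℝ]), by
    change (z - (z.re : ℍ[ℝ])).re = 0
    simp⟩
  map_add' x y := Subtype.ext (by ext <;> simp)
  map_smul' r x := Subtype.ext (by ext <;> simp)

theorem imProj_coe (x : pureIm) : imProj x = x := by
  have hx : (x : ℍ[ℝ]).re = 0 := x.2
  apply Subtype.ext
  change (x : ℍ[ℝ]) - ((x : ℍ[ℝ]).re : ℍ[ℝ]) = x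
  rw [hx]
  simp

/-- The linear map `x ↦ z x z̄`. -/
def twistLinear (z : ℍ[ℝ]) : pureIm →ₗ[ℝ] pureIm where
  toFun := twist z
  map_add' x y := Subtype.ext (by
    simp only [coe_twist, Submodule.coe_add, mul_add, add_mul])
  map_smul' r x := Subtype.ext (by
    simp only [coe_twist, Submodule.coe_smul, mul_smul_comm, smul_mul_assoc, RingHom.id_apply])

theorem twistLinear_apply (z : ℍ[ℝ]) (x : pureIm) : twistLinear z x = twist z x := rfl

/-- The generators acting on `ℍ ⊕ ℍ₀`. -/
def gen43 (k : Fin 3) : ℍ[ℝ] × pureIm →ₗ[ℝ] ℍ[ℝ] × pureIm :=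
  ((-(1 / 2 : ℝ)) • LinearMap.mulRight ℝ (imUnit k)).prodMap ((1 / 2 : ℝ) • imComm (imUnit k))

theorem gen43_apply (k : Fin 3) (p : ℍ[ℝ] × pureIm) :
    gen43 k p = ((-(1 / 2 : ℝ)) • (p.1 * imUnit k), (1 / 2 : ℝ) • imComm (imUnit k) p.2) := rfl

/-- The Euclidean inner product on `ℍ ⊕ ℍ₀`. -/
def form43 (p p' : ℍ[ℝ] × pureIm) : ℝ :=
  (p.1 * star p'.1).re + ((p.2 : ℍ[ℝ]) * star (p'.2 : ℍ[ℝ])).re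

theorem quot43_smul (t : ℝ) (p : ℍ[ℝ] × pureIm) :
    quot43 (t • p) = (t ^ 2 • (quot43 p).1, t ^ 3 • (quot43 p).2) := by
  simp only [quot43]
  ext1
  · simp only [Prod.smul_fst, Prod.smul_snd, Submodule.coe_smul, norm_smul, mul_pow,
      Real.norm_eq_abs, sq_abs, smul_eq_mul, mul_sub]
  · apply Subtype.ext
    simp only [Prod.smul_fst, Prod.smul_snd, coe_twist, Submodule.coe_smul, star_smul_quaternion,
      smul_mul_smul_comm]
    congr 1
    ring

theorem contDiff_mul_mul_star : ContDiff ℝ ∞ fun p : ℍ[ℝ] × pureIm => p.1 * p.2 * star p.1 :=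
  (contDiff_fst.mul (pureIm.subtypeL.contDiff.comp contDiff_snd)).mul
    (contDiff_star_quaternion.comp contDiff_fst)

theorem contDiff_quot43 : ContDiff ℝ ∞ quot43 := by
  refine ((contDiff_fst.norm_sq ℝ).sub
    ((pureIm.subtypeL.contDiff.comp contDiff_snd).norm_sq ℝ)).prodMk ?_
  have h1 : (fun p : ℍ[ℝ] × pureIm => twist p.1 p.2) = fun p => imProj (p.1 * p.2 * star p.1) := by
    funext p
    exact (imProj_coe _).symm
  rw [h1]
  exact (LinearMap.toContinuousLinearMap imProj).contDiff.comp contDiff_mul_mul_star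

theorem twist_circleQuat {u : ℍ[ℝ]} (hus : star u = -u) (t : ℝ) (x : pureIm) :
    twist (circleQuat u t) x = (Real.cos t * Real.cos t) • x +
      (Real.cos t * Real.sin t) • imComm u x + (Real.sin t * Real.sin t) • twist u x := by
  apply Subtype.ext
  simp only [coe_twist, Submodule.coe_add, Submodule.coe_smul, coe_imComm, star_circleQuat hus, hus]
  simp only [circleQuat, add_mul, mul_add, smul_mul_assoc, mul_smul_comm, smul_smul, smul_sub,
    mul_neg, smul_neg, one_mul, mul_one, smul_add]
  module

theorem hasDerivAt_twist_circleQuat {u : ℍ[ℝ]} (hu : u * u = -1) (hus : star u = -u) (x : pureIm)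
    (t : ℝ) : HasDerivAt (fun t => twist (circleQuat u t) x)
      (imComm u (twist (circleQuat u t) x)) t := by
  have e1 : imComm u (imComm u x) = -(2 : ℝ) • x + (2 : ℝ) • twist u x := by
    apply Subtype.ext
    simp only [coe_twist, Submodule.coe_add, Submodule.coe_smul, coe_imComm, hus, mul_sub, sub_mul,
      ← mul_assoc, hu]
    simp only [mul_assoc, hu]
    simp only [neg_mul, one_mul, mul_neg, mul_one]
    module
  have e2 : imComm u (twist u x) = - imComm u x := by
    apply Subtype.ext
    simp only [coe_twist, Submodule.coe_neg, coe_imComm, hus, ← mul_assoc, hu]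
    simp only [mul_assoc, mul_neg, neg_mul, hu, one_mul, mul_one]
    abel
  simp only [twist_circleQuat hus, map_add, map_smul, e1, e2]
  have hc := Real.hasDerivAt_cos t
  have hs := Real.hasDerivAt_sin t
  refine ((((hc.mul hc).smul_const x).add ((hc.mul hs).smul_const (imComm u x))).add
    ((hs.mul hs).smul_const (twist u x))).congr_deriv ?_
  module

/-- The flow on `ℍ ⊕ ℍ₀` generated by `u`. -/
theorem hasDerivAt_flow43 {u : ℍ[ℝ]} (hu : u * u = -1) (hus : star u = -u) (p : ℍ[ℝ] × pureIm)
    (t : ℝ) : HasDerivAt (fun t => (p.1 * circleQuat (-u) t, twist (circleQuat u t) p.2))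
      (-(p.1 * circleQuat (-u) t * u), imComm u (twist (circleQuat u t) p.2)) t := by
  have h1 := (hasDerivAt_circleQuat (u := -u) (by rw [neg_mul_neg, hu]) t).const_mul p.1
  refine (h1.prodMk (hasDerivAt_twist_circleQuat hu hus p.2 t)).congr_deriv ?_
  rw [mul_neg, mul_neg, mul_assoc]

theorem star_imUnit (k : Fin 3) : star (imUnit k) = -imUnit k := by
  fin_cases k <;> ext <;> simp

theorem imUnit_mul_self (k : Fin 3) : imUnit k * imUnit k = -1 := by
  fin_cases k <;> ext <;> simp

/-- The quaternions `i`, `j`, `k` in the space of imaginary quaternions. -/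
def imVec (k : Fin 3) : pureIm := ⟨imUnit k, by fin_cases k <;> rfl⟩

theorem coe_imVec (k : Fin 3) : (imVec k : ℍ[ℝ]) = imUnit k := rfl

theorem eq_sum_smul_imVec (x : pureIm) : x = (x : ℍ[ℝ]).imI • imVec 0 + (x : ℍ[ℝ]).imJ • imVec 1 +
    (x : ℍ[ℝ]).imK • imVec 2 := by
  have hx : (x : ℍ[ℝ]).re = 0 := x.2
  apply Subtype.ext
  simp only [Submodule.coe_add, Submodule.coe_smul, coe_imVec]
  ext <;> simp [hx]

/-- Linear maps commuting with the commutators are scalar. -/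
theorem exists_eq_smul_of_commute_imComm {t : pureIm →ₗ[ℝ] pureIm}
    (ht : ∀ k x, t (imComm (imUnit k) x) = imComm (imUnit k) (t x)) :
    ∃ r : ℝ, ∀ x, t x = r • x := by
  -- An imaginary quaternion commuting with i is a multiple of i; brackets then carry the same
  -- scalar to j and k.
  have h0 : imComm (imUnit 0) (t (imVec 0)) = 0 := by
    rw [← ht]
    have : imComm (imUnit 0) (imVec 0) = 0 := Subtype.ext (by simp [coe_imComm, coe_imVec])
    rw [this, map_zero]
  set r := (t (imVec 0) : ℍ[ℝ]).imI with hr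
  have h0' := congrArg Subtype.val h0
  rw [coe_imComm] at h0'
  have hJ := congrArg QuaternionAlgebra.imK h0'
  have hK := congrArg QuaternionAlgebra.imJ h0'
  have hR : (t (imVec 0) : ℍ[ℝ]).re = 0 := (t (imVec 0)).2
  simp at hJ hK
  have e0 : t (imVec 0) = r • imVec 0 := by
    apply Subtype.ext
    rw [Submodule.coe_smul, coe_imVec]
    ext <;> simp [hR] <;> linarith
  have c1 : imVec 1 = (1 / 2 : ℝ) • imComm (imUnit 2) (imVec 0) := by
    apply Subtype.ext
    rw [Submodule.coe_smul, coe_imVec, coe_imComm, coe_imVec]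
    ext <;> simp; norm_num
  have c2 : imVec 2 = (1 / 2 : ℝ) • imComm (imUnit 0) (imVec 1) := by
    apply Subtype.ext
    rw [Submodule.coe_smul, coe_imVec, coe_imComm, coe_imVec]
    ext <;> simp; norm_num
  have e1 : t (imVec 1) = r • imVec 1 := by
    rw [c1, map_smul, ht, e0, map_smul, smul_comm]
  have e2 : t (imVec 2) = r • imVec 2 := by
    rw [c2, map_smul, ht, e1, map_smul, smul_comm]
  refine ⟨r, fun x => ?_⟩
  rw [eq_sum_smul_imVec x]
  simp only [map_add, map_smul, e0, e1, e2, smul_add, smul_comm r]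

/-- The Casimir operator has different eigenvalues on the two summands, so maps commuting with the
generators preserve both. -/
theorem sum_gen43_gen43 (p : ℍ[ℝ] × pureIm) :
    ∑ k, gen43 k (gen43 k p) = (-(3 / 4 : ℝ) • p.1, -(2 : ℝ) • p.2) := by
  have hx : (p.2 : ℍ[ℝ]).re = 0 := p.2.2
  simp only [gen43_apply, Fin.sum_univ_three]
  ext1
  · ext <;> simp <;> ring
  · apply Subtype.ext
    simp only [Prod.snd_add, map_smul, Submodule.coe_add, Submodule.coe_smul, coe_imComm]
    ext <;> simp [hx] <;> ring

/-- An isometry commuting with the generators induces a linear map of the quotient. -/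
theorem exists_quot43_comp_eq {T : ℍ[ℝ] × pureIm →ₗ[ℝ] ℍ[ℝ] × pureIm}
    (hT : ∀ x y, form43 (T x) (T y) = form43 x y) (hY : ∀ k x, T (gen43 k x) = gen43 k (T x)) :
    ∃ τ : ℝ × pureIm →ₗ[ℝ] ℝ × pureIm, ∀ x, quot43 (T x) = τ (quot43 x) := by
  have hcas : ∀ p, T (-(3 / 4 : ℝ) • p.1, -(2 : ℝ) • p.2) =
      (-(3 / 4 : ℝ) • (T p).1, -(2 : ℝ) • (T p).2) := by
    intro p
    rw [← sum_gen43_gen43, ← sum_gen43_gen43, map_sum]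
    simp only [hY]
  have h1 : ∀ z, (T (z, 0)).2 = 0 := by
    intro z
    have h := hcas (z, 0)
    have e : ((-(3 / 4 : ℝ) • z, -(2 : ℝ) • 0) : ℍ[ℝ] × pureIm) = -(3 / 4 : ℝ) • (z, 0) := by simp
    rw [e, map_smul] at h
    have h2 := congrArg Prod.snd h
    simp only [Prod.smul_snd] at h2
    have h3 := congrArg Subtype.val h2
    simp only [Submodule.coe_smul] at h3
    have h4 : (-(3 / 4) - -2 : ℝ) • ((T (z, 0)).2 : ℍ[ℝ]) = 0 := by rw [sub_smul, h3, sub_self]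
    exact Subtype.ext ((smul_eq_zero.1 h4).resolve_left (by norm_num))
  have h2 : ∀ x, (T (0, x)).1 = 0 := by
    intro x
    have h := hcas (0, x)
    have e : ((-(3 / 4 : ℝ) • 0, -(2 : ℝ) • x) : ℍ[ℝ] × pureIm) = -(2 : ℝ) • (0, x) := by simp
    rw [e, map_smul] at h
    have h2 := congrArg Prod.fst h
    simp only [Prod.smul_fst] at h2
    have h3 : (-(3 / 4) - -2 : ℝ) • (T (0, x)).1 = 0 := by rw [sub_smul, h2, sub_self]
    exact (smul_eq_zero.1 h3).resolve_left (by norm_num)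
  set a := (T (1, 0)).1 with ha
  have hl : ∀ z, T (z, 0) = (a * z, 0) := by
    intro z
    refine Prod.ext ?_ (h1 z)
    refine eq_mul_of_commute_mul_imUnit (t := LinearMap.fst ℝ _ _ ∘ₗ T ∘ₗ LinearMap.inl ℝ _ _)
      (fun k z => ?_) z
    have := congrArg Prod.fst (hY k (z, 0))
    rw [gen43_apply, gen43_apply] at this
    have e : (((-(1 / 2 : ℝ)) • (z * imUnit k), (1 / 2 : ℝ) • imComm (imUnit k) 0) : ℍ[ℝ] × pureIm) =
        (-(1 / 2 : ℝ)) • (z * imUnit k, 0) := by simp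
    rw [e, map_smul] at this
    exact smul_right_injective _ (by norm_num) this
  obtain ⟨r, hr⟩ := exists_eq_smul_of_commute_imComm
    (t := LinearMap.snd ℝ _ _ ∘ₗ T ∘ₗ LinearMap.inr ℝ _ _) (by
      intro k x
      have := congrArg Prod.snd (hY k (0, x))
      rw [gen43_apply, gen43_apply] at this
      have e : (((-(1 / 2 : ℝ)) • (0 * imUnit k), (1 / 2 : ℝ) • imComm (imUnit k) x) :
          ℍ[ℝ] × pureIm) = (1 / 2 : ℝ) • (0, imComm (imUnit k) x) := by simp
      rw [e, map_smul] at this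
      exact smul_right_injective _ (by norm_num) this)
  have hrx : ∀ x, T (0, x) = (0, r • x) := fun x => Prod.ext (h2 x) (hr x)
  have hTp : ∀ p, T p = (a * p.1, r • p.2) := by
    intro p
    have : p = (p.1, 0) + (0, p.2) := by simp
    conv_lhs => rw [this]
    rw [map_add, hl, hrx]
    simp
  -- On ℍ the map is left multiplication by a, on ℍ₀ the scalar r; isometry makes a unit and r = ±1,
  -- so the norms in q are unchanged and the twisted product changes by r times the twist by a.
  have ha1 : ‖a‖ ^ 2 = 1 := by
    have := hT (1, 0) (1, 0)
    simpa only [hTp, form43, mul_one, smul_zero, Submodule.coe_zero, re_mul_star_self, norm_one,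
      norm_zero, one_pow, ne_eq, OfNat.ofNat_ne_zero, not_false_eq_true, zero_pow, add_zero] using this
  have hr1 : r ^ 2 = 1 := by
    have := hT (0, imVec 0) (0, imVec 0)
    simp only [hTp, form43, mul_zero, Submodule.coe_smul, coe_imVec, re_mul_star_self, norm_smul,
      norm_zero, ne_eq, OfNat.ofNat_ne_zero, not_false_eq_true, zero_pow, zero_add, mul_pow,
      Real.norm_eq_abs, sq_abs, norm_sq_eq (imUnit 0)] at this
    simpa using this
  refine ⟨LinearMap.id.prodMap (r • twistLinear a), fun p => ?_⟩
  rw [hTp]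
  ext1
  · simp [quot43, norm_smul, mul_pow, ha1, hr1]
  · apply Subtype.ext
    simp only [quot43, LinearMap.prodMap_apply, LinearMap.smul_apply, twistLinear_apply, twist_twist]
    simp only [coe_twist, Submodule.coe_smul, mul_smul_comm, smul_mul_assoc]

variable {G : Type*} [TopologicalSpace G] [Group G] [IsTopologicalGroup G]
  {V : Type*} [NormedAddCommGroup V] [NormedSpace ℝ V] [FiniteDimensional ℝ V]
  {ρ : G →* (V →L[ℝ] V)} {X : Fin 3 → V →L[ℝ] V} {B : LinearMap.BilinForm ℝ V}

namespace IsLinearModel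

/-- The flow of a generator is (z, x) ↦ (z c̄, c x c̄) with c on a circle of unit quaternions, and
c̄c = 1 cancels. This invariant ties the action on ℍ₀ to that on ℍ. -/
theorem mul_mul_star_eq {e : V ≃ₗ[ℝ] fixedSubspace ρ × (ℍ[ℝ] × pureIm)}
    (he : IsLinearModel ρ X B gen43 form43 e) (h : IsInfinitesimalModel ρ X B) {g : G}
    (hg : g ∈ idComponent G) (v : V) : (e (ρ g v)).2.1 * (e (ρ g v)).2.2 * star (e (ρ g v)).2.1 =
      (e v).2.1 * (e v).2.2 * star (e v).2.1 := by
  refine he.apply_eq_of_flow h (fun p => p.1 * p.2 * star p.1)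
    (contDiff_mul_mul_star.differentiable (by simp))
    (fun k t p => (p.1 * circleQuat (-imUnit k) t, twist (circleQuat (imUnit k) t) p.2)) ?_
    (two_ne_zero (α := ℝ)) ?_ ?_ hg v
  · intro k p
    simp [circleQuat_zero, twist_one]
  · intro k p
    refine (hasDerivAt_flow43 (imUnit_mul_self k) (star_imUnit k) p 0).congr_deriv ?_
    rw [gen43_apply, circleQuat_zero, circleQuat_zero, twist_one, mul_one]
    ext1
    · change _ = (2 : ℝ) • (-(1 / 2 : ℝ)) • (p.1 * imUnit k)
      rw [smul_smul]; norm_num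
    · change _ = (2 : ℝ) • (1 / 2 : ℝ) • imComm (imUnit k) p.2
      rw [smul_smul]; norm_num
  · intro k t p
    simp only [coe_twist, ← star_circleQuat (star_imUnit k), star_mul, star_star]
    set c := circleQuat (imUnit k) t
    have hc : star c * c = 1 := by
      apply star_mul_self_of_norm_eq_one
      have h1 : ‖c‖ ^ 2 = 1 := by
        rw [norm_sq_eq]
        simp only [c, circleQuat]
        fin_cases k <;> simp
      exact (pow_eq_one_iff_of_nonneg (norm_nonneg _) two_ne_zero).1 h1
    calc _ = p.1 * (star c * c) * p.2 * (star c * c) * star p.1 := by noncomm_ring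
      _ = _ := by rw [hc, mul_one, mul_one]

/-- As for ℍ ⊕ ℍ, the action on ℍ is right multiplication by a unit β. At z = 1 the invariant z x z̄
says that β x' β̄ = x for the image x' of x, so x' = β̄ x β. -/
theorem exists_act43 {e : V ≃ₗ[ℝ] fixedSubspace ρ × (ℍ[ℝ] × pureIm)}
    (he : IsLinearModel ρ X B gen43 form43 e) (h : IsInfinitesimalModel ρ X B) {g : G}
    (hg : g ∈ idComponent G) : ∃ s, ∀ v, e (ρ g v) = ((e v).1, act43 s (e v).2) := by
  obtain ⟨T, hT, hb, hC⟩ := he.exists_of_mem_idComponent h hg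
  have hfst : ∀ z, (T (z, 0)).2 = 0 := fun z => by
    have := hC (LinearMap.inl ℝ _ _ ∘ₗ LinearMap.fst ℝ _ _) (fun k x => by simp [gen43_apply]) (z, 0)
    exact congrArg Prod.snd this
  have hsnd : ∀ x, (T (0, x)).1 = 0 := fun x => by
    have := hC (LinearMap.inr ℝ _ _ ∘ₗ LinearMap.snd ℝ _ _) (fun k x => by simp [gen43_apply]) (0, x)
    exact congrArg Prod.fst this
  set β := (T (1, 0)).1 with hβ
  have hleft : ∀ z, T (z, 0) = (z * β, 0) := by
    intro z
    have := hC ((LinearMap.mulLeft ℝ z).prodMap LinearMap.id)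
      (fun k x => by simp [gen43_apply, mul_assoc]) (1, 0)
    simpa [hfst] using this
  have hn : ‖β‖ = 1 := by
    have := hb (1, 0) (1, 0)
    simp only [form43, hfst, re_mul_star_self, Submodule.coe_zero, norm_zero, norm_one, one_pow,
      add_zero, ne_eq, OfNat.ofNat_ne_zero, not_false_eq_true, zero_pow] at this
    exact (pow_eq_one_iff_of_nonneg (norm_nonneg _) two_ne_zero).1 this
  have hβ1 := star_mul_self_of_norm_eq_one hn
  have hx : ∀ x, T (0, x) = (0, twist (star β) x) := by
    intro x
    refine Prod.ext (hsnd x) ?_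
    have h1 := he.mul_mul_star_eq h hg (e.symm (0, (1, x)))
    have h2 : T (1, x) = (β, (T (0, x)).2) := by
      have : ((1, x) : ℍ[ℝ] × pureIm) = (1, 0) + (0, x) := by simp
      rw [this, map_add, hleft, ← Prod.mk.eta (p := T (0, x)), hsnd]
      simp
    rw [hT, LinearEquiv.apply_symm_apply] at h1
    simp only [h2, one_mul, star_one, mul_one] at h1
    apply Subtype.ext
    rw [coe_twist, star_star, ← h1]
    calc ((T (0, x)).2 : ℍ[ℝ]) = (star β * β) * (T (0, x)).2 * (star β * β) := by
          rw [hβ1, one_mul, mul_one]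
      _ = _ := by noncomm_ring
  refine ⟨⟨star β, by rw [norm_star, hn]⟩, fun v => ?_⟩
  rw [hT, act43]
  simp only [inv_eq_star_of_norm_eq_one (h := star β) (by rw [norm_star, hn]), star_star]
  congr 1
  have : (e v).2 = ((e v).2.1, 0) + (0, (e v).2.2) := by simp
  conv_lhs => rw [this]
  rw [map_add, hleft, hx]
  simp

theorem exists_rep_eq_act43 {e : V ≃ₗ[ℝ] fixedSubspace ρ × (ℍ[ℝ] × pureIm)}
    (he : IsLinearModel ρ X B gen43 form43 e) (h : IsInfinitesimalModel ρ X B) (s : UnitQuaternion) :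
    ∃ g ∈ idComponent G, ∀ v, e (ρ g v) = ((e v).1, act43 s (e v).2) := by
  obtain ⟨t, c, hc, hs⟩ := exists_eq_circleQuat s.2
  have hsum : ∀ z : pureIm, ∑ k, c k • imComm (imUnit k) z = imComm (∑ k, c k • imUnit k) z := by
    intro z
    apply Subtype.ext
    simp only [Fin.sum_univ_three, Submodule.coe_add, Submodule.coe_smul, coe_imComm, add_mul,
      mul_add, smul_mul_assoc, mul_smul_comm]
    module
  have hu := sum_smul_imUnit_mul_self hc
  have hus := star_sum_smul_imUnit c
  set u := ∑ k, c k • imUnit k with hudef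
  obtain ⟨g, hg, hgv⟩ := he.exists_of_flow h (fun k => 2 * c k)
    (fun t p => (p.1 * circleQuat (-u) t, twist (circleQuat u t) p.2))
    (fun z => by simp [circleQuat_zero, twist_one]) (fun p t => by
      refine (hasDerivAt_flow43 hu hus p t).congr_deriv ?_
      have e1 : ∀ k (w : ℍ[ℝ] × pureIm), (2 * c k) • gen43 k w =
          (-(w.1 * (c k • imUnit k)), c k • imComm (imUnit k) w.2) := by
        intro k w
        rw [gen43_apply]
        ext1
        · simp only [Prod.smul_fst, mul_smul_comm, smul_smul]
          rw [← neg_smul]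
          congr 1
          ring
        · simp only [Prod.smul_snd, smul_smul]
          congr 1
          ring
      simp only [e1]
      ext1
      · simp only [Prod.fst_sum, Finset.sum_neg_distrib, ← Finset.mul_sum, ← hudef]
      · simp only [Prod.snd_sum, hsum]) t
  refine ⟨g, hg, fun v => ?_⟩
  rw [hgv, act43, inv_eq_star_of_norm_eq_one s.2, hs, star_circleQuat hus]

theorem exists_homeomorph43 {e : V ≃ₗ[ℝ] fixedSubspace ρ × (ℍ[ℝ] × pureIm)}
    (he : IsLinearModel ρ X B gen43 form43 e) (h : IsInfinitesimalModel ρ X B) :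
    ∃ (m : ℕ) (φ : OrbitSpace ρ ≃ₜ EuclideanSpace ℝ (Fin m))
      (σ : Representation ℝ (G ⧸ idComponent G) (EuclideanSpace ℝ (Fin m))),
      ContDiff ℝ ∞ (fun v : V => φ (toOrbit ρ v)) ∧
      (∀ (g : G) (v : V), φ (toOrbit ρ (ρ g v)) =
        σ (g : G ⧸ idComponent G) (φ (toOrbit ρ v))) ∧
      HasExplicitQuotientMap ρ φ act43 quot43 :=
  he.exists_homeomorph h (fun _ hg => he.exists_act43 h hg) (he.exists_rep_eq_act43 h)
    quot43_eq_iff quot43_surjective two_ne_zero three_ne_zero quot43_smul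
    (fun j l => (LinearMap.toContinuousLinearMap l).contDiff.comp
      (contDiff_quot43.comp (LinearMap.toContinuousLinearMap j).contDiff))
    (fun _ hT hY => exists_quot43_comp_eq hT hY)

end IsLinearModel

end Model43

/-! ### The model of 3 × 3 matrices. -/

section Model333

open Matrix

attribute [local instance] Matrix.normedAddCommGroup Matrix.normedSpace

/-- The matrices of the right actions of the generators on row vectors. -/
def rotGen (k : Fin 3) : Matrix (Fin 3) (Fin 3) ℝ :=
  ![!![0, 0, 0; 0, 0, 1; 0, -1, 0], !![0, 0, -1; 0, 0, 0; 1, 0, 0],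
    !![0, 1, 0; -1, 0, 0; 0, 0, 0]] k

/-- The generators acting on `3 × 3` matrices. -/
def gen333 (k : Fin 3) : Matrix (Fin 3) (Fin 3) ℝ →ₗ[ℝ] Matrix (Fin 3) (Fin 3) ℝ :=
  LinearMap.mulRight ℝ (rotGen k)

theorem gen333_apply (k : Fin 3) (A : Matrix (Fin 3) (Fin 3) ℝ) : gen333 k A = A * rotGen k := rfl

/-- The Euclidean inner product on `3 × 3` matrices. -/
def form333 (A B : Matrix (Fin 3) (Fin 3) ℝ) : ℝ := (A * Bᵀ).trace

/-- The rotations generated by `rotGen k`. -/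
def rotFlow (k : Fin 3) (t : ℝ) : Matrix (Fin 3) (Fin 3) ℝ :=
  1 + Real.sin t • rotGen k + (1 - Real.cos t) • (rotGen k * rotGen k)

/-- This identity is what makes Rodrigues' formula in `rotFlow` solve R' = RN. -/
theorem rotGen_pow_three (k : Fin 3) : rotGen k * rotGen k * rotGen k = -rotGen k := by
  fin_cases k <;> ext i j <;> fin_cases i <;> fin_cases j <;>
    simp [rotGen, Matrix.mul_apply, Fin.sum_univ_three]

theorem rotFlow_zero (k : Fin 3) : rotFlow k 0 = 1 := by simp [rotFlow]

theorem det_rotFlow (k : Fin 3) (t : ℝ) : (rotFlow k t).det = 1 := by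
  have := Real.cos_sq_add_sin_sq t
  fin_cases k <;> rw [det_fin_three] <;>
    simp [rotFlow, rotGen] <;> linarith

theorem rotFlow_zero_eq (t : ℝ) : rotFlow 0 t = (rotX t)ᵀ := by
  ext i j
  fin_cases i <;> fin_cases j <;>
    simp [rotFlow, rotGen, rotX]

theorem rotFlow_two_eq (t : ℝ) : rotFlow 2 t = (rotZ t)ᵀ := by
  ext i j
  fin_cases i <;> fin_cases j <;>
    simp [rotFlow, rotGen, rotZ]

theorem hasDerivAt_mul_rotFlow (k : Fin 3) (A : Matrix (Fin 3) (Fin 3) ℝ) (t : ℝ) :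
    HasDerivAt (fun t => A * rotFlow k t) (gen333 k (A * rotFlow k t)) t := by
  have h0 : ∀ t, A * rotFlow k t = A + Real.sin t • (A * rotGen k) +
      (1 - Real.cos t) • (A * (rotGen k * rotGen k)) := by
    intro t
    simp only [rotFlow, mul_add, mul_one, mul_smul_comm]
  rw [gen333_apply]
  simp only [h0]
  refine ((((Real.hasDerivAt_sin t).smul_const (A * rotGen k)).const_add A).add
    (((Real.hasDerivAt_cos t).const_sub 1).smul_const
      (A * (rotGen k * rotGen k)))).congr_deriv ?_
  have h3 : A * (rotGen k * rotGen k) * rotGen k = -(A * rotGen k) := by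
    rw [mul_assoc, rotGen_pow_three, mul_neg]
  rw [add_mul, add_mul, smul_mul_assoc, smul_mul_assoc, h3, mul_assoc]
  module

/-- Testing on A = D - 1 shows that the Euclidean norm of D - 1 is zero. -/
theorem eq_one_of_trace_mul {D : Matrix (Fin 3) (Fin 3) ℝ} (hD : Dᵀ = D)
    (h : ∀ A : Matrix (Fin 3) (Fin 3) ℝ, (A * D).trace = A.trace) : D = 1 := by
  have h1 := h (D - 1)
  have h2 : ((D - 1) * (D - 1)ᵀ).trace = 0 := by
    rw [transpose_sub, hD, transpose_one, mul_sub, mul_one, trace_sub, h1, sub_self]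
  rw [← conjTranspose_eq_transpose_of_trivial, trace_mul_conjTranspose_self_eq_zero_iff] at h2
  exact sub_eq_zero.1 h2

/-- The coordinate functions on matrices. -/
def entryCLM (i j : Fin 3) : Matrix (Fin 3) (Fin 3) ℝ →L[ℝ] ℝ :=
  LinearMap.toContinuousLinearMap (Matrix.entryLinearMap ℝ ℝ i j)

theorem entryCLM_apply (i j : Fin 3) (A : Matrix (Fin 3) (Fin 3) ℝ) : entryCLM i j A = A i j := rfl

theorem contDiff_det_fin_three :
    ContDiff ℝ ∞ (fun A : Matrix (Fin 3) (Fin 3) ℝ => A.det) := by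
  simp only [det_fin_three, ← entryCLM_apply]
  fun_prop

theorem contDiff_linear_mul_transpose (l : Matrix (Fin 3) (Fin 3) ℝ →ₗ[ℝ] ℝ) :
    ContDiff ℝ ∞ (fun A : Matrix (Fin 3) (Fin 3) ℝ => l (A * Aᵀ)) := by
  have : ∀ M, l M = ∑ i, ∑ j, M i j * l (Matrix.single i j 1) := by
    intro M
    conv_lhs => rw [matrix_eq_sum_single M]
    simp only [map_sum]
    refine Finset.sum_congr rfl fun i _ => Finset.sum_congr rfl fun j _ => ?_
    rw [← smul_eq_mul, ← map_smul, smul_single, smul_eq_mul, mul_one]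
  have h2 : (fun A : Matrix (Fin 3) (Fin 3) ℝ => l (A * Aᵀ)) =
      fun A => ∑ i, ∑ j, (A * Aᵀ) i j * l (Matrix.single i j 1) := funext fun A => this _
  rw [h2]
  simp only [Matrix.mul_apply, transpose_apply]
  simp only [← entryCLM_apply]
  fun_prop

/-- The symmetric part of a matrix. -/
def symPart : Matrix (Fin 3) (Fin 3) ℝ →ₗ[ℝ] symMat where
  toFun A := ⟨(1 / 2 : ℝ) • (A + Aᵀ), by
    change ((1 / 2 : ℝ) • (A + Aᵀ))ᵀ = _
    rw [transpose_smul, transpose_add, transpose_transpose, add_comm]⟩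
  map_add' A B := Subtype.ext (by
    simp only [Submodule.coe_add, transpose_add]
    module)
  map_smul' r A := Subtype.ext (by
    simp only [Submodule.coe_smul, transpose_smul, RingHom.id_apply]
    module)

theorem symPart_coe (S : symMat) : symPart S = S := by
  have hS : (S : Matrix (Fin 3) (Fin 3) ℝ)ᵀ = S := S.2
  apply Subtype.ext
  change (1 / 2 : ℝ) • ((S : Matrix (Fin 3) (Fin 3) ℝ) + (S : Matrix (Fin 3) (Fin 3) ℝ)ᵀ) = S
  rw [hS]
  module

theorem contDiff_linear_quot333 (l : (symMat ⧸ scalarLine) × ℝ →ₗ[ℝ] ℝ) :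
    ContDiff ℝ ∞ fun A => l (quot333 A) := by
  -- The symmetric part extends the quotient projection to all matrices, so smoothness reduces to
  -- polynomials in the entries.
  have : ∀ A, l (quot333 A) = (l ∘ₗ LinearMap.inl ℝ _ _ ∘ₗ scalarLine.mkQ ∘ₗ symPart) (A * Aᵀ) +
      A.det * l (0, 1) := by
    intro A
    have h1 : symPart (A * Aᵀ) = ⟨A * Aᵀ, isSymm_mul_transpose_self A⟩ :=
      symPart_coe ⟨A * Aᵀ, isSymm_mul_transpose_self A⟩
    have h2 : quot333 A = LinearMap.inl ℝ _ _ (scalarLine.mkQ (symPart (A * Aᵀ))) +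
        A.det • ((0, 1) : (symMat ⧸ scalarLine) × ℝ) := by
      rw [h1]
      ext1 <;> simp [quot333]
    rw [h2, map_add, map_smul]
    rfl
  simp only [this]
  exact (contDiff_linear_mul_transpose _).add (contDiff_det_fin_three.mul contDiff_const)

theorem quot333_smul (t : ℝ) (A : Matrix (Fin 3) (Fin 3) ℝ) :
    quot333 (t • A) = (t ^ 2 • (quot333 A).1, t ^ 3 • (quot333 A).2) := by
  ext1
  · simp only [quot333, ← map_smul]
    congr 1
    apply Subtype.ext
    simp only [Submodule.coe_smul, transpose_smul, smul_mul_smul_comm, sq]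
  · simp [quot333]

/-- Conjugation of symmetric matrices by `O`. -/
def symConj (O : Matrix (Fin 3) (Fin 3) ℝ) : symMat →ₗ[ℝ] symMat where
  toFun S := ⟨O * (S : Matrix (Fin 3) (Fin 3) ℝ) * Oᵀ, by
    have hS : (S : Matrix (Fin 3) (Fin 3) ℝ)ᵀ = S := S.2
    change (O * (S : Matrix (Fin 3) (Fin 3) ℝ) * Oᵀ)ᵀ = _
    rw [transpose_mul, transpose_mul, transpose_transpose, hS, mul_assoc]⟩
  map_add' A B := Subtype.ext (by simp only [Submodule.coe_add, mul_add, add_mul])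
  map_smul' r A := Subtype.ext (by
    simp only [Submodule.coe_smul, mul_smul_comm, smul_mul_assoc, RingHom.id_apply])

/-- An isometry commuting with the generators induces a linear map of the quotient. -/
theorem exists_quot333_comp_eq {T : Matrix (Fin 3) (Fin 3) ℝ →ₗ[ℝ] Matrix (Fin 3) (Fin 3) ℝ}
    (hT : ∀ x y, form333 (T x) (T y) = form333 x y)
    (hY : ∀ k x, T (gen333 k x) = gen333 k (T x)) :
    ∃ τ : (symMat ⧸ scalarLine) × ℝ →ₗ[ℝ] (symMat ⧸ scalarLine) × ℝ,
      ∀ x, quot333 (T x) = τ (quot333 x) := by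
  -- Matrices supported in the first column are the kernel of the first generator, so T preserves
  -- them, acting there by some O. The generators move the first column to the others, where T must
  -- act by the same O.
  let O : Matrix (Fin 3) (Fin 3) ℝ := Matrix.of fun s r => T (Matrix.single r 0 1) s 0
  have h0 : ∀ r, T (Matrix.single r 0 1) = O * Matrix.single r 0 1 := by
    intro r
    have h1 : (Matrix.single r 0 1 : Matrix (Fin 3) (Fin 3) ℝ) * rotGen 0 = 0 := by
      ext i j
      fin_cases j <;> simp [rotGen, Matrix.mul_apply, Fin.sum_univ_three, Matrix.single_apply]
    have h2 := hY 0 (Matrix.single r 0 1)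
    rw [gen333_apply, gen333_apply, h1, map_zero] at h2
    ext i j
    have e1 := congrFun (congrFun h2 i) 1
    have e2 := congrFun (congrFun h2 i) 2
    simp [rotGen, Matrix.mul_apply, Fin.sum_univ_three] at e1 e2
    fin_cases j
    · simp [O]
    · simpa using e2.symm
    · simpa using e1
  have h1 : ∀ r, T (Matrix.single r 1 1) = O * Matrix.single r 1 1 := by
    intro r
    have h2 : (Matrix.single r 1 1 : Matrix (Fin 3) (Fin 3) ℝ) = Matrix.single r 0 1 * rotGen 2 := by
      ext i j
      fin_cases j <;> simp [rotGen, Matrix.mul_apply, Fin.sum_univ_three, Matrix.single_apply]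
    rw [h2, ← gen333_apply, hY, h0, gen333_apply, gen333_apply, mul_assoc]
  have h2 : ∀ r, T (Matrix.single r 2 1) = O * Matrix.single r 2 1 := by
    intro r
    have h2 : (Matrix.single r 2 1 : Matrix (Fin 3) (Fin 3) ℝ) = Matrix.single r 1 1 * rotGen 0 := by
      ext i j
      fin_cases j <;> simp [rotGen, Matrix.mul_apply, Fin.sum_univ_three, Matrix.single_apply]
    rw [h2, ← gen333_apply, hY, h1, gen333_apply, gen333_apply, mul_assoc]
  have hTO : ∀ A, T A = O * A := by
    intro A
    conv_lhs => rw [matrix_eq_sum_single A]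
    conv_rhs => rw [matrix_eq_sum_single A]
    simp only [map_sum, Finset.mul_sum]
    refine Finset.sum_congr rfl fun i _ => Finset.sum_congr rfl fun j _ => ?_
    have : Matrix.single i j (A i j) = A i j • Matrix.single i j (1 : ℝ) := by
      rw [smul_single, smul_eq_mul, mul_one]
    rw [this, map_smul, mul_smul_comm]
    congr 1
    fin_cases j
    · exact h0 i
    · exact h1 i
    · exact h2 i
  have hO : Oᵀ * O = 1 := by
    refine eq_one_of_trace_mul (by rw [transpose_mul, transpose_transpose]) fun A => ?_
    have := hT A 1
    rw [form333, form333, hTO, hTO, mul_one, transpose_one, mul_one] at this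
    rw [← this, trace_mul_comm (O * A), ← mul_assoc Oᵀ, trace_mul_comm A]
  have hO' := mul_eq_one_comm.1 hO
  have hle : scalarLine ≤ scalarLine.comap (symConj O) := by
    intro S hS
    obtain ⟨c, rfl⟩ := Submodule.mem_span_singleton.1 hS
    have : symConj O ⟨1, isSymm_one⟩ = ⟨1, isSymm_one⟩ := Subtype.ext (by
      change O * 1 * Oᵀ = 1
      rw [mul_one, hO'])
    rw [Submodule.mem_comap, map_smul, this]
    exact Submodule.smul_mem _ c (Submodule.mem_span_singleton_self _)
  refine ⟨(scalarLine.mapQ scalarLine (symConj O) hle).prodMap (O.det • LinearMap.id), fun A => ?_⟩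
  ext1
  · simp only [quot333, LinearMap.prodMap_apply, Submodule.mkQ_apply, Submodule.mapQ_apply]
    congr 1
    apply Subtype.ext
    change T A * (T A)ᵀ = O * (A * Aᵀ) * Oᵀ
    rw [hTO, transpose_mul]
    simp only [mul_assoc]
  · simp [quot333, hTO]

variable {G : Type*} [TopologicalSpace G] [Group G] [IsTopologicalGroup G]
  {V : Type*} [NormedAddCommGroup V] [NormedSpace ℝ V] [FiniteDimensional ℝ V]
  {ρ : G →* (V →L[ℝ] V)} {X : Fin 3 → V →L[ℝ] V} {B : LinearMap.BilinForm ℝ V}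

namespace IsLinearModel

/-- Isometry alone would also allow matrices of determinant -1; this invariant rules them out. -/
theorem det_eq {e : V ≃ₗ[ℝ] fixedSubspace ρ × Matrix (Fin 3) (Fin 3) ℝ}
    (he : IsLinearModel ρ X B gen333 form333 e) (h : IsInfinitesimalModel ρ X B) {g : G}
    (hg : g ∈ idComponent G) (v : V) : (e (ρ g v)).2.det = (e v).2.det := by
  have := he.apply_eq_of_flow h (fun A => A.det • (1 : ℍ[ℝ]))
    ((contDiff_det_fin_three.smul contDiff_const).differentiable (by simp))
    (fun k t A => A * rotFlow k t) (fun k A => by rw [rotFlow_zero, mul_one])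
    (one_ne_zero (α := ℝ)) (fun k A => by
      have := hasDerivAt_mul_rotFlow k A 0
      rwa [rotFlow_zero, mul_one, ← one_smul ℝ (gen333 k A)] at this)
    (fun k t A => by rw [det_mul, det_rotFlow, mul_one]) hg v
  have h2 := congrArg QuaternionAlgebra.re this
  simpa using h2

/-- Left multiplications commute with the generators, so the action is A ↦ AK with K the image of
the identity matrix. -/
theorem exists_act333 {e : V ≃ₗ[ℝ] fixedSubspace ρ × Matrix (Fin 3) (Fin 3) ℝ}
    (he : IsLinearModel ρ X B gen333 form333 e) (h : IsInfinitesimalModel ρ X B) {g : G}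
    (hg : g ∈ idComponent G) : ∃ s, ∀ v, e (ρ g v) = ((e v).1, act333 s (e v).2) := by
  obtain ⟨T, hT, hb, hC⟩ := he.exists_of_mem_idComponent h hg
  set K := T 1 with hK
  have hTK : ∀ A, T A = A * K := by
    intro A
    have := hC (LinearMap.mulLeft ℝ A) (fun k x => by simp [gen333_apply, mul_assoc]) 1
    simpa using this
  have hKK : K * Kᵀ = 1 := by
    refine eq_one_of_trace_mul (by rw [transpose_mul, transpose_transpose]) fun A => ?_
    have := hb A 1
    rwa [form333, form333, hTK, transpose_one, mul_one, mul_assoc] at this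
  have hdet : K.det = 1 := by
    have := he.det_eq h hg (e.symm (0, 1))
    rw [hT, LinearEquiv.apply_symm_apply, det_one] at this
    exact this
  have hmem : Kᵀ ∈ specialOrthogonalGroup (Fin 3) ℝ :=
    mem_specialOrthogonalGroup_iff.2 ⟨(mem_orthogonalGroup_iff' _ _).2
      (by rw [transpose_transpose, hKK]), by rw [det_transpose, hdet]⟩
  refine ⟨⟨Kᵀ, hmem⟩, fun v => ?_⟩
  rw [hT, act333, coe_inv_specialOrthogonal, transpose_transpose, hTK]

theorem exists_rep_eq_act333 {e : V ≃ₗ[ℝ] fixedSubspace ρ × Matrix (Fin 3) (Fin 3) ℝ}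
    (he : IsLinearModel ρ X B gen333 form333 e) (h : IsInfinitesimalModel ρ X B)
    (s : specialOrthogonalGroup (Fin 3) ℝ) :
    ∃ g ∈ idComponent G, ∀ v, e (ρ g v) = ((e v).1, act333 s (e v).2) := by
  have flow : ∀ k t, ∃ g ∈ idComponent G, ∀ v, e (ρ g v) = ((e v).1, (e v).2 * rotFlow k t) := by
    intro k t
    exact he.exists_of_flow h (Pi.single k 1) (fun t A => A * rotFlow k t)
      (fun A => by rw [rotFlow_zero, mul_one]) (fun A t => by
        refine (hasDerivAt_mul_rotFlow k A t).congr_deriv ?_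
        simp [Pi.single_apply]) t
  have mul : ∀ C D : Matrix (Fin 3) (Fin 3) ℝ,
      (∃ g ∈ idComponent G, ∀ v, e (ρ g v) = ((e v).1, (e v).2 * Cᵀ)) →
      (∃ g ∈ idComponent G, ∀ v, e (ρ g v) = ((e v).1, (e v).2 * Dᵀ)) →
      ∃ g ∈ idComponent G, ∀ v, e (ρ g v) = ((e v).1, (e v).2 * (C * D)ᵀ) := by
    rintro C D ⟨g, hg, hgC⟩ ⟨g', hg', hgD⟩
    refine ⟨g * g', mul_mem hg hg', fun v => ?_⟩
    have : ρ (g * g') v = ρ g (ρ g' v) := by rw [map_mul]; rfl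
    rw [this, hgC, hgD, transpose_mul, mul_assoc]
  have hX : ∀ t, ∃ g ∈ idComponent G, ∀ v, e (ρ g v) = ((e v).1, (e v).2 * (rotX t)ᵀ) := fun t => by
    rw [← rotFlow_zero_eq]; exact flow 0 t
  have hZ : ∀ t, ∃ g ∈ idComponent G, ∀ v, e (ρ g v) = ((e v).1, (e v).2 * (rotZ t)ᵀ) := fun t => by
    rw [← rotFlow_two_eq]; exact flow 2 t
  obtain ⟨a, b, c, hs⟩ := exists_euler_angles
    ((mem_orthogonalGroup_iff' _ _).1 (mem_specialOrthogonalGroup_iff.1 s.2).1)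
    (mem_specialOrthogonalGroup_iff.1 s.2).2
  have := mul _ _ (mul _ _ (hZ a) (hX b)) (hZ c)
  rw [← hs] at this
  simpa only [act333, coe_inv_specialOrthogonal] using this

theorem exists_homeomorph333 {e : V ≃ₗ[ℝ] fixedSubspace ρ × Matrix (Fin 3) (Fin 3) ℝ}
    (he : IsLinearModel ρ X B gen333 form333 e) (h : IsInfinitesimalModel ρ X B) :
    ∃ (m : ℕ) (φ : OrbitSpace ρ ≃ₜ EuclideanSpace ℝ (Fin m))
      (σ : Representation ℝ (G ⧸ idComponent G) (EuclideanSpace ℝ (Fin m))),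
      ContDiff ℝ ∞ (fun v : V => φ (toOrbit ρ v)) ∧
      (∀ (g : G) (v : V), φ (toOrbit ρ (ρ g v)) =
        σ (g : G ⧸ idComponent G) (φ (toOrbit ρ v))) ∧
      HasExplicitQuotientMap ρ φ act333 quot333 :=
  he.exists_homeomorph h (fun _ hg => he.exists_act333 h hg) (he.exists_rep_eq_act333 h)
    quot333_eq_iff quot333_surjective two_ne_zero three_ne_zero quot333_smul
    (fun j l => (contDiff_linear_quot333 l).comp (LinearMap.toContinuousLinearMap j).contDiff)
    (fun _ hT hY => exists_quot333_comp_eq hT hY)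

end IsLinearModel

end Model333

/-! ### Irreducible components and their relations. -/

section Components

variable {G : Type*} [TopologicalSpace G] [Group G] [IsTopologicalGroup G]
  {V : Type*} [NormedAddCommGroup V] [NormedSpace ℝ V]
  {ρ : G →* (V →L[ℝ] V)} {X : Fin 3 → V →L[ℝ] V} {B : LinearMap.BilinForm ℝ V}

theorem finrank_finset_sup_le [FiniteDimensional ℝ V] {ι : Type*} (T : Finset ι) (W : ι → Submodule ℝ V) :
    Module.finrank ℝ (T.sup W : Submodule ℝ V) ≤ ∑ i ∈ T, Module.finrank ℝ (W i) := by
  classical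
  induction T using Finset.induction_on with
  | empty => simp
  | insert i T hi ih =>
    rw [Finset.sup_insert, Finset.sum_insert hi]
    exact (Submodule.finrank_add_le_finrank_add_finrank _ _).trans (by omega)

theorem IsInfinitesimalModel.apply_form_self (h : IsInfinitesimalModel ρ X B) (k : Fin 3) (v : V) :
    B (X k v) v = 0 := by
  have h1 := h.skew k v v
  rw [h.symm v] at h1
  linarith

/-- The irreducible components of dimension greater than one have no fixed vectors and span the
space together with the fixed vectors. -/
theorem IsInfinitesimalModel.exists_components [FiniteDimensional ℝ V] {d : ℕ}
    [ChartedSpace (EuclideanSpace ℝ (Fin d)) G]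
    (h : IsInfinitesimalModel ρ X B)
    (hinv : ∀ W : Submodule ℝ V, IsLieInvariant (d := d) ρ W ↔ ∀ k, ∀ w ∈ W, X k w ∈ W)
    {s : Multiset ℕ} (hs : HasNontrivialComponentDims (d := d) ρ s) :
    ∃ (L : ℕ) (W : Fin L → Submodule ℝ V) (T : Finset (Fin L)), iSupIndep W ∧
      (∀ i ∈ T, (∀ k, ∀ w ∈ W i, X k w ∈ W i) ∧ ∀ w ∈ W i, (∀ k, X k w = 0) → w = 0) ∧
      Module.finrank ℝ V ≤ Module.finrank ℝ (fixedSubspace ρ) + s.sum ∧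
      T.val.map (fun i => Module.finrank ℝ (W i)) = s := by
  obtain ⟨L, W, hW, hirr, rfl⟩ := hs
  let T : Finset (Fin L) := Finset.univ.filter fun i => 1 < Module.finrank ℝ (W i)
  have hTs : T.val.map (fun i => Module.finrank ℝ (W i)) =
      ((Finset.univ : Finset (Fin L)).val.map fun i => Module.finrank ℝ (W i)).filter (1 < ·) := by
    rw [Multiset.filter_map]
    rfl
  have hinvW : ∀ i k, ∀ w ∈ W i, X k w ∈ W i := fun i => (hinv _).1 (hirr i).2.1
  refine ⟨L, W, T, hW.submodule_iSupIndep, fun i hi => ⟨hinvW i, fun w hw hX => ?_⟩, ?_, hTs⟩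
  · by_contra hw0
    have hi' : 1 < Module.finrank ℝ (W i) := (Finset.mem_filter.1 hi).2
    -- A vector killed by the generators spans an invariant line, which irreducibility would make
    -- the whole component.
    have hle : ℝ ∙ w ≤ W i := by rwa [Submodule.span_singleton_le_iff_mem]
    rcases (hirr i).2.2 (ℝ ∙ w) hle ((hinv _).2 fun k x hx => by
      obtain ⟨c, rfl⟩ := Submodule.mem_span_singleton.1 hx
      rw [map_smul, hX, smul_zero]
      exact zero_mem _) with h1 | h1
    · exact hw0 (Submodule.span_singleton_eq_bot.1 h1)
    · rw [← h1, finrank_span_singleton hw0] at hi'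
      exact lt_irrefl _ hi'
  -- A skew operator on a line is zero, so one-dimensional components are fixed.
  · have hsmall : ∀ i ∉ T, W i ≤ fixedSubspace ρ := by
      intro i hi w hw
      rw [h.fixed]
      intro k
      have hi' : Module.finrank ℝ (W i) ≤ 1 := by
        by_contra! hlt
        exact hi (Finset.mem_filter.2 ⟨Finset.mem_univ _, hlt⟩)
      obtain ⟨v, hv⟩ := finrank_le_one_iff.1 hi'
      obtain ⟨a, ha⟩ := hv ⟨X k w, hinvW i k w hw⟩
      obtain ⟨b, hb⟩ := hv ⟨w, hw⟩
      have ha' : a • (v : V) = X k w := congrArg Subtype.val ha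
      have hb' : b • (v : V) = w := congrArg Subtype.val hb
      have h0 := h.apply_form_self k w
      rw [← ha']
      by_contra hne
      have ha0 : a ≠ 0 := fun h => hne (by rw [h, zero_smul])
      have hv0 : (v : V) ≠ 0 := fun h => hne (by rw [h, smul_zero])
      rw [← ha'] at h0
      conv at h0 => enter [1, 2]; rw [← hb']
      rw [map_smul, map_smul, LinearMap.smul_apply, smul_eq_mul, smul_eq_mul] at h0
      have hb0 : b = 0 := by
        rcases mul_eq_zero.1 h0 with h0 | h0
        · exact h0
        · exact absurd h0 (mul_ne_zero ha0 (h.pos _ hv0).ne')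
      rw [hb0, zero_smul] at hb'
      rw [← hb', map_zero] at ha'
      exact hne ha'
    have htop : (⊤ : Submodule ℝ V) ≤ fixedSubspace ρ ⊔ T.sup W := by
      rw [← hW.submodule_iSup_eq_top]
      refine iSup_le fun i => ?_
      by_cases hi : i ∈ T
      · exact (Finset.le_sup hi).trans le_sup_right
      · exact (hsmall i hi).trans le_sup_left
    calc Module.finrank ℝ V = Module.finrank ℝ (⊤ : Submodule ℝ V) :=
        (_root_.finrank_top ℝ V).symm
      _ ≤ Module.finrank ℝ (fixedSubspace ρ ⊔ T.sup W : Submodule ℝ V) :=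
        Submodule.finrank_mono htop
      _ ≤ Module.finrank ℝ (fixedSubspace ρ) + Module.finrank ℝ (T.sup W : Submodule ℝ V) :=
        Submodule.finrank_add_le_finrank_add_finrank _ _
      _ ≤ _ := by
        rw [← hTs]
        exact Nat.add_le_add_left (finrank_finset_sup_le T W) _

/-- The generators as linear maps. -/
abbrev linGen (X : Fin 3 → V →L[ℝ] V) (k : Fin 3) : V →ₗ[ℝ] V := (X k).toLinearMap

namespace IsInfinitesimalModel

theorem apply01 (h : IsInfinitesimalModel ρ X B) (w : V) : X 0 (X 1 w) - X 1 (X 0 w) = X 2 w := by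
  rw [← h.comm01]; rfl

theorem apply12 (h : IsInfinitesimalModel ρ X B) (w : V) : X 1 (X 2 w) - X 2 (X 1 w) = X 0 w := by
  rw [← h.comm12]; rfl

theorem apply20 (h : IsInfinitesimalModel ρ X B) (w : V) : X 2 (X 0 w) - X 0 (X 2 w) = X 1 w := by
  rw [← h.comm20]; rfl

theorem isSpinHalf_of_mem [FiniteDimensional ℝ V] (h : IsInfinitesimalModel ρ X B) {W : Submodule ℝ V}
    (hinv : ∀ k, ∀ w ∈ W, X k w ∈ W) (hfix : ∀ w ∈ W, (∀ k, X k w = 0) → w = 0)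
    (hW : Module.finrank ℝ W = 4) {w : V} (hw : w ∈ W) : IsSpinHalf (linGen X) w := by
  let Y : Fin 3 → W →ₗ[ℝ] W := fun k => (linGen X k).restrict (hinv k)
  have hY : ∀ k w, (Y k w : V) = X k w := fun k w => rfl
  have key := isSpinHalf_of_finrank_eq_four hW (B := B.restrict W) (fun v w => h.symm v w)
    (fun v hv => h.pos v fun h => hv (Subtype.ext h)) (X := Y) (fun k v w => h.skew k v w)
    (fun w => Subtype.ext (h.apply01 w)) (fun w => Subtype.ext (h.apply12 w))
    (fun w => Subtype.ext (h.apply20 w))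
    (fun w hw => Subtype.ext (hfix w w.2 fun k => congrArg Subtype.val (hw k))) ⟨w, hw⟩
  exact ⟨fun k => congrArg Subtype.val (key.1 k), congrArg Subtype.val key.2.1,
    congrArg Subtype.val key.2.2.1, congrArg Subtype.val key.2.2.2⟩

theorem isSpinOne_of_mem [FiniteDimensional ℝ V] (h : IsInfinitesimalModel ρ X B) {W : Submodule ℝ V}
    (hinv : ∀ k, ∀ w ∈ W, X k w ∈ W) (hfix : ∀ w ∈ W, (∀ k, X k w = 0) → w = 0)
    (hW : Module.finrank ℝ W = 3) : (∀ w ∈ W, IsSpinOne (linGen X) w) ∧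
      ∃ w ∈ W, w ≠ 0 ∧ X 0 w = 0 := by
  let Y : Fin 3 → W →ₗ[ℝ] W := fun k => (linGen X k).restrict (hinv k)
  obtain ⟨key, w, hw0, hw⟩ := isSpinOne_of_finrank_eq_three hW (B := B.restrict W)
    (fun v w => h.symm v w)
    (fun v hv => h.pos v fun h => hv (Subtype.ext h)) (X := Y) (fun k v w => h.skew k v w)
    (fun w => Subtype.ext (h.apply01 w)) (fun w => Subtype.ext (h.apply12 w))
    (fun w => Subtype.ext (h.apply20 w))
    (fun w hw => Subtype.ext (hfix w w.2 fun k => congrArg Subtype.val (hw k)))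
  exact ⟨fun w hw => ⟨congrArg Subtype.val (key ⟨w, hw⟩).1, congrArg Subtype.val (key ⟨w, hw⟩).2.1,
    congrArg Subtype.val (key ⟨w, hw⟩).2.2⟩, w, w.2, fun h => hw0 (Subtype.ext h),
    congrArg Subtype.val hw⟩

theorem exists_mem_form_self_eq_one (h : IsInfinitesimalModel ρ X B) {W : Submodule ℝ V}
    (hW : W ≠ ⊥) : ∃ w ∈ W, B w w = 1 := by
  obtain ⟨w, hw, hw0⟩ := Submodule.exists_mem_ne_zero_of_ne_bot hW
  have hp := h.pos w hw0
  refine ⟨(√(B w w))⁻¹ • w, W.smul_mem _ hw, ?_⟩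
  rw [map_smul, map_smul, LinearMap.smul_apply, smul_eq_mul, smul_eq_mul, ← mul_assoc, ← mul_inv,
    Real.mul_self_sqrt hp.le, inv_mul_cancel₀ hp.ne']

theorem form_fixed_apply (h : IsInfinitesimalModel ρ X B) {v : V} (hv : v ∈ fixedSubspace ρ)
    (k : Fin 3) (w : V) : B v (X k w) = 0 := by
  have h1 := h.skew k v w
  rw [(h.fixed v).1 hv k, map_zero] at h1
  simpa using h1.symm

end IsInfinitesimalModel

theorem IsSpinHalf.add {W : Type*} [AddCommGroup W] [Module ℝ W] {X : Fin 3 → W →ₗ[ℝ] W} {v w : W}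
    (hv : IsSpinHalf X v) (hw : IsSpinHalf X w) : IsSpinHalf X (v + w) := by
  refine ⟨fun k => ?_, ?_, ?_, ?_⟩
  · simp only [map_add, hv.1 k, hw.1 k, smul_add]
  · simp only [map_add, hv.2.1, hw.2.1, smul_add]
  · simp only [map_add, hv.2.2.1, hw.2.2.1, smul_add]
  · simp only [map_add, hv.2.2.2, hw.2.2.2, smul_add]

/-- The relations are linear in the vector, so they survive mixing of different components, which
need not be orthogonal. -/
theorem isSpinOne_of_mem_span {W : Type*} [AddCommGroup W] [Module ℝ W] {X : Fin 3 → W →ₗ[ℝ] W}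
    {s : Set W} (hs : ∀ v ∈ s, IsSpinOne X v) {v : W} (hv : v ∈ Submodule.span ℝ s) :
    IsSpinOne X v := by
  induction hv using Submodule.span_induction with
  | mem x hx => exact hs x hx
  | zero => simp [IsSpinOne]
  | add x y _ _ hx hy =>
    refine ⟨?_, ?_, ?_⟩
    · have := congrArg₂ (· + ·) hx.1 hy.1
      simp only [map_add, smul_add] at this ⊢
      rw [← this]
      abel
    · have := congrArg₂ (· + ·) hx.2.1 hy.2.1
      simp only [map_add, add_zero] at this ⊢
      rw [← this]
      abel
    · simp only [map_add, hx.2.2, hy.2.2, add_zero]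
  | smul c x _ hx =>
    refine ⟨?_, ?_, ?_⟩
    · simp only [map_smul, ← smul_add, hx.1, smul_comm c]
    · simp only [map_smul, ← smul_add, hx.2.1, smul_zero]
    · simp only [map_smul, hx.2.2, smul_zero]

end Components

/-! ### Equivariant embeddings of ℍ and ℝ³ generated by one vector. -/

section Embeddings

variable {G : Type*} [TopologicalSpace G] [Group G] [IsTopologicalGroup G]
  {V : Type*} [NormedAddCommGroup V] [NormedSpace ℝ V]
  {ρ : G →* (V →L[ℝ] V)} {X : Fin 3 → V →L[ℝ] V} {B : LinearMap.BilinForm ℝ V}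

/-- The equivariant embedding of the quaternions generated by the vector `w`. -/
def spinHalfMap (X : Fin 3 → V →L[ℝ] V) (w : V) : ℍ[ℝ] →ₗ[ℝ] V where
  -- The generators send 1 in ℍ to -i/2, -j/2, -k/2, so equivariance forces i, j, k to go to -2Xₖw.
  toFun z := z.re • w - (2 * z.imI) • X 0 w - (2 * z.imJ) • X 1 w - (2 * z.imK) • X 2 w
  map_add' x y := by
    simp only [Quaternion.re_add, Quaternion.imI_add, Quaternion.imJ_add, Quaternion.imK_add]
    module
  map_smul' r x := by
    simp only [Quaternion.re_smul, Quaternion.imI_smul, Quaternion.imJ_smul, Quaternion.imK_smul,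
      smul_eq_mul, RingHom.id_apply]
    module

theorem spinHalfMap_apply (X : Fin 3 → V →L[ℝ] V) (w : V) (z : ℍ[ℝ]) : spinHalfMap X w z =
    z.re • w - (2 * z.imI) • X 0 w - (2 * z.imJ) • X 1 w - (2 * z.imK) • X 2 w := rfl

/-- The equivariant embedding of `ℝ³` generated by the vector `v` fixed by the first generator. -/
def spinOneMap (X : Fin 3 → V →L[ℝ] V) (v : V) : (Fin 3 → ℝ) →ₗ[ℝ] V where
  toFun a := a 0 • v + a 1 • X 2 v - a 2 • X 1 v
  map_add' x y := by
    simp only [Pi.add_apply]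
    module
  map_smul' r x := by
    simp only [Pi.smul_apply, smul_eq_mul, RingHom.id_apply]
    module

theorem spinOneMap_apply (X : Fin 3 → V →L[ℝ] V) (v : V) (a : Fin 3 → ℝ) : spinOneMap X v a =
    a 0 • v + a 1 • X 2 v - a 2 • X 1 v := rfl

namespace IsInfinitesimalModel

theorem spinHalf_relations (h : IsInfinitesimalModel ρ X B) {w : V}
    (hw : IsSpinHalf (linGen X) w) :
    (∀ k, X k (X k w) = -(1 / 4 : ℝ) • w) ∧ X 0 (X 1 w) = (1 / 2 : ℝ) • X 2 w ∧
      X 1 (X 2 w) = (1 / 2 : ℝ) • X 0 w ∧ X 2 (X 0 w) = (1 / 2 : ℝ) • X 1 w ∧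
      X 1 (X 0 w) = -(1 / 2 : ℝ) • X 2 w ∧ X 2 (X 1 w) = -(1 / 2 : ℝ) • X 0 w ∧
      X 0 (X 2 w) = -(1 / 2 : ℝ) • X 1 w := by
  obtain ⟨h0, h1, h2, h3⟩ := hw
  change ∀ k, X k (X k w) = _ at h0
  change X 0 (X 1 w) = (1 / 2 : ℝ) • X 2 w at h1
  change X 1 (X 2 w) = (1 / 2 : ℝ) • X 0 w at h2
  change X 2 (X 0 w) = (1 / 2 : ℝ) • X 1 w at h3
  refine ⟨h0, h1, h2, h3, ?_, ?_, ?_⟩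
  · rw [← sub_eq_iff_eq_add'.2 (sub_eq_iff_eq_add.1 (h.apply01 w)), h1]; module
  · rw [← sub_eq_iff_eq_add'.2 (sub_eq_iff_eq_add.1 (h.apply12 w)), h2]; module
  · rw [← sub_eq_iff_eq_add'.2 (sub_eq_iff_eq_add.1 (h.apply20 w)), h3]; module

theorem apply_spinHalfMap (h : IsInfinitesimalModel ρ X B) {w : V} (hw : IsSpinHalf (linGen X) w)
    (k : Fin 3) (z : ℍ[ℝ]) :
    X k (spinHalfMap X w z) = spinHalfMap X w (-(1 / 2 : ℝ) • (z * imUnit k)) := by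
  obtain ⟨h0, h01, h12, h20, h10, h21, h02⟩ := h.spinHalf_relations hw
  rw [map_smul, spinHalfMap_apply, spinHalfMap_apply]
  simp only [map_sub, map_smul]
  fin_cases k
  · simp [h0 0, h01, h02]; module
  · simp [h0 1, h12, h10]; module
  · simp [h0 2, h20, h21]; module

/-- Skewness moves all generators onto w', where the relations leave only B(w, w') and the vanishing
B(w, Xₖw'). -/
theorem form_spinHalfMap (h : IsInfinitesimalModel ρ X B) {w w' : V}
    (hw' : IsSpinHalf (linGen X) w') (hX : ∀ k, B w (X k w') = 0) (z z' : ℍ[ℝ]) :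
    B (spinHalfMap X w z) (spinHalfMap X w' z') = (z * star z').re * B w w' := by
  obtain ⟨h0, h01, h12, h20, h10, h21, h02⟩ := h.spinHalf_relations hw'
  rw [spinHalfMap_apply, spinHalfMap_apply]
  simp only [map_sub, map_smul, LinearMap.sub_apply, LinearMap.smul_apply, h.skew, h0, h01, h12,
    h20, h10, h21, h02, hX, smul_eq_mul]
  simp
  ring

theorem form_fixed_spinHalfMap (h : IsInfinitesimalModel ρ X B) {w : V}
    (hw : IsSpinHalf (linGen X) w) {v : V} (hv : v ∈ fixedSubspace ρ) (z : ℍ[ℝ]) :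
    B v (spinHalfMap X w z) = 0 := by
  have hw0 : B v w = 0 := by
    have h1 := h.form_fixed_apply hv 0 (X 0 w)
    rw [(h.spinHalf_relations hw).1, map_smul, smul_eq_mul] at h1
    linarith
  rw [spinHalfMap_apply]
  simp only [map_sub, map_smul, h.form_fixed_apply hv, hw0, smul_zero, sub_zero]

/-- At a vector killed by X₀, the three relations and the commutators together determine all
products of two generators. -/
theorem spinOne_relations (h : IsInfinitesimalModel ρ X B) {v : V} (hv : IsSpinOne (linGen X) v)
    (hv0 : X 0 v = 0) : X 1 (X 1 v) = -v ∧ X 2 (X 2 v) = -v ∧ X 1 (X 2 v) = 0 ∧ X 2 (X 1 v) = 0 ∧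
      X 0 (X 1 v) = X 2 v ∧ X 0 (X 2 v) = -X 1 v := by
  obtain ⟨h1, h2, h3⟩ := hv
  change X 0 (X 0 v) + X 1 (X 1 v) + X 2 (X 2 v) = _ at h1
  change X 1 (X 0 (X 2 v)) + X 2 (X 0 (X 1 v)) = 0 at h2
  change X 1 (X 0 (X 1 v)) = 0 at h3
  have e01 := h.apply01 v
  have e20 := h.apply20 v
  have e12 := h.apply12 v
  rw [hv0, map_zero, sub_zero] at e01
  rw [hv0, map_zero, zero_sub, neg_eq_iff_eq_neg] at e20
  rw [e01, e20, map_neg, neg_add_eq_zero] at h2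
  rw [hv0, map_zero, zero_add, ← h2, ← two_smul ℝ, neg_smul, ← smul_neg] at h1
  have e11 : X 1 (X 1 v) = -v := smul_right_injective V (two_ne_zero (α := ℝ)) h1
  rw [e01] at h3
  rw [h3, hv0, zero_sub, neg_eq_zero] at e12
  exact ⟨e11, h2 ▸ e11, h3, e12, e01, e20⟩

theorem apply_spinOneMap (h : IsInfinitesimalModel ρ X B) {v : V} (hv : IsSpinOne (linGen X) v)
    (hv0 : X 0 v = 0) (k : Fin 3) (a : Fin 3 → ℝ) :
    X k (spinOneMap X v a) = spinOneMap X v (Matrix.vecMul a (rotGen k)) := by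
  obtain ⟨e11, e22, e12, e21, e01, e02⟩ := h.spinOne_relations hv hv0
  rw [spinOneMap_apply, spinOneMap_apply]
  simp only [map_sub, map_add, map_smul]
  fin_cases k
  · simp [rotGen, Matrix.vecMul, dotProduct, Fin.sum_univ_three, hv0, e01, e02]
    abel
  · simp [rotGen, Matrix.vecMul, dotProduct, Fin.sum_univ_three, e12, e11]
    abel
  · simp [rotGen, Matrix.vecMul, dotProduct, Fin.sum_univ_three, e22, e21]
    abel

/-- The cross terms vanish because X₁w and X₂w lie in the image of X₀ and v in its kernel. -/
theorem form_spinOneMap (h : IsInfinitesimalModel ρ X B) {v : V} (hv0 : X 0 v = 0) {w : V}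
    (hw : IsSpinOne (linGen X) w) (hw0 : X 0 w = 0) (a b : Fin 3 → ℝ) :
    B (spinOneMap X v a) (spinOneMap X w b) = (a ⬝ᵥ b) * B v w := by
  obtain ⟨e11, e22, e12, e21, e01, e02⟩ := h.spinOne_relations hw hw0
  have h1 : B v (X 1 w) = 0 := by
    have := h.skew 0 v (X 2 w)
    rw [hv0, e02, map_zero] at this
    simpa using this.symm
  have h2 : B v (X 2 w) = 0 := by
    have := h.skew 0 v (X 1 w)
    rw [hv0, e01, map_zero] at this
    simpa using this.symm
  rw [spinOneMap_apply, spinOneMap_apply]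
  simp only [map_sub, map_add, map_smul, LinearMap.sub_apply, LinearMap.add_apply,
    LinearMap.smul_apply, h.skew, e11, e22, e12, e21, h1, h2, smul_eq_mul, dotProduct,
    Fin.sum_univ_three, map_neg, map_zero]
  ring

theorem form_fixed_spinOneMap (h : IsInfinitesimalModel ρ X B) {v : V}
    (hv : IsSpinOne (linGen X) v) (hv0 : X 0 v = 0) {u : V} (hu : u ∈ fixedSubspace ρ)
    (a : Fin 3 → ℝ) : B u (spinOneMap X v a) = 0 := by
  have huv : B u v = 0 := by
    have h1 := h.form_fixed_apply hu 1 (X 1 v)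
    rw [(h.spinOne_relations hv hv0).1, map_neg] at h1
    linarith
  rw [spinOneMap_apply]
  simp only [map_sub, map_add, map_smul, h.form_fixed_apply hu, huv, smul_zero, sub_zero, add_zero]

/-- The Casimir operator is self-adjoint with eigenvalue -3/4 at w and -2 at v. -/
theorem form_eq_zero_of_isSpinHalf_of_isSpinOne (h : IsInfinitesimalModel ρ X B) {w v : V}
    (hw : IsSpinHalf (linGen X) w) (hv : IsSpinOne (linGen X) v) : B w v = 0 := by
  have h1 : ∀ k, B (X k (X k w)) v = B w (X k (X k v)) := fun k => by
    rw [h.skew, h.skew, neg_neg]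
  have h2 : B w (X 0 (X 0 v) + X 1 (X 1 v) + X 2 (X 2 v)) = -(2 : ℝ) * B w v := by
    have := congrArg (B w) hv.1
    rw [map_smul, smul_eq_mul] at this
    exact this
  rw [map_add, map_add, ← h1, ← h1, ← h1, (h.spinHalf_relations hw).1, (h.spinHalf_relations hw).1,
    (h.spinHalf_relations hw).1, map_smul, LinearMap.smul_apply, smul_eq_mul] at h2
  linarith

end IsInfinitesimalModel

end Embeddings

/-! ### Linear models in the three cases. -/

section ExistsModel

variable {G : Type*} [TopologicalSpace G] [Group G] [IsTopologicalGroup G]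
  {V : Type*} [NormedAddCommGroup V] [NormedSpace ℝ V]
  {ρ : G →* (V →L[ℝ] V)} {X : Fin 3 → V →L[ℝ] V} {B : LinearMap.BilinForm ℝ V}

theorem spinHalfMap_mem {W : Submodule ℝ V} (hW : ∀ k, ∀ w ∈ W, X k w ∈ W) {w : V} (hw : w ∈ W)
    (z : ℍ[ℝ]) : spinHalfMap X w z ∈ W :=
  sub_mem (sub_mem (sub_mem (W.smul_mem _ hw) (W.smul_mem _ (hW 0 w hw)))
    (W.smul_mem _ (hW 1 w hw))) (W.smul_mem _ (hW 2 w hw))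

theorem spinOneMap_mem {W : Submodule ℝ V} (hW : ∀ k, ∀ w ∈ W, X k w ∈ W) {v : V} (hv : v ∈ W)
    (a : Fin 3 → ℝ) : spinOneMap X v a ∈ W :=
  sub_mem (add_mem (W.smul_mem _ hv) (W.smul_mem _ (hW 2 v hv))) (W.smul_mem _ (hW 1 v hv))

theorem ne_bot_of_finrank_pos {W : Submodule ℝ V} (hW : 0 < Module.finrank ℝ W) : W ≠ ⊥ := by
  rintro rfl
  simp at hW

variable [FiniteDimensional ℝ V] {d : ℕ} [ChartedSpace (EuclideanSpace ℝ (Fin d)) G]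

namespace IsInfinitesimalModel

/-- A Gram–Schmidt step over ℍ: the two components need not be orthogonal, so the second generating
vector is sought in their sum, orthogonal to the copy of ℍ generated by the first. -/
theorem exists_isLinearModel44 (h : IsInfinitesimalModel ρ X B)
    (hinv : ∀ W : Submodule ℝ V, IsLieInvariant (d := d) ρ W ↔ ∀ k, ∀ w ∈ W, X k w ∈ W)
    (hs : HasNontrivialComponentDims (d := d) ρ {4, 4}) :
    ∃ e, IsLinearModel ρ X B gen44 form44 e := by
  obtain ⟨L, W, T, hind, hT, hdim, hTs⟩ := h.exists_components hinv hs
  have hcard : T.card = 2 := by simpa using congrArg Multiset.card hTs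
  have h4 : ∀ i ∈ T, Module.finrank ℝ (W i) = 4 := by
    intro i hi
    have : Module.finrank ℝ (W i) ∈ T.val.map fun i => Module.finrank ℝ (W i) :=
      Multiset.mem_map_of_mem _ hi
    rw [hTs] at this
    simpa using this
  obtain ⟨i, j, hij, rfl⟩ := Finset.card_eq_two.1 hcard
  have hi : i ∈ ({i, j} : Finset (Fin L)) := by simp
  have hj : j ∈ ({i, j} : Finset (Fin L)) := by simp
  have hsi : ∀ w ∈ W i, IsSpinHalf (linGen X) w := fun w hw =>
    h.isSpinHalf_of_mem (hT i hi).1 (hT i hi).2 (h4 i hi) hw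
  have hsj : ∀ w ∈ W j, IsSpinHalf (linGen X) w := fun w hw =>
    h.isSpinHalf_of_mem (hT j hj).1 (hT j hj).2 (h4 j hj) hw
  have hsP : ∀ w ∈ W i ⊔ W j, IsSpinHalf (linGen X) w := by
    intro w hw
    obtain ⟨x, hx, y, hy, rfl⟩ := Submodule.mem_sup.1 hw
    exact (hsi x hx).add (hsj y hy)
  obtain ⟨w₁, hw₁, hB₁⟩ := h.exists_mem_form_self_eq_one (W := W i)
    (ne_bot_of_finrank_pos (by rw [h4 i hi]; norm_num))
  have hP : Module.finrank ℝ (W i ⊔ W j : Submodule ℝ V) = 8 := by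
    have h1 := Submodule.finrank_sup_add_finrank_inf_eq (W i) (W j)
    rw [(hind.pairwiseDisjoint hij).eq_bot, finrank_bot, h4 i hi, h4 j hj] at h1
    omega
  -- Orthogonality to w₁ and the Xₖw₁ is four linear conditions on an eight-dimensional space.
  let f : V →ₗ[ℝ] ℝ × (Fin 3 → ℝ) := (B w₁).prod (LinearMap.pi fun k => B (X k w₁))
  have hker : LinearMap.ker (f ∘ₗ (W i ⊔ W j).subtype) ≠ ⊥ := by
    apply LinearMap.ker_ne_bot_of_finrank_lt
    rw [hP, Module.finrank_prod]
    simp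
  obtain ⟨w₂, hw₂, hB₂⟩ := h.exists_mem_form_self_eq_one
    (W := (LinearMap.ker (f ∘ₗ (W i ⊔ W j).subtype)).map (W i ⊔ W j).subtype) (fun hbot =>
      hker (Submodule.map_injective_of_injective (Submodule.subtype_injective _)
        (hbot.trans (Submodule.map_bot _).symm)))
  obtain ⟨⟨w₂, hw₂P⟩, hw₂f, rfl⟩ := hw₂
  have hf : f w₂ = 0 := hw₂f
  have hB12 : B w₁ w₂ = 0 := congrArg Prod.fst hf
  have hBX : ∀ k, B (X k w₁) w₂ = 0 := fun k => congrFun (congrArg Prod.snd hf) k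
  have hs₁ := hsi w₁ hw₁
  have hs₂ := hsP w₂ hw₂P
  refine h.exists_isLinearModel ((spinHalfMap X w₁).coprod (spinHalfMap X w₂)) ?_ ?_ ?_ ?_ ?_
  · intro k x
    simp only [LinearMap.coprod_apply, map_add, h.apply_spinHalfMap hs₁, h.apply_spinHalfMap hs₂]
    rfl
  · intro x y
    have e11 := h.form_spinHalfMap hs₁ (fun k => by rw [h.symm, h.apply_form_self]) x.1 y.1
    have e22 := h.form_spinHalfMap (w := w₂) hs₂ (fun k => by rw [h.symm, h.apply_form_self]) x.2 y.2
    have e12 := h.form_spinHalfMap (w := w₁) hs₂ (fun k => by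
      have := h.skew k w₁ w₂
      rw [hBX] at this
      linarith) x.1 y.2
    have e21 := h.form_spinHalfMap (w := w₂) hs₁ (fun k => by rw [h.symm, hBX]) x.2 y.1
    have hB₂' : B w₂ w₂ = 1 := hB₂
    rw [hB₁, mul_one] at e11
    rw [hB₂', mul_one] at e22
    rw [hB12, mul_zero] at e12
    rw [h.symm w₂, hB12, mul_zero] at e21
    simp only [LinearMap.coprod_apply, map_add, LinearMap.add_apply, e11, e12, e21, e22, form44]
    ring
  · intro v hv x
    simp only [LinearMap.coprod_apply, map_add, h.form_fixed_spinHalfMap hs₁ hv,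
      h.form_fixed_spinHalfMap hs₂ hv, add_zero]
  · rintro ⟨x, y⟩ hxy
    simp only [form44, re_mul_star_self] at hxy
    have h1 := sq_nonneg ‖x‖
    have h2 := sq_nonneg ‖y‖
    have hx : ‖x‖ ^ 2 = 0 := by linarith
    have hy : ‖y‖ ^ 2 = 0 := by linarith
    exact Prod.ext (norm_eq_zero.1 (pow_eq_zero_iff two_ne_zero |>.1 hx))
      (norm_eq_zero.1 (pow_eq_zero_iff two_ne_zero |>.1 hy))
  · rw [Module.finrank_prod, Quaternion.finrank_eq_four]
    simpa using hdim

end IsInfinitesimalModel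

/-- The coordinates on the imaginary quaternions. -/
def imCoord : pureIm ≃ₗ[ℝ] (Fin 3 → ℝ) where
  toFun x := ![(x : ℍ[ℝ]).imI, (x : ℍ[ℝ]).imJ, (x : ℍ[ℝ]).imK]
  map_add' x y := by ext i; fin_cases i <;> simp
  map_smul' r x := by ext i; fin_cases i <;> simp
  invFun a := ⟨quat 0 (a 0) (a 1) (a 2), rfl⟩
  left_inv x := by
    have hx : (x : ℍ[ℝ]).re = 0 := x.2
    apply Subtype.ext
    ext <;> simp [hx]
  right_inv a := by ext i; fin_cases i <;> simp

theorem imCoord_apply (x : pureIm) :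
    imCoord x = ![(x : ℍ[ℝ]).imI, (x : ℍ[ℝ]).imJ, (x : ℍ[ℝ]).imK] := rfl

theorem imCoord_imComm (k : Fin 3) (x : pureIm) :
    imCoord ((1 / 2 : ℝ) • imComm (imUnit k) x) = Matrix.vecMul (imCoord x) (rotGen k) := by
  rw [imCoord_apply, imCoord_apply, Submodule.coe_smul, coe_imComm]
  ext i
  fin_cases k <;> fin_cases i <;>
    simp [rotGen, Matrix.vecMul, dotProduct, Fin.sum_univ_three] <;> ring

theorem re_mul_star_eq_dotProduct (x y : pureIm) :
    ((x : ℍ[ℝ]) * star (y : ℍ[ℝ])).re = imCoord x ⬝ᵥ imCoord y := by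
  have hx : (x : ℍ[ℝ]).re = 0 := x.2
  have hy : (y : ℍ[ℝ]).re = 0 := y.2
  simp [imCoord_apply, dotProduct, Fin.sum_univ_three, hx, hy]

theorem finrank_pureIm : Module.finrank ℝ pureIm = 3 := by
  rw [imCoord.finrank_eq, Module.finrank_fin_fun]

/-- The rows of a matrix. -/
def rowMap (r : Fin 3) : Matrix (Fin 3) (Fin 3) ℝ →ₗ[ℝ] (Fin 3 → ℝ) where
  toFun A := A r
  map_add' _ _ := rfl
  map_smul' _ _ := rfl

theorem rowMap_gen333 (r k : Fin 3) (A : Matrix (Fin 3) (Fin 3) ℝ) :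
    rowMap r (gen333 k A) = Matrix.vecMul (rowMap r A) (rotGen k) := rfl

theorem form333_eq_sum (A C : Matrix (Fin 3) (Fin 3) ℝ) :
    form333 A C = ∑ r, rowMap r A ⬝ᵥ rowMap r C := rfl

namespace IsInfinitesimalModel

/-- Here the two components are orthogonal automatically, by their Casimir eigenvalues. -/
theorem exists_isLinearModel43 (h : IsInfinitesimalModel ρ X B)
    (hinv : ∀ W : Submodule ℝ V, IsLieInvariant (d := d) ρ W ↔ ∀ k, ∀ w ∈ W, X k w ∈ W)
    (hs : HasNontrivialComponentDims (d := d) ρ {4, 3}) :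
    ∃ e, IsLinearModel ρ X B gen43 form43 e := by
  obtain ⟨L, W, T, hind, hT, hdim, hTs⟩ := h.exists_components hinv hs
  have mem : ∀ n ∈ ({4, 3} : Multiset ℕ), ∃ i ∈ T, Module.finrank ℝ (W i) = n := by
    intro n hn
    rw [← hTs] at hn
    exact Multiset.mem_map.1 hn
  obtain ⟨i, hi, h4⟩ := mem 4 (by simp)
  obtain ⟨j, hj, h3⟩ := mem 3 (by simp)
  have hsi : ∀ w ∈ W i, IsSpinHalf (linGen X) w := fun w hw =>
    h.isSpinHalf_of_mem (hT i hi).1 (hT i hi).2 h4 hw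
  obtain ⟨hsj, u, hu, hu0, hXu⟩ := h.isSpinOne_of_mem (hT j hj).1 (hT j hj).2 h3
  obtain ⟨w, hw, hBw⟩ := h.exists_mem_form_self_eq_one (W := W i)
    (ne_bot_of_finrank_pos (by rw [h4]; norm_num))
  obtain ⟨v, ⟨hv, hv0⟩, hBv⟩ := h.exists_mem_form_self_eq_one (W := W j ⊓ LinearMap.ker (linGen X 0))
    (fun hbot => hu0 ((Submodule.mem_bot ℝ).1 (hbot ▸ ⟨hu, hXu⟩)))
  have hv0 : X 0 v = 0 := hv0
  have hsw := hsi w hw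
  have hsv := hsj v hv
  have horth : ∀ z a, B (spinHalfMap X w z) (spinOneMap X v a) = 0 := fun z a =>
    h.form_eq_zero_of_isSpinHalf_of_isSpinOne (hsi _ (spinHalfMap_mem (hT i hi).1 hw z))
      (hsj _ (spinOneMap_mem (hT j hj).1 hv a))
  refine h.exists_isLinearModel
    ((spinHalfMap X w).coprod (spinOneMap X v ∘ₗ imCoord.toLinearMap)) ?_ ?_ ?_ ?_ ?_
  · intro k x
    simp only [LinearMap.coprod_apply, LinearMap.comp_apply, map_add, h.apply_spinHalfMap hsw,
      h.apply_spinOneMap hsv hv0, LinearEquiv.coe_coe, gen43_apply, imCoord_imComm]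
  · intro x y
    have e11 := h.form_spinHalfMap hsw (fun k => by rw [h.symm, h.apply_form_self]) x.1 y.1
    have e22 := h.form_spinOneMap hv0 hsv hv0 (imCoord x.2) (imCoord y.2)
    rw [hBw, mul_one] at e11
    rw [hBv, mul_one, ← re_mul_star_eq_dotProduct] at e22
    simp only [LinearMap.coprod_apply, LinearMap.comp_apply, LinearEquiv.coe_coe, map_add,
      LinearMap.add_apply, e11, e22, horth, h.symm (spinOneMap X v _) (spinHalfMap X w _), form43]
    ring
  · intro u hu x
    simp only [LinearMap.coprod_apply, LinearMap.comp_apply, map_add,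
      h.form_fixed_spinHalfMap hsw hu, h.form_fixed_spinOneMap hsv hv0 hu, add_zero]
  · rintro ⟨x, y⟩ hxy
    simp only [form43, re_mul_star_self] at hxy
    have h1 := sq_nonneg ‖x‖
    have h2 := sq_nonneg ‖(y : ℍ[ℝ])‖
    have hx : ‖x‖ ^ 2 = 0 := by linarith
    have hy : ‖(y : ℍ[ℝ])‖ ^ 2 = 0 := by linarith
    exact Prod.ext (norm_eq_zero.1 (pow_eq_zero_iff two_ne_zero |>.1 hx))
      (Subtype.ext (norm_eq_zero.1 (pow_eq_zero_iff two_ne_zero |>.1 hy)))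
  · rw [Module.finrank_prod, Quaternion.finrank_eq_four, finrank_pureIm]
    simpa using hdim

/-- Each component contributes a vector killed by X₀. An orthonormal basis of the three-dimensional
span of these vectors generates mutually orthogonal copies of ℝ³, which are the rows of the matrix.
-/
theorem exists_isLinearModel333 (h : IsInfinitesimalModel ρ X B)
    (hinv : ∀ W : Submodule ℝ V, IsLieInvariant (d := d) ρ W ↔ ∀ k, ∀ w ∈ W, X k w ∈ W)
    (hs : HasNontrivialComponentDims (d := d) ρ {3, 3, 3}) :
    ∃ e, IsLinearModel ρ X B gen333 form333 e := by
  obtain ⟨L, W, T, hind, hT, hdim, hTs⟩ := h.exists_components hinv hs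
  have hcard : T.card = 3 := by simpa using congrArg Multiset.card hTs
  have h3 : ∀ i : T, Module.finrank ℝ (W i) = 3 := by
    intro i
    have : Module.finrank ℝ (W i) ∈ T.val.map fun i => Module.finrank ℝ (W i) :=
      Multiset.mem_map_of_mem _ i.2
    rw [hTs] at this
    simpa using this
  have hone := fun i : T => h.isSpinOne_of_mem (hT i i.2).1 (hT i i.2).2 (h3 i)
  choose u hu hu0 hXu using fun i : T => (hone i).2
  have hlin : LinearIndependent ℝ u :=
    (hind.comp Subtype.val_injective).linearIndependent (fun i : T => W i) hu hu0
  set K := Submodule.span ℝ (Set.range u) with hK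
  have hKfin : Module.finrank ℝ K = 3 := by
    rw [hK, finrank_span_eq_card hlin, Fintype.card_coe, hcard]
  have hKone : ∀ v ∈ K, IsSpinOne (linGen X) v := fun v hv => isSpinOne_of_mem_span (by
    rintro _ ⟨i, rfl⟩
    exact (hone i).1 _ (hu i)) hv
  have hK0 : K ≤ LinearMap.ker (linGen X 0) := by
    rw [hK, Submodule.span_le]
    rintro _ ⟨i, rfl⟩
    exact hXu i
  obtain ⟨b, hb⟩ := exists_orthonormal_basis (B.restrict K) (fun v w => h.symm v w)
    (fun v hv => h.pos v fun h => hv (Subtype.ext h)) hKfin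
  have hb' : ∀ r s, B (b r : V) (b s) = if r = s then 1 else 0 := hb
  have hb0 : ∀ r, X 0 (b r : V) = 0 := fun r => hK0 (b r).2
  have hb1 : ∀ r, IsSpinOne (linGen X) (b r : V) := fun r => hKone _ (b r).2
  have hJ : ∀ A, (∑ r, spinOneMap X (b r : V) ∘ₗ rowMap r) A =
      ∑ r, spinOneMap X (b r : V) (rowMap r A) := fun A => by simp
  refine h.exists_isLinearModel (∑ r, spinOneMap X (b r : V) ∘ₗ rowMap r) ?_ ?_ ?_ ?_ ?_
  · intro k A
    rw [hJ, hJ, map_sum]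
    exact Finset.sum_congr rfl fun r _ => by rw [h.apply_spinOneMap (hb1 r) (hb0 r), rowMap_gen333]
  · intro A C
    rw [hJ, hJ, form333_eq_sum]
    simp only [map_sum, LinearMap.sum_apply, h.form_spinOneMap (hb0 _) (hb1 _) (hb0 _), hb']
    simp
  · intro v hv A
    rw [hJ, map_sum]
    exact Finset.sum_eq_zero fun r _ => h.form_fixed_spinOneMap (hb1 r) (hb0 r) hv _
  · intro A hA
    rwa [form333, ← Matrix.conjTranspose_eq_transpose_of_trivial,
      Matrix.trace_mul_conjTranspose_self_eq_zero_iff] at hA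
  · rw [Module.finrank_matrix]
    simpa using hdim

end IsInfinitesimalModel

theorem IsLinearModel.finrank_eq {M : Type*} [AddCommGroup M] [Module ℝ M] [FiniteDimensional ℝ M]
    {Y : Fin 3 → M →ₗ[ℝ] M} {b : M → M → ℝ} {e : V ≃ₗ[ℝ] fixedSubspace ρ × M}
    (_ : IsLinearModel ρ X B Y b e) :
    Module.finrank ℝ V = Module.finrank ℝ (fixedSubspace ρ) + Module.finrank ℝ M := by
  rw [e.finrank_eq, Module.finrank_prod]

end ExistsModel

end OrbitSpaceSU2

end

/-! ### The theorem. -/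

theorem mainTheorem5 {d : ℕ} {G : Type*} [TopologicalSpace G] [T2Space G] [CompactSpace G]
    [ChartedSpace (EuclideanSpace ℝ (Fin d)) G] [Group G] [IsTopologicalGroup G]
    [LieGroup (𝓡 d) ∞ G]
    {V : Type*} [NormedAddCommGroup V] [NormedSpace ℝ V] [FiniteDimensional ℝ V]
    (ρ : G →* (V →L[ℝ] V))
    (hρ : ContMDiff (𝓡 d) 𝓘(ℝ, V →L[ℝ] V) ∞ (fun g : G => ρ g))
    (hg : Nonempty (GroupLieAlgebra (𝓡 d) G ≃ₗ⁅ℝ⁆ OrbitSpaceSU2.su2))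
    (hn : OrbitSpaceSU2.HasNontrivialComponentDims (d := d) ρ {4, 4} ∨
      OrbitSpaceSU2.HasNontrivialComponentDims (d := d) ρ {4, 3} ∨
      OrbitSpaceSU2.HasNontrivialComponentDims (d := d) ρ {3, 3, 3}) :
    Finite (G ⧸ OrbitSpaceSU2.idComponent G) ∧
    ∃ (m : ℕ) (φ : OrbitSpaceSU2.OrbitSpace ρ ≃ₜ EuclideanSpace ℝ (Fin m))
      (σ : Representation ℝ (G ⧸ OrbitSpaceSU2.idComponent G) (EuclideanSpace ℝ (Fin m))),
      ContDiff ℝ ∞ (fun v : V => φ (OrbitSpaceSU2.toOrbit ρ v)) ∧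
      (∀ (g : G) (v : V), φ (OrbitSpaceSU2.toOrbit ρ (ρ g v)) =
        σ (g : G ⧸ OrbitSpaceSU2.idComponent G) (φ (OrbitSpaceSU2.toOrbit ρ v))) ∧
      (OrbitSpaceSU2.HasNontrivialComponentDims (d := d) ρ {4, 4} →
        OrbitSpaceSU2.HasExplicitQuotientMap ρ φ OrbitSpaceSU2.act44 OrbitSpaceSU2.quot44) ∧
      (OrbitSpaceSU2.HasNontrivialComponentDims (d := d) ρ {4, 3} →
        OrbitSpaceSU2.HasExplicitQuotientMap ρ φ OrbitSpaceSU2.act43 OrbitSpaceSU2.quot43) ∧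
      (OrbitSpaceSU2.HasNontrivialComponentDims (d := d) ρ {3, 3, 3} →
        OrbitSpaceSU2.HasExplicitQuotientMap ρ φ OrbitSpaceSU2.act333 OrbitSpaceSU2.quot333) := by
  refine ⟨OrbitSpaceSU2.finite_quotient_idComponent d, ?_⟩
  obtain ⟨X, B, h, hinv⟩ := OrbitSpaceSU2.exists_isInfinitesimalModel ρ hρ hg
  -- The codimension of V₀ is 8, 7 or 9, so the three cases exclude each other and only one
  -- implication in the conclusion is not vacuous.
  have d44 : OrbitSpaceSU2.HasNontrivialComponentDims (d := d) ρ {4, 4} →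
      Module.finrank ℝ V = Module.finrank ℝ (OrbitSpaceSU2.fixedSubspace ρ) + 8 := by
    intro hs
    obtain ⟨e, he⟩ := h.exists_isLinearModel44 hinv hs
    rw [he.finrank_eq, Module.finrank_prod, Quaternion.finrank_eq_four]
  have d43 : OrbitSpaceSU2.HasNontrivialComponentDims (d := d) ρ {4, 3} →
      Module.finrank ℝ V = Module.finrank ℝ (OrbitSpaceSU2.fixedSubspace ρ) + 7 := by
    intro hs
    obtain ⟨e, he⟩ := h.exists_isLinearModel43 hinv hs
    rw [he.finrank_eq, Module.finrank_prod, Quaternion.finrank_eq_four,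
      OrbitSpaceSU2.finrank_pureIm]
  have d333 : OrbitSpaceSU2.HasNontrivialComponentDims (d := d) ρ {3, 3, 3} →
      Module.finrank ℝ V = Module.finrank ℝ (OrbitSpaceSU2.fixedSubspace ρ) + 9 := by
    intro hs
    obtain ⟨e, he⟩ := h.exists_isLinearModel333 hinv hs
    rw [he.finrank_eq, Module.finrank_matrix]
    simp
  rcases hn with hs | hs | hs
  · obtain ⟨e, he⟩ := h.exists_isLinearModel44 hinv hs
    obtain ⟨m, φ, σ, hφ, hσ, hq⟩ := he.exists_homeomorph44 h
    refine ⟨m, φ, σ, hφ, hσ, fun _ => hq, fun h' => ?_, fun h' => ?_⟩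
    · have := d44 hs; have := d43 h'; omega
    · have := d44 hs; have := d333 h'; omega
  · obtain ⟨e, he⟩ := h.exists_isLinearModel43 hinv hs
    obtain ⟨m, φ, σ, hφ, hσ, hq⟩ := he.exists_homeomorph43 h
    refine ⟨m, φ, σ, hφ, hσ, fun h' => ?_, fun _ => hq, fun h' => ?_⟩
    · have := d43 hs; have := d44 h'; omega
    · have := d43 hs; have := d333 h'; omega
  · obtain ⟨e, he⟩ := h.exists_isLinearModel333 hinv hs
    obtain ⟨m, φ, σ, hφ, hσ, hq⟩ := he.exists_homeomorph333 h
    refine ⟨m, φ, σ, hφ, hσ, fun h' => ?_, fun h' => ?_, fun _ => hq⟩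
    · have := d333 hs; have := d44 h'; omega
    · have := d333 hs; have := d43 h'; omega
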